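/- **Problem.** Let $3\le k$, $3\le k_0$, $k+k_0\le d$, $d'=d-k$, $0<\delta<1$, $\sigma\ge 0$, $\delta_S>0$. Let $\mathbf x_1,\dots,\mathbf x_T\in\mathbb R^d$ with $\|\mathbf x_s\|_\infty\le 1$, let $\mathbf w^*\in\mathbb R^d$ with $\|\mathbf w^*\|_1\le1$, $\|\mathbf w^*\|_0\le k$ and nonempty support $S$, and let $y_s=\langle\mathbf w^*,\mathbf x_s\rangle+\eta_s$ with independent noises $\eta_s\sim\mathcal N(0,\sigma^2)$. In round $s$ the learner uses $k$ attributes of $\mathbf x_s$ to predict, then sees $y_s$, then observes $k_0$ further attributes. For a set $A$ of coordinates, $\mathbf w(A)$ is $\mathbf w$ with the coordinates outside $A$ replaced by $0$. **Constants.** Put $g=\frac{(d'-1)(d'-2)}{(k_0-1)(k_0-2)}$, $L_1=\ln\frac d\delta$, $L_2=\ln\frac{d^2}\delta$, $\mu_1=\frac{9}{9-2\sqrt3}$, $\mu_2=\Bigl(1-\frac{\sqrt6}{9\sqrt{\frac{d'-2}{k_0-2}L_2}}\Bigr)^{-1}$, $$s_0=\frac{24^2k^2g}{\delta_S^4}L_2,\qquad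 s_1=\frac{24^2k^2g}{\delta_S^4}\,\frac{d'-2}{k_0-2}L_1L_2,\qquad n_0=\lceil s_0\rceil,\ n_1=\lceil s_1\rceil .$$ Let $\kappa\ge1.2$ be a parameter of the algorithm, and suppose that $\sigma\le1$ or $\kappa\ge1.7$. Put $$a_1=\bigl(\tfrac{64}{3}+\tfrac{32}{3}\sigma\bigr)L_1,\quad a_2=\tfrac{16(6.9+\kappa\sigma)}{3}\sqrt{L_1},\quad a_3=\tfrac83\sqrt{3L_1},$$ $$a_4=\delta_S^2\frac{a_1}{k}+24a_2\sqrt{\tfrac{k_0-2}{d'-2}L_2}+4a_3\Bigl(24\sqrt{L_2}+\frac{\delta_S^2}{k\sqrt g}\Bigr),$$ $$a_5=\frac{36}{9-2\sqrt3}\Bigl(\delta_S^2\frac{2+\sigma}{9k}+\frac8{\sqrt3}+\frac{\frac{\sqrt3}{9}\delta_S^2}{k\sqrt{gL_2}}\Bigr)+a_2+\frac{2\sqrt3\,a_2}{9-2\sqrt3}\sqrt{\frac{k_0-2}{(d'-2)L_2}} .$$ Define $\nu_s$ by $$\nu_s=\begin{cases} \frac{2}{\sqrt s}\sqrt{3gL_1},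 & s\le n_0,\\[2pt] \frac1s\sqrt{3gL_1}\bigl(\frac{48k}{\delta_S^2}\sqrt{gL_2}+2\bigr), & s=n_0+1,\\[2pt] \frac{n_0+1}{s}\nu_{n_0+1}+\frac1s\sqrt{3gL_1}\,\frac{\mu_1a_4}{\delta_S^4}\sqrt{\sum_{\tau=n_0+1}^{s-1}\frac{k^4g^2}{\tau^2}}, & n_0+1<s\le n_1,\\[2pt] \frac1s\sqrt{3gL_1}\Bigl(\frac{48k}{\delta_S^2}\sqrt{gL_2}+2+\frac{\mu_1a_4k^2g}{\delta_S^4}\sqrt{\sum_{\tau=n_0+1}^{n_1}\frac1{\tau^2}}\Bigr), & s=n_1+1,\\[2pt] \frac{n_1+1}{s}\nu_{n_1+1}+\frac1s\sqrt{3gL_1}\,\frac{\mu_2a_5}{\delta_S^2}\sqrt{\sum_{\tau=n_1+1}^{s-1}\frac{k^2(d'-1)}{\tau(k_0-1)}}, & s>n_1+1 \end{cases}$$ (where two cases overlap, the first one applies), and $$\hat\gamma_s=\bigl(\tfrac83+2\sigma\bigr)\frac gsL_1+(6.9+\kappa\sigma)\sqrt{\frac{d'-1}{s(k_0-1)}L_1}+\nu_s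 .$$ **Algorithm (DS-POSLRC).** Let $\hat{\mathbf w}_0=\frac1d\mathbf 1_d$ and let $S_0\subseteq[d]$ be arbitrary with $|S_0|=k$. In round $s=1,\dots,T$: predict $\hat y_s=\langle\hat{\mathbf w}_{s-1}(S_{s-1}),\mathbf x_s(S_{s-1})\rangle$; after $y_s$ is revealed, draw one attribute outside $S_{s-1}$ with probabilities proportional to $|\hat w_{s-1,i}|$, $i\notin S_{s-1}$ (uniformly if all these vanish), and $k_0-1$ further attributes outside $S_{s-1}$ uniformly without replacement; let $B'_s$ be the set of these $k_0$ attributes and $B_s=B'_s\cup S_{s-1}$. With probabilities taken conditionally on the past, put $\hat x_{s,i}=\frac{x_{s,i}}{\mathbb P[i\in B_s]}\mathbb I_{i\in B_s}$ and $h_s[i,j]=\frac{x_{s,i}x_{s,j}}{\mathbb P[i,j\in B_s]}\mathbb I_{i,j\in B_s}$ (including $i=j$). Let $\hat{\mathbf w}_s$ be any solution of the Dantzig selector $$\min_{\mathbf w}\|\mathbf w\|_1\quad\text{s.t.}\quad\Bigl\|\frac1s\sum_{\tau\le s}\hat{\mathbf x}_\tau y_\tau-\frac1s\sum_{\tau\le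 s}\mathbf h_\tau\mathbf w\Bigr\|_\infty\le\hat\gamma_s$$ (arbitrary if this problem is infeasible), and let $S_s$ be the set of indices of $k$ entries of $\hat{\mathbf w}_s$ of largest absolute value, ties broken arbitrarily. The noise $\eta_s$ is independent of everything that happened before round $s$. The regret is $\mathrm{Reg}(\mathbf w^*)=\sum_{s=1}^T\bigl[(\hat y_s-y_s)^2-(\langle\mathbf w^*,\mathbf x_s\rangle-y_s)^2\bigr]$. **Theorem.** Assume $T>(s_1+1)^2$ and that for every integer $s\in(s_0,T]$ the matrix $(\mathbf x_1,\dots,\mathbf x_s)$ satisfies the compatibility condition on $S$ with constant $\delta_S$: $$\frac{|S|\sum_{\tau\le s}\langle\mathbf x_\tau,\mathbf w\rangle^2}{s\,\|\mathbf w(S)\|_1^2}\ \ge\ \delta_S^2\qquad\text{for all }\mathbf w\ne0\text{ with }\|\mathbf w(S^c)\|_1\le\|\mathbf w(S)\|_1 .$$ Let $$M_T=\frac{48^2k^2g}{\delta_S^4}L_2+\frac{2.7\,a_4^2k^2g}{64\,\delta_S^4L_2}+9\mu_2^2a_5^2\,\frac{k^2(d'-1)}{\delta_S^4(k_0-1)}\ln\frac{T}{s_1+1}.$$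 Then, with probability at least $1-\bigl(T\bigl(6+\log_{1.5}\frac{d+k}{k-2}\bigr)+1\bigr)\delta$, the regret of DS-POSLRC satisfies $$\mathrm{Reg}(\mathbf w^*)\ \le\ M_T+2\sigma\sqrt{2M_T\ln\tfrac1\delta},$$ and this bound is at most $$C(1+\kappa\sigma)^2\Bigl(\frac{k^2d'^2}{\delta_S^4k_0^2}\ln\frac d\delta+\frac{k^2d'}{\delta_S^4k_0}\ln(T)\ln\frac{dT}\delta\Bigr)$$ with the universal constant $C=10^7$. -/

import Mathlib

open MeasureTheory ProbabilityTheory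
open scoped NNReal

noncomputable section

namespace POSLR

/-! ### Vectors -/

/-- The `ℓ₁`-norm. -/
def l1 {d : ℕ} (w : Fin d → ℝ) : ℝ := ∑ i, |w i|

/-- The vector `w(S)`: the coordinates outside `S` are replaced by `0`. -/
def restr {d : ℕ} (w : Fin d → ℝ) (S : Finset (Fin d)) : Fin d → ℝ :=
  fun i => if i ∈ S then w i else 0

/-- The support of a vector. -/
def supp {d : ℕ} (w : Fin d → ℝ) : Finset (Fin d) := Finset.univ.filter (fun i => w i ≠ 0)

/-- The cone `Ω_S` of nonzero `w` with `‖w(Sᶜ)‖₁ ≤ α ‖w(S)‖₁`. -/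
def cone {d : ℕ} (S : Finset (Fin d)) (α : ℝ) : Set (Fin d → ℝ) :=
  {w | w ≠ 0 ∧ l1 (restr w Sᶜ) ≤ α * l1 (restr w S)}

/-- The compatibility condition for the data matrix with columns `x 1, …, x s`: on the cone, the
ratio `|S| ‖Xᵀ w‖₂² / (s ‖w(S)‖₁²)` is at least `δS ^ 2`. The minimum over the cone makes sense
only for nonempty `S` (for `S = ∅` the cone is empty). -/
def Compatible {d : ℕ} (δS : ℝ) (S : Finset (Fin d)) (α : ℝ) (x : ℕ → Fin d → ℝ) (s : ℕ) : Prop :=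
  S.Nonempty ∧ ∀ w ∈ cone S α,
    δS ^ 2 ≤ ((S.card : ℝ) * ∑ τ ∈ Finset.Icc 1 s, (x τ ⬝ᵥ w) ^ 2) / ((s : ℝ) * l1 (restr w S) ^ 2)

/-! ### The sampling procedure -/

/-- The distribution of the first draw from `A`: proportional to `|w i|`, and uniform on `A` if `w`
vanishes on `A`. -/
def firstDraw {d : ℕ} (A : Finset (Fin d)) (w : Fin d → ℝ) (i : Fin d) : ℝ :=
  if ∑ j ∈ A, |w j| = 0 then 1 / (A.card : ℝ) else |w i| / ∑ j ∈ A, |w j|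

/-- `drawRest A n B C` is the probability that the set `B` is turned into `C` by adding, `n` times
in a row, a uniformly chosen element of `A` that has not been selected yet. -/
def drawRest {d : ℕ} (A : Finset (Fin d)) : ℕ → Finset (Fin d) → Finset (Fin d) → ℝ
  | 0, B, C => if C = B then 1 else 0
  | n + 1, B, C => ∑ j ∈ A \ B, 1 / ((A \ B).card : ℝ) * drawRest A n (insert j B) C

/-- The probability that sampling `n` elements of `A` (the first one from `firstDraw A w`, the other
`n - 1` uniformly without replacement) returns the set `C`. -/
def sampleProb {d : ℕ} (A : Finset (Fin d)) (n : ℕ) (w : Fin d → ℝ) (C : Finset (Fin d)) : ℝ :=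
  ∑ i ∈ A, firstDraw A w i * drawRest A (n - 1) {i} C

/-- The probability that both `i` and `j` belong to `C ∪ S`, where `C` is a sample of `n` elements of
the complement of `S`. For `i = j` it is the probability that `i` is observed. -/
def obsProb {d : ℕ} (S : Finset (Fin d)) (n : ℕ) (w : Fin d → ℝ) (i j : Fin d) : ℝ :=
  ∑ C : Finset (Fin d), if i ∈ C ∪ S ∧ j ∈ C ∪ S then sampleProb Sᶜ n w C else 0

/-- The estimator of `x` from the observed set `B = C ∪ S`. -/
def xHat {d : ℕ} (S : Finset (Fin d)) (n : ℕ) (w : Fin d → ℝ) (C : Finset (Fin d))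
    (x : Fin d → ℝ) : Fin d → ℝ :=
  fun i => if i ∈ C ∪ S then x i / obsProb S n w i i else 0

/-- The estimator of `x xᵀ` from the observed set `B = C ∪ S`. -/
def hHat {d : ℕ} (S : Finset (Fin d)) (n : ℕ) (w : Fin d → ℝ) (C : Finset (Fin d))
    (x : Fin d → ℝ) : Matrix (Fin d) (Fin d) ℝ :=
  Matrix.of fun i j => if i ∈ C ∪ S ∧ j ∈ C ∪ S then x i * x j / obsProb S n w i j else 0

/-! ### The Dantzig selector -/

/-- `w` satisfies the constraint of the Dantzig selector with threshold `γ`. -/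
def DSFeasible {d : ℕ} (b : Fin d → ℝ) (H : Matrix (Fin d) (Fin d) ℝ) (s : ℕ) (γ : ℝ)
    (w : Fin d → ℝ) : Prop :=
  ∀ i, |1 / (s : ℝ) * b i - 1 / (s : ℝ) * (H.mulVec w) i| ≤ γ

/-- `w` is a solution of the Dantzig selector: a feasible vector of minimal `ℓ₁`-norm. -/
def DSSolution {d : ℕ} (b : Fin d → ℝ) (H : Matrix (Fin d) (Fin d) ℝ) (s : ℕ) (γ : ℝ)
    (w : Fin d → ℝ) : Prop :=
  DSFeasible b H s γ w ∧ ∀ v, DSFeasible b H s γ v → l1 w ≤ l1 v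

/-- `S` consists of the indices of `k` entries of `w` of largest absolute value. -/
def IsTop {d : ℕ} (k : ℕ) (w : Fin d → ℝ) (S : Finset (Fin d)) : Prop :=
  S.card = k ∧ ∀ i ∈ S, ∀ j ∉ S, |w j| ≤ |w i|

/-! ### Parameters -/

/-- The parameters: `k` attributes are used for a prediction, `k₀` more are observed afterwards, `d`
is the dimension, `σ` is the standard deviation of the noise, `κ` is the coefficient of `σ` in the
`1/√s`-term of the threshold, `δS` is the constant of the compatibility condition, and `δ` is the
confidence parameter. -/
structure Params where
  k : ℕ
  k₀ : ℕ
  d : ℕ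
  σ : ℝ≥0
  κ : ℝ
  δS : ℝ
  δ : ℝ

namespace Params

variable (p : Params)

/-- `d' = d - k`. -/
def d' : ℝ := (p.d : ℝ) - p.k

/-- `g_{d',k₀}`. -/
def g : ℝ := ((p.d' - 1) * (p.d' - 2)) / (((p.k₀ : ℝ) - 1) * ((p.k₀ : ℝ) - 2))

/-- `ln (d / δ)`. -/
def L₁ : ℝ := Real.log (p.d / p.δ)

/-- `ln (d² / δ)`. -/
def L₂ : ℝ := Real.log ((p.d : ℝ) ^ 2 / p.δ)

def μ₁ : ℝ := 9 / (9 - 2 * √3)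

def μ₂ : ℝ := 1 / (1 - √6 / (9 * √((p.d' - 2) / ((p.k₀ : ℝ) - 2) * p.L₂)))

def s₀ : ℝ := 24 ^ 2 * (p.k : ℝ) ^ 2 * p.g / p.δS ^ 4 * p.L₂

def s₁ : ℝ :=
  24 ^ 2 * (p.k : ℝ) ^ 2 * p.g / p.δS ^ 4 * ((p.d' - 2) / ((p.k₀ : ℝ) - 2)) * p.L₁ * p.L₂

def a₁ : ℝ := (64 / 3 + 32 / 3 * (p.σ : ℝ)) * p.L₁

def a₂ : ℝ := 16 * (6.9 + p.κ * (p.σ : ℝ)) / 3 * √p.L₁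

def a₃ : ℝ := 8 / 3 * √(3 * p.L₁)

def a₄ : ℝ :=
  p.δS ^ 2 * (p.a₁ / p.k) + 24 * p.a₂ * √(((p.k₀ : ℝ) - 2) / (p.d' - 2) * p.L₂)
    + 4 * p.a₃ * (24 * √p.L₂ + p.δS ^ 2 / (p.k * √p.g))

def a₅ : ℝ :=
  36 / (9 - 2 * √3) *
      (p.δS ^ 2 * ((2 + (p.σ : ℝ)) / (9 * p.k)) + 8 / √3
        + (√3 / 9 * p.δS ^ 2) / (p.k * √(p.g * p.L₂)))
    + p.a₂ + 2 * √3 * p.a₂ / (9 - 2 * √3) * √(((p.k₀ : ℝ) - 2) / ((p.d' - 2) * p.L₂))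

/-- `s₀` rounded up, the last round of the first phase. -/
def n₀ : ℕ := ⌈p.s₀⌉₊

/-- `s₁` rounded up, the last round of the second phase. -/
def n₁ : ℕ := ⌈p.s₁⌉₊

/-- `ν_{n₀+1}`. -/
def νA : ℝ :=
  1 / ((p.n₀ : ℝ) + 1) * √(3 * p.g * p.L₁) * (48 * p.k / p.δS ^ 2 * √(p.g * p.L₂) + 2)

/-- `ν_{n₁+1}`. -/
def νB : ℝ :=
  1 / ((p.n₁ : ℝ) + 1) * √(3 * p.g * p.L₁) *
    (48 * p.k / p.δS ^ 2 * √(p.g * p.L₂) + 2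
      + μ₁ * p.a₄ * (p.k : ℝ) ^ 2 * p.g / p.δS ^ 4
        * √(∑ τ ∈ Finset.Icc (p.n₀ + 1) p.n₁, 1 / (τ : ℝ) ^ 2))

/-- The sequence `ν_s`. -/
def ν (s : ℕ) : ℝ :=
  if s ≤ p.n₀ then 2 / √(s : ℝ) * √(3 * p.g * p.L₁)
  else if s = p.n₀ + 1 then p.νA
  else if s ≤ p.n₁ then
    ((p.n₀ : ℝ) + 1) / s * p.νA + 1 / (s : ℝ) * √(3 * p.g * p.L₁) * (μ₁ * p.a₄ / p.δS ^ 4)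
      * √(∑ τ ∈ Finset.Icc (p.n₀ + 1) (s - 1), (p.k : ℝ) ^ 4 * p.g ^ 2 / (τ : ℝ) ^ 2)
  else if s = p.n₁ + 1 then p.νB
  else
    ((p.n₁ : ℝ) + 1) / s * p.νB + 1 / (s : ℝ) * √(3 * p.g * p.L₁) * (p.μ₂ * p.a₅ / p.δS ^ 2)
      * √(∑ τ ∈ Finset.Icc (p.n₁ + 1) (s - 1),
          (p.k : ℝ) ^ 2 * (p.d' - 1) / ((τ : ℝ) * ((p.k₀ : ℝ) - 1)))

/-- The threshold of the Dantzig selector in round `s`. -/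
def γHat (s : ℕ) : ℝ :=
  (8 / 3 + 2 * (p.σ : ℝ)) * (p.g / s) * p.L₁
    + (6.9 + p.κ * (p.σ : ℝ)) * √((p.d' - 1) / ((s : ℝ) * ((p.k₀ : ℝ) - 1)) * p.L₁) + p.ν s

/-- The leading part of the regret bound over `T` rounds. -/
def mainBound (T : ℕ) : ℝ :=
  48 ^ 2 * (p.k : ℝ) ^ 2 * p.g / p.δS ^ 4 * p.L₂
    + 2.7 * p.a₄ ^ 2 * (p.k : ℝ) ^ 2 * p.g / (64 * p.δS ^ 4 * p.L₂)
    + 9 * p.μ₂ ^ 2 * p.a₅ ^ 2 * ((p.k : ℝ) ^ 2 * (p.d' - 1) / (p.δS ^ 4 * ((p.k₀ : ℝ) - 1)))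
      * Real.log (T / (p.s₁ + 1))

/-- The regret bound over `T` rounds: the leading part and the term of lower order that comes from
the noise. -/
def regretBound (T : ℕ) : ℝ :=
  p.mainBound T + 2 * (p.σ : ℝ) * √(2 * p.mainBound T * Real.log (1 / p.δ))

end Params

/-! ### The algorithm -/

/-- A run of the algorithm DS-POSLRC over `T` rounds on the instances `x 1, …, x T`, with responses
`y s = ⟨wstar, x s⟩ + η s`, on a probability space `(Ω, P)`. -/
structure Run {Ω : Type*} [mΩ : MeasurableSpace Ω] (P : Measure Ω) (p : Params) (T : ℕ)
    (x : ℕ → Fin p.d → ℝ) (wstar : Fin p.d → ℝ) where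
  /-- `ℱ s` is the history up to the end of round `s`. -/
  ℱ : Filtration ℕ mΩ
  /-- the noise -/
  η : ℕ → Ω → ℝ
  /-- the attributes chosen after the prediction -/
  B' : ℕ → Ω → Finset (Fin p.d)
  /-- the estimators -/
  what : ℕ → Ω → Fin p.d → ℝ
  /-- the attributes used for the next prediction -/
  S : ℕ → Ω → Finset (Fin p.d)
  η_meas : ∀ s ∈ Finset.Icc 1 T, Measurable[ℱ s] (η s)
  B'_meas : ∀ s ∈ Finset.Icc 1 T, ∀ C, MeasurableSet[ℱ s] {ω | B' s ω = C}
  what_meas : ∀ s ≤ T, Measurable[ℱ s] (what s)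
  S_meas : ∀ s ≤ T, ∀ C, MeasurableSet[ℱ s] {ω | S s ω = C}
  /-- The noise of round `s` is a centred Gaussian variable of variance `σ²`. -/
  η_law : ∀ s ∈ Finset.Icc 1 T, P.map (η s) = gaussianReal 0 (p.σ ^ 2)
  /-- The noise of round `s` is independent of the past. -/
  η_indep : ∀ s ∈ Finset.Icc 1 T, Indep (MeasurableSpace.comap (η s) inferInstance) (ℱ (s - 1)) P
  /-- Given the past and the response of round `s`, the set `B' s` is a sample of `k₀` attributes
  outside `S (s - 1)`, whose first draw is governed by the estimator of the previous round. -/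
  B'_law : ∀ s ∈ Finset.Icc 1 T, ∀ C,
    P[{ω | B' s ω = C}.indicator (fun _ => (1 : ℝ)) |
        (ℱ (s - 1) : MeasurableSpace Ω) ⊔ MeasurableSpace.comap (η s) inferInstance]
      =ᵐ[P] fun ω => sampleProb (S (s - 1) ω)ᶜ p.k₀ (what (s - 1) ω) C
  what_zero : ∀ ω i, what 0 ω i = 1 / (p.d : ℝ)
  S_zero : ∀ ω, (S 0 ω).card = p.k
  /-- `what s` solves the Dantzig selector with threshold `γHat s` whenever that problem is
  feasible; nothing is assumed about `what s` otherwise. -/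
  what_sol : ∀ s ∈ Finset.Icc 1 T, ∀ ω,
    let b : Fin p.d → ℝ := fun i => ∑ τ ∈ Finset.Icc 1 s,
      xHat (S (τ - 1) ω) p.k₀ (what (τ - 1) ω) (B' τ ω) (x τ) i * (wstar ⬝ᵥ x τ + η τ ω)
    let H : Matrix (Fin p.d) (Fin p.d) ℝ := ∑ τ ∈ Finset.Icc 1 s,
      hHat (S (τ - 1) ω) p.k₀ (what (τ - 1) ω) (B' τ ω) (x τ)
    (∃ w, DSFeasible b H s (p.γHat s) w) → DSSolution b H s (p.γHat s) (what s ω)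
  S_top : ∀ s ∈ Finset.Icc 1 T, ∀ ω, IsTop p.k (what s ω) (S s ω)

namespace Run

variable {Ω : Type*} [MeasurableSpace Ω] {P : Measure Ω} {p : Params} {T : ℕ}
  {x : ℕ → Fin p.d → ℝ} {wstar : Fin p.d → ℝ}

/-- The response in round `s`. -/
def y (R : Run P p T x wstar) (s : ℕ) (ω : Ω) : ℝ := wstar ⬝ᵥ x s + R.η s ω

/-- The prediction in round `s`, which uses only the attributes in `S (s - 1)`. -/
def yhat (R : Run P p T x wstar) (s : ℕ) (ω : Ω) : ℝ :=
  restr (R.what (s - 1) ω) (R.S (s - 1) ω) ⬝ᵥ restr (x s) (R.S (s - 1) ω)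

/-- The regret against `wstar` after `T` rounds, for the square loss. -/
def regret (R : Run P p T x wstar) (ω : Ω) : ℝ :=
  ∑ s ∈ Finset.Icc 1 T, ((R.yhat s ω - R.y s ω) ^ 2 - (wstar ⬝ᵥ x s - R.y s ω) ^ 2)

end Run

end POSLR

end

/-!
The regret is `∑ D_s ^ 2 - 2 * ∑ D_s * η_s`, where `D_s` is the error of the prediction of round
`s` up to noise (`Run.regret_eq`). The second sum is a Gaussian martingale transform whose
variance is governed by the first one, so the matter is to bound `∑ D_s ^ 2` by the leading part
`mainBound` (`Run.sum_predErr_sq_le`).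

If the target `w*` is feasible for the Dantzig selector of round `s`, then the solution `ŵ_s` is
not longer than `w*` in `ℓ₁`-norm, the difference lies in the cone of the compatibility
condition, and the compatibility condition bounds the `ℓ₁`-error `Δ_s` on the support by the
threshold (`dantzig_error`). Passing to the `k` largest entries costs a constant:
`|D_{s+1}| ≤ 3 * Δ_s`, and the mass `q_{s+1} = ‖w*(S_sᶜ)‖₁` that the next prediction misses is at
most `2 * Δ_s` (`l1_restr_top_sub_le`, `l1_restr_compl_top_le`).

Whether `w*` is feasible is decided by row sums of the increments
`x̂_i * η + ∑ j, (x̂_i x_j - h_ij) w*_j`. Attributes in `S` are always observed, so only `j ∉ S` contributes, and the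
conditional variance of the sampling part is of order `g * q ^ 2`
(`SampleBounds.sum_exp_row_le`). Hence the row sums deviate by more than the threshold only with
small probability, unless the total variance proxy with `∑ q_τ ^ 2` is too large for it
(`Run.measure_row_abs_le`). Each `s` requires just one exponential supermartingale with a
deterministic exponent, tuned to the threshold: the random proxy enters through the exceptional
event, and no union over its possible sizes is needed. That the proxy is small enough follows by
induction over the rounds, as `q_τ ≤ 2 * Δ_{τ-1}` is controlled by the feasibility of `w*` in
the earlier rounds (`Run.targetFeasible`).

What remains is numerical. With `Θ = √(g L₁ s₀)`, `a = A / √R` and `e` the normalized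
coefficients of the threshold, one has `s * γHat s ≤ Θ * (b + 1.07 * a * √(s / s₀))` after the
first phase (`Params.Admissible.mul_γHat_le`), and the induction and the final sum become
polynomial inequalities in `a`, `e` and `√(s / s₀)` (`recursion_poly`, `mainBound_poly`). These
use that the logarithms are not small, `24 ≤ L₁`. This may be assumed because otherwise
`6 * T * δ ≥ 1`, so that the asserted probability is not positive (`Params.Admissible.L₁_ge_of_mul_lt`).
The failure probability obtained in this way, `(4 * T + 1) * δ`, is smaller than the one
asserted.
-/

namespace POSLR

/-! ### Inclusion probabilities of the sampling procedure -/

section Sampling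

variable {d : ℕ}

lemma drawRest_nonneg (A : Finset (Fin d)) (n : ℕ) (B C : Finset (Fin d)) :
    0 ≤ drawRest A n B C := by
  induction n generalizing B with
  | zero => simp only [drawRest]; split_ifs <;> norm_num
  | succ n ih =>
    simp only [drawRest]
    exact Finset.sum_nonneg fun j _ => mul_nonneg (by positivity) (ih _)

lemma card_sdiff_insert {A B : Finset (Fin d)} {j : Fin d} (hj : j ∈ A \ B) :
    (A \ insert j B).card + 1 = (A \ B).card := by
  have : A \ insert j B = (A \ B).erase j := by
    ext x; simp only [Finset.mem_sdiff, Finset.mem_insert, Finset.mem_erase]; tauto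
  rw [this, Finset.card_erase_add_one hj]

/-- Expectations under `drawRest` obey the recursion of the sampling procedure. -/
lemma sum_drawRest_succ (A : Finset (Fin d)) (n : ℕ) (B : Finset (Fin d))
    (f : Finset (Fin d) → ℝ) :
    ∑ C, drawRest A (n + 1) B C * f C
      = ∑ j ∈ A \ B, 1 / ((A \ B).card : ℝ) * ∑ C, drawRest A n (insert j B) C * f C := by
  simp only [drawRest, Finset.sum_mul, Finset.mul_sum]
  rw [Finset.sum_comm]
  simp only [mul_assoc]

lemma sum_drawRest_zero (A B : Finset (Fin d)) (f : Finset (Fin d) → ℝ) :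
    ∑ C, drawRest A 0 B C * f C = f B := by
  simp [drawRest]

lemma sum_drawRest (A : Finset (Fin d)) (n : ℕ) (B : Finset (Fin d)) (h : n ≤ (A \ B).card) :
    ∑ C, drawRest A n B C = 1 := by
  induction n generalizing B with
  | zero => simp [drawRest]
  | succ n ih =>
    have h1 := sum_drawRest_succ A n B (fun _ => 1)
    simp only [mul_one] at h1
    rw [h1, Finset.sum_congr rfl (g := fun _ => 1 / ((A \ B).card : ℝ))]
    · rw [Finset.sum_const, nsmul_eq_mul, mul_one_div_cancel]
      have : 0 < (A \ B).card := by omega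
      positivity
    · intro j hj
      have := card_sdiff_insert hj
      rw [ih _ (by omega), mul_one]

/-- The set of attributes only grows during the sampling. -/
lemma drawRest_eq_zero (A : Finset (Fin d)) (n : ℕ) (B C : Finset (Fin d)) (h : ¬ B ⊆ C) :
    drawRest A n B C = 0 := by
  induction n generalizing B with
  | zero =>
    simp only [drawRest]
    rw [if_neg]; rintro rfl; exact h le_rfl
  | succ n ih =>
    simp only [drawRest]
    refine Finset.sum_eq_zero fun j _ => ?_
    rw [ih _ (fun h' => h ((Finset.subset_insert _ _).trans h')), mul_zero]

lemma sum_drawRest_mem_of_mem (A : Finset (Fin d)) (n : ℕ) (B : Finset (Fin d))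
    (f : Finset (Fin d) → ℝ) (h : ∀ C, B ⊆ C → f C = 1) (hn : n ≤ (A \ B).card) :
    ∑ C, drawRest A n B C * f C = 1 := by
  rw [← sum_drawRest A n B hn]
  refine Finset.sum_congr rfl fun C _ => ?_
  by_cases hC : B ⊆ C
  · rw [h C hC, mul_one]
  · rw [drawRest_eq_zero A n B C hC, zero_mul]

/-- The probability that a given element that has not been selected yet is selected in the next `n`
draws. -/
lemma sum_drawRest_single (A : Finset (Fin d)) (n : ℕ) (B : Finset (Fin d)) (j : Fin d)
    (hj : j ∈ A \ B) (hn : n ≤ (A \ B).card) :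
    ∑ C, drawRest A n B C * (if j ∈ C then 1 else 0) = (n : ℝ) / (A \ B).card := by
  induction n generalizing B with
  | zero =>
    rw [sum_drawRest_zero]
    simp [(Finset.mem_sdiff.1 hj).2]
  | succ n ih =>
    rw [sum_drawRest_succ, ← Finset.add_sum_erase _ _ hj]
    have hN : 0 < (A \ B).card := by omega
    have hN' : (0 : ℝ) < (A \ B).card := by exact_mod_cast hN
    have hc := card_sdiff_insert hj
    rw [sum_drawRest_mem_of_mem A n (insert j B) _
      (fun C hC => if_pos (hC (Finset.mem_insert_self _ _))) (by omega)]
    have : ∀ l ∈ (A \ B).erase j, 1 / ((A \ B).card : ℝ) *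
        ∑ C, drawRest A n (insert l B) C * (if j ∈ C then 1 else 0)
        = 1 / ((A \ B).card : ℝ) * ((n : ℝ) / (((A \ B).card : ℝ) - 1)) := by
      intro l hl
      rw [Finset.mem_erase] at hl
      have hc' := card_sdiff_insert hl.2
      rw [ih (insert l B) ?_ (by omega)]
      · congr 2
        rw [← hc']; push_cast; ring
      · simp only [Finset.mem_sdiff, Finset.mem_insert, not_or] at hj ⊢
        exact ⟨hj.1, hl.1.symm, hj.2⟩
    rw [Finset.sum_congr rfl this, Finset.sum_const, Finset.card_erase_of_mem hj, nsmul_eq_mul]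
    push_cast [Nat.cast_sub hN]
    rcases Nat.eq_zero_or_pos n with rfl | hn0
    · simp
    · have : ((A \ B).card : ℝ) - 1 ≠ 0 := by
        have : (2 : ℝ) ≤ (A \ B).card := by exact_mod_cast (by omega)
        linarith
      field_simp
      ring

/-- The probability that two given elements that have not been selected yet are both selected in
the next `n` draws. -/
lemma sum_drawRest_pair (A : Finset (Fin d)) (n : ℕ) (B : Finset (Fin d)) (i j : Fin d)
    (hi : i ∈ A \ B) (hj : j ∈ A \ B) (hij : i ≠ j) (hn : n ≤ (A \ B).card) :
    ∑ C, drawRest A n B C * (if i ∈ C ∧ j ∈ C then 1 else 0)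
      = (n : ℝ) * (n - 1) / ((A \ B).card * ((A \ B).card - 1)) := by
  induction n generalizing B with
  | zero =>
    rw [sum_drawRest_zero]
    simp [(Finset.mem_sdiff.1 hj).2]
  | succ n ih =>
    have hi' : i ∈ (A \ B).erase j := Finset.mem_erase.2 ⟨hij, hi⟩
    rw [sum_drawRest_succ, ← Finset.add_sum_erase _ _ hj, ← Finset.add_sum_erase _ _ hi']
    have hc1 := Finset.card_erase_add_one hj
    have hc2 := Finset.card_erase_add_one hi'
    have hN : 2 ≤ (A \ B).card := by omega
    have hN' : (2 : ℝ) ≤ (A \ B).card := by exact_mod_cast hN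
    have key : ∀ a b : Fin d, a ∈ A \ B → b ∈ A \ B → a ≠ b →
        ∑ C, drawRest A n (insert a B) C * (if a ∈ C ∧ b ∈ C then 1 else 0)
          = (n : ℝ) / (((A \ B).card : ℝ) - 1) := by
      intro a b ha hb hab
      have hc := card_sdiff_insert ha
      have : ((A \ B).card : ℝ) - 1 = (A \ insert a B).card := by rw [← hc]; push_cast; ring
      rw [this, ← sum_drawRest_single A n (insert a B) b ?_ (by omega)]
      · refine Finset.sum_congr rfl fun C _ => ?_
        by_cases hC : insert a B ⊆ C
        · simp [hC (Finset.mem_insert_self _ _)]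
        · rw [drawRest_eq_zero A n _ C hC, zero_mul, zero_mul]
      · simp only [Finset.mem_sdiff, Finset.mem_insert, not_or] at hb ⊢
        exact ⟨hb.1, hab.symm, hb.2⟩
    rw [key i j hi hj hij]
    have k2 := key j i hj hi hij.symm
    simp only [and_comm (a := j ∈ _)] at k2
    rw [k2]
    have : ∀ l ∈ ((A \ B).erase j).erase i, 1 / ((A \ B).card : ℝ) *
        ∑ C, drawRest A n (insert l B) C * (if i ∈ C ∧ j ∈ C then 1 else 0)
        = 1 / ((A \ B).card : ℝ) * ((n : ℝ) * (n - 1) /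
          ((((A \ B).card : ℝ) - 1) * (((A \ B).card : ℝ) - 2))) := by
      intro l hl
      simp only [Finset.mem_erase] at hl
      have hc' := card_sdiff_insert hl.2.2
      rw [ih (insert l B) ?_ ?_ (by omega)]
      · congr 2
        rw [← hc']; push_cast; ring
      · simp only [Finset.mem_sdiff, Finset.mem_insert, not_or] at hi ⊢
        exact ⟨hi.1, hl.1.symm, hi.2⟩
      · simp only [Finset.mem_sdiff, Finset.mem_insert, not_or] at hj ⊢
        exact ⟨hj.1, hl.2.1.symm, hj.2⟩
    rw [Finset.sum_congr rfl this, Finset.sum_const, nsmul_eq_mul]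
    have hc3 : ((((A \ B).erase j).erase i).card : ℝ) = (A \ B).card - 2 := by
      rw [← hc1, ← hc2]; push_cast; ring
    rw [hc3]
    generalize ((A \ B).card : ℝ) = N at *
    have h1 : N ≠ 0 := by linarith
    have h2 : N - 1 ≠ 0 := by linarith
    push_cast
    rcases eq_or_ne N 2 with rfl | h3
    · have hn1 : n ≤ 1 := by
        have : (A \ B).card = 2 := by
          have : (((A \ B).erase j).erase i).card = 0 := by
            have : ((((A \ B).erase j).erase i).card : ℝ) = 0 := by rw [hc3]; ring
            exact_mod_cast this
          omega
        omega
      interval_cases n <;> norm_num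
    · have h3 : N - 2 ≠ 0 := sub_ne_zero.2 h3
      field_simp
      ring

lemma firstDraw_nonneg (A : Finset (Fin d)) (w : Fin d → ℝ) (i : Fin d) :
    0 ≤ firstDraw A w i := by
  unfold firstDraw
  split_ifs
  · positivity
  · exact div_nonneg (abs_nonneg _) (Finset.sum_nonneg fun _ _ => abs_nonneg _)

lemma sum_firstDraw (A : Finset (Fin d)) (w : Fin d → ℝ) (hA : A.Nonempty) :
    ∑ i ∈ A, firstDraw A w i = 1 := by
  unfold firstDraw
  by_cases h : ∑ j ∈ A, |w j| = 0
  · simp only [h, if_true, Finset.sum_const, nsmul_eq_mul]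
    have : (0 : ℝ) < A.card := by exact_mod_cast hA.card_pos
    field_simp
  · simp only [h, if_false, ← Finset.sum_div, div_self, ne_eq, not_false_eq_true]

lemma sampleProb_nonneg (A : Finset (Fin d)) (n : ℕ) (w : Fin d → ℝ) (C : Finset (Fin d)) :
    0 ≤ sampleProb A n w C :=
  Finset.sum_nonneg fun _ _ => mul_nonneg (firstDraw_nonneg _ _ _) (drawRest_nonneg _ _ _ _)

lemma sum_sampleProb_mul (A : Finset (Fin d)) (n : ℕ) (w : Fin d → ℝ)
    (f : Finset (Fin d) → ℝ) :
    ∑ C, sampleProb A n w C * f C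
      = ∑ i ∈ A, firstDraw A w i * ∑ C, drawRest A (n - 1) {i} C * f C := by
  simp only [sampleProb, Finset.sum_mul, Finset.mul_sum]
  rw [Finset.sum_comm]
  simp only [mul_assoc]

lemma card_sdiff_single {A : Finset (Fin d)} {i : Fin d} (hi : i ∈ A) :
    (A \ {i}).card + 1 = A.card := by
  rw [Finset.sdiff_singleton_eq_erase, Finset.card_erase_add_one hi]

lemma sum_sampleProb (A : Finset (Fin d)) (n : ℕ) (w : Fin d → ℝ) (hn : 1 ≤ n)
    (hA : n ≤ A.card) : ∑ C, sampleProb A n w C = 1 := by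
  have h := sum_sampleProb_mul A n w (fun _ => 1)
  simp only [mul_one] at h
  rw [h, ← sum_firstDraw A w (Finset.card_pos.1 (by omega))]
  refine Finset.sum_congr rfl fun i hi => ?_
  have := card_sdiff_single hi
  rw [sum_drawRest A (n - 1) {i} (by omega), mul_one]

/-- A lower bound for an expectation under the sampling, uniform in the first draw. -/
lemma le_sum_sampleProb_mul (A : Finset (Fin d)) (n : ℕ) (w : Fin d → ℝ) (hA : A.Nonempty)
    (f : Finset (Fin d) → ℝ) (c : ℝ)
    (h : ∀ i ∈ A, c ≤ ∑ C, drawRest A (n - 1) {i} C * f C) :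
    c ≤ ∑ C, sampleProb A n w C * f C := by
  rw [sum_sampleProb_mul]
  calc c = ∑ i ∈ A, firstDraw A w i * c := by rw [← Finset.sum_mul, sum_firstDraw A w hA, one_mul]
    _ ≤ _ := Finset.sum_le_sum fun i hi =>
      mul_le_mul_of_nonneg_left (h i hi) (firstDraw_nonneg _ _ _)

lemma le_sum_sampleProb_single (A : Finset (Fin d)) (n : ℕ) (w : Fin d → ℝ) (hn : 1 ≤ n)
    (hA : n ≤ A.card) (hA2 : 2 ≤ A.card) (j : Fin d) (hj : j ∈ A) :
    ((n : ℝ) - 1) / ((A.card : ℝ) - 1) ≤ ∑ C, sampleProb A n w C * (if j ∈ C then 1 else 0) := by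
  refine le_sum_sampleProb_mul A n w ⟨j, hj⟩ _ _ fun i hi => ?_
  have hc := card_sdiff_single hi
  have hA' : (2 : ℝ) ≤ A.card := by exact_mod_cast hA2
  have hnA : (n : ℝ) ≤ A.card := by exact_mod_cast hA
  rcases eq_or_ne j i with rfl | hij
  · rw [sum_drawRest_mem_of_mem A (n - 1) {j} _
      (fun C hC => if_pos (hC (Finset.mem_singleton_self _))) (by omega)]
    rw [div_le_one (by linarith)]; linarith
  · rw [sum_drawRest_single A (n - 1) {i} j (by simp [hj, hij]) (by omega), ← hc]
    push_cast [Nat.cast_sub hn]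
    rw [add_sub_cancel_right]

lemma le_sum_sampleProb_pair (A : Finset (Fin d)) (n : ℕ) (w : Fin d → ℝ) (hn : 2 ≤ n)
    (hA : n ≤ A.card) (hA3 : 3 ≤ A.card) (j l : Fin d) (hj : j ∈ A) (hl : l ∈ A) (hjl : j ≠ l) :
    (((n : ℝ) - 1) * (n - 2)) / (((A.card : ℝ) - 1) * (A.card - 2))
      ≤ ∑ C, sampleProb A n w C * (if j ∈ C ∧ l ∈ C then 1 else 0) := by
  have hA' : (3 : ℝ) ≤ A.card := by exact_mod_cast hA3
  have hnA : (n : ℝ) ≤ A.card := by exact_mod_cast hA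
  have hn' : (2 : ℝ) ≤ n := by exact_mod_cast hn
  have key : ∀ a b : Fin d, a ∈ A → b ∈ A → a ≠ b →
      (((n : ℝ) - 1) * (n - 2)) / (((A.card : ℝ) - 1) * (A.card - 2)) ≤
      ∑ C, drawRest A (n - 1) {a} C * (if a ∈ C ∧ b ∈ C then 1 else 0) := by
    intro a b ha hb hab
    have hc := card_sdiff_single ha
    have e : ∑ C, drawRest A (n - 1) {a} C * (if a ∈ C ∧ b ∈ C then 1 else 0)
        = ∑ C, drawRest A (n - 1) {a} C * (if b ∈ C then 1 else 0) := by
      refine Finset.sum_congr rfl fun C _ => ?_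
      by_cases hC : {a} ⊆ C
      · simp [hC (Finset.mem_singleton_self _)]
      · rw [drawRest_eq_zero A _ _ C hC, zero_mul, zero_mul]
    rw [e, sum_drawRest_single A (n - 1) {a} b (by simp [hb, hab.symm]) (by omega)]
    have : ((A \ {a}).card : ℝ) = A.card - 1 := by rw [← hc]; push_cast; ring
    rw [this]
    push_cast [Nat.cast_sub (by omega : 1 ≤ n)]
    rw [mul_div_mul_comm]
    refine mul_le_of_le_one_right (div_nonneg (by linarith) (by linarith)) ?_
    rw [div_le_one (by linarith)]; linarith
  refine le_sum_sampleProb_mul A n w ⟨j, hj⟩ _ _ fun i hi => ?_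
  have hc := card_sdiff_single hi
  rcases eq_or_ne i j with rfl | hij
  · exact key i l hi hl hjl
  rcases eq_or_ne i l with rfl | hil
  · simpa only [and_comm] using key i j hi hj hij
  · rw [sum_drawRest_pair A (n - 1) {i} j l (by simp [hj, hij.symm]) (by simp [hl, hil.symm]) hjl
      (by omega)]
    have : ((A \ {i}).card : ℝ) = A.card - 1 := by rw [← hc]; push_cast; ring
    rw [this]
    push_cast [Nat.cast_sub (by omega : 1 ≤ n)]
    apply le_of_eq
    congr 1 <;> ring

lemma obsProb_eq (S : Finset (Fin d)) (n : ℕ) (w : Fin d → ℝ) (i j : Fin d) :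
    obsProb S n w i j
      = ∑ C, sampleProb Sᶜ n w C * (if i ∈ C ∪ S ∧ j ∈ C ∪ S then 1 else 0) := by
  simp [obsProb]

lemma obsProb_le_diag (S : Finset (Fin d)) (n : ℕ) (w : Fin d → ℝ) (i j : Fin d) :
    obsProb S n w i j ≤ obsProb S n w i i := by
  rw [obsProb_eq, obsProb_eq]
  refine Finset.sum_le_sum fun C _ => mul_le_mul_of_nonneg_left ?_ (sampleProb_nonneg _ _ _ _)
  by_cases h : i ∈ C ∪ S
  · simp only [h, true_and, and_self, if_true]; split_ifs <;> norm_num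
  · simp [h]

lemma obsProb_eq_diag (S : Finset (Fin d)) (n : ℕ) (w : Fin d → ℝ) (i j : Fin d) (hj : j ∈ S) :
    obsProb S n w i j = obsProb S n w i i := by
  rw [obsProb_eq, obsProb_eq]
  refine Finset.sum_congr rfl fun C _ => ?_
  simp [hj]

lemma obsProb_comm (S : Finset (Fin d)) (n : ℕ) (w : Fin d → ℝ) (i j : Fin d) :
    obsProb S n w i j = obsProb S n w j i := by
  simp only [obsProb, and_comm]

lemma le_obsProb_diag (S : Finset (Fin d)) (n : ℕ) (w : Fin d → ℝ) (hn : 1 ≤ n)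
    (hS : n ≤ Sᶜ.card) (hS2 : 2 ≤ Sᶜ.card) (i : Fin d) :
    ((n : ℝ) - 1) / ((Sᶜ.card : ℝ) - 1) ≤ obsProb S n w i i := by
  rw [obsProb_eq]
  by_cases hi : i ∈ S
  · simp only [Finset.mem_union, hi, or_true, and_self, if_true, mul_one]
    rw [sum_sampleProb _ _ _ hn hS]
    have hA' : (2 : ℝ) ≤ Sᶜ.card := by exact_mod_cast hS2
    have hnA : (n : ℝ) ≤ Sᶜ.card := by exact_mod_cast hS
    rw [div_le_one (by linarith)]; linarith
  · simpa [hi] using le_sum_sampleProb_single Sᶜ n w hn hS hS2 i (by simpa using hi)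

lemma le_obsProb (S : Finset (Fin d)) (n : ℕ) (w : Fin d → ℝ) (hn : 2 ≤ n)
    (hS : n ≤ Sᶜ.card) (hS3 : 3 ≤ Sᶜ.card) (i j : Fin d) :
    (((n : ℝ) - 1) * (n - 2)) / (((Sᶜ.card : ℝ) - 1) * (Sᶜ.card - 2)) ≤ obsProb S n w i j := by
  have hA' : (3 : ℝ) ≤ Sᶜ.card := by exact_mod_cast hS3
  have hnA : (n : ℝ) ≤ Sᶜ.card := by exact_mod_cast hS
  have hn' : (2 : ℝ) ≤ n := by exact_mod_cast hn
  have hle : (((n : ℝ) - 1) * (n - 2)) / (((Sᶜ.card : ℝ) - 1) * (Sᶜ.card - 2))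
      ≤ ((n : ℝ) - 1) / ((Sᶜ.card : ℝ) - 1) := by
    rw [mul_div_mul_comm]
    refine mul_le_of_le_one_right (div_nonneg (by linarith) (by linarith)) ?_
    rw [div_le_one (by linarith)]; linarith
  have hdiag := fun i => hle.trans (le_obsProb_diag S n w (by omega) hS (by omega) i)
  by_cases hj : j ∈ S
  · rw [obsProb_eq_diag S n w i j hj]; exact hdiag i
  by_cases hi : i ∈ S
  · rw [obsProb_comm, obsProb_eq_diag S n w j i hi]; exact hdiag j
  rcases eq_or_ne i j with rfl | hij
  · exact hdiag i
  rw [obsProb_eq]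
  simpa [hi, hj] using le_sum_sampleProb_pair Sᶜ n w hn hS hS3 i j (by simpa using hi)
    (by simpa using hj) hij

end Sampling

end POSLR

namespace POSLR

/-! ### Exponential moments of the estimators, conditionally on the past -/

section ExpMoment

lemma exp_le_quadratic_of_nonpos {x : ℝ} (hx : x ≤ 0) : Real.exp x ≤ 1 + x + x ^ 2 / 2 := by
  have h := Real.quadratic_le_exp_of_nonneg (x := -x) (by linarith)
  rw [show Real.exp x = (Real.exp (-x))⁻¹ by rw [Real.exp_neg, inv_inv]]
  have hpos : 0 < 1 + -x + (-x) ^ 2 / 2 := by nlinarith [sq_nonneg x]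
  refine (inv_anti₀ hpos h).trans ?_
  rw [inv_le_iff_one_le_mul₀ hpos]
  nlinarith [sq_nonneg (x ^ 2)]

lemma exp_le_quadratic {x c β : ℝ} (hc : c ≤ 1) (hβ : 1 / 2 + 2 / 9 * c ≤ β) (hβ' : 1 / 2 ≤ β)
    (hx : x ≤ c) : Real.exp x ≤ 1 + x + β * x ^ 2 := by
  rcases le_total x 0 with h0 | h0
  · have := exp_le_quadratic_of_nonpos h0
    nlinarith [sq_nonneg x]
  · have := Real.exp_bound' h0 (hx.trans hc) (n := 3) (by norm_num)
    norm_num [Finset.sum_range_succ, Nat.factorial] at this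
    have h2 : x ^ 2 * (1 / 2 + 2 / 9 * x) ≤ x ^ 2 * β :=
      mul_le_mul_of_nonneg_left (by linarith) (sq_nonneg x)
    nlinarith

variable {ι : Type*} [Fintype ι]

lemma sum_mul_exp_le (π z : ι → ℝ) (hπ : ∀ c, 0 ≤ π c) (hπ1 : ∑ c, π c = 1)
    (hz : ∑ c, π c * z c = 0) {β zbar : ℝ} (hz2 : ∑ c, π c * z c ^ 2 ≤ zbar) (hβ : 0 ≤ β)
    (hexp : ∀ c, Real.exp (z c) ≤ 1 + z c + β * z c ^ 2) :
    ∑ c, π c * Real.exp (z c) ≤ Real.exp (β * zbar) := by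
  calc ∑ c, π c * Real.exp (z c) ≤ ∑ c, π c * (1 + z c + β * z c ^ 2) :=
        Finset.sum_le_sum fun c _ => mul_le_mul_of_nonneg_left (hexp c) (hπ c)
    _ = ∑ c, π c + ∑ c, π c * z c + β * ∑ c, π c * z c ^ 2 := by
        rw [Finset.mul_sum, ← Finset.sum_add_distrib, ← Finset.sum_add_distrib]
        exact Finset.sum_congr rfl fun c _ => by ring
    _ ≤ β * zbar + 1 := by
        rw [hπ1, hz]; nlinarith
    _ ≤ _ := Real.add_one_le_exp _

/-- A Bernstein-type bound for the sum of a small nonnegative variable `u` and a centred variable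
`z`. The parameter `η` balances the two contributions to the second moment. -/
lemma sum_mul_exp_add_le (π u z : ι → ℝ) (hπ : ∀ c, 0 ≤ π c) (hπ1 : ∑ c, π c = 1)
    {u₀ ubar zbar β η : ℝ} (hu : ∀ c, 0 ≤ u c) (hu' : ∀ c, u c ≤ u₀)
    (hubar : ∑ c, π c * u c ≤ ubar)
    (hz : ∑ c, π c * z c = 0) (hz2 : ∑ c, π c * z c ^ 2 ≤ zbar) (hβ : 0 ≤ β) (hη : 0 < η)
    (hu₀ : 0 ≤ u₀)
    (hexp : ∀ c, Real.exp (u c + z c) ≤ 1 + (u c + z c) + β * (u c + z c) ^ 2) :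
    ∑ c, π c * Real.exp (u c + z c)
      ≤ Real.exp (ubar * (1 + β * (1 + 1 / η) * u₀) + β * (1 + η) * zbar) := by
  have hη' : 0 < 1 / η := by positivity
  have hsq : ∀ c, (u c + z c) ^ 2 ≤ (1 + 1 / η) * (u₀ * u c) + (1 + η) * z c ^ 2 := by
    intro c
    have h1 : 2 * (u c * z c) ≤ 1 / η * u c ^ 2 + η * z c ^ 2 := by
      have h3 : 0 ≤ 1 / η * (u c - η * z c) ^ 2 := by positivity
      have h4 : 1 / η * (u c - η * z c) ^ 2
          = 1 / η * u c ^ 2 - 2 * (u c * z c) + η * z c ^ 2 := by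
        field_simp; ring
      linarith
    have h2 : u c ^ 2 ≤ u₀ * u c := by nlinarith [hu c, hu' c]
    nlinarith
  calc ∑ c, π c * Real.exp (u c + z c)
      ≤ ∑ c, π c * (1 + (u c + z c) + β * ((1 + 1 / η) * (u₀ * u c) + (1 + η) * z c ^ 2)) :=
        Finset.sum_le_sum fun c _ => mul_le_mul_of_nonneg_left
          ((hexp c).trans (by have := mul_le_mul_of_nonneg_left (hsq c) hβ; linarith)) (hπ c)
    _ = ∑ c, π c + ∑ c, π c * z c + (∑ c, π c * u c) * (1 + β * (1 + 1 / η) * u₀)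
          + β * (1 + η) * ∑ c, π c * z c ^ 2 := by
        rw [Finset.mul_sum, Finset.sum_mul, ← Finset.sum_add_distrib, ← Finset.sum_add_distrib,
          ← Finset.sum_add_distrib]
        exact Finset.sum_congr rfl fun c _ => by ring
    _ ≤ (ubar * (1 + β * (1 + 1 / η) * u₀) + β * (1 + η) * zbar) + 1 := by
        rw [hπ1, hz]
        have h1 : (∑ c, π c * u c) * (1 + β * (1 + 1 / η) * u₀)
            ≤ ubar * (1 + β * (1 + 1 / η) * u₀) :=
          mul_le_mul_of_nonneg_right hubar (by positivity)
        have h2 : β * (1 + η) * ∑ c, π c * z c ^ 2 ≤ β * (1 + η) * zbar :=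
          mul_le_mul_of_nonneg_left hz2 (by positivity)
        linarith
    _ ≤ _ := Real.add_one_le_exp _

end ExpMoment

section Estimators

variable {d : ℕ}

/-- Lower bounds for the observation probabilities: single attributes are observed with probability
at least `1 / K`, pairs with probability at least `1 / g`. -/
structure SampleBounds (S : Finset (Fin d)) (n : ℕ) (w : Fin d → ℝ) (K g : ℝ) : Prop where
  sum_one : ∑ C, sampleProb Sᶜ n w C = 1
  single : ∀ i, 1 / K ≤ obsProb S n w i i
  pair : ∀ i j, 1 / g ≤ obsProb S n w i j
  one_le : 1 ≤ K
  le : K ≤ g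

/-- The part of the estimation error of coordinate `i` of the gradient that comes from attribute
`j`. -/
noncomputable def rowErr (S : Finset (Fin d)) (n : ℕ) (w : Fin d → ℝ) (C : Finset (Fin d))
    (x : Fin d → ℝ) (i j : Fin d) : ℝ :=
  xHat S n w C x i * x j - hHat S n w C x i j

variable {S : Finset (Fin d)} {n : ℕ} {w : Fin d → ℝ} {K g : ℝ}

namespace SampleBounds

variable (h : SampleBounds S n w K g)
include h

lemma obs_pos (i j : Fin d) : 0 < obsProb S n w i j :=
  lt_of_lt_of_le (one_div_pos.2 (by linarith [h.one_le, h.le])) (h.pair i j)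

lemma obs_le_one (i j : Fin d) : obsProb S n w i j ≤ 1 := by
  refine (le_of_eq (obsProb_eq S n w i j)).trans
    ((Finset.sum_le_sum fun C _ => ?_).trans_eq h.sum_one)
  refine mul_le_of_le_one_right (sampleProb_nonneg _ _ _ _) ?_
  split_ifs
  · exact le_rfl
  · exact zero_le_one

lemma one_div_obs_le (i j : Fin d) : 1 / obsProb S n w i j ≤ g := by
  have hg : 0 < g := by linarith [h.one_le, h.le]
  have := h.pair i j
  rw [div_le_iff₀ hg] at this
  rw [div_le_iff₀ (h.obs_pos i j)]; linarith

lemma one_div_obs_diag_le (i : Fin d) : 1 / obsProb S n w i i ≤ K := by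
  have hg : 0 < K := by linarith [h.one_le, h.le]
  have := h.single i
  rw [div_le_iff₀ hg] at this
  rw [div_le_iff₀ (h.obs_pos i i)]; linarith

lemma sum_xHat_sq_le (x : Fin d → ℝ) (hx : ∀ i, |x i| ≤ 1) (i : Fin d) :
    ∑ C, sampleProb Sᶜ n w C * xHat S n w C x i ^ 2 ≤ K := by
  have hP := h.obs_pos i i
  have : ∑ C, sampleProb Sᶜ n w C * xHat S n w C x i ^ 2
      = x i ^ 2 / obsProb S n w i i ^ 2 *
        ∑ C, sampleProb Sᶜ n w C * (if i ∈ C ∪ S ∧ i ∈ C ∪ S then 1 else 0) := by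
    rw [Finset.mul_sum]
    refine Finset.sum_congr rfl fun C _ => ?_
    by_cases hi : i ∈ C ∪ S
    · simp only [xHat, hi, if_true, and_self]; ring
    · simp [xHat, hi]
  rw [this, ← obsProb_eq]
  have h1 := h.one_div_obs_diag_le i
  have h2 : x i ^ 2 ≤ 1 := (sq_le_one_iff_abs_le_one _).2 (hx i)
  calc x i ^ 2 / obsProb S n w i i ^ 2 * obsProb S n w i i
      = x i ^ 2 * (1 / obsProb S n w i i) := by field_simp
    _ ≤ 1 * (1 / obsProb S n w i i) := mul_le_mul_of_nonneg_right h2 (by positivity)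
    _ ≤ K := by linarith

lemma xHat_sq_le (x : Fin d → ℝ) (hx : ∀ i, |x i| ≤ 1) (i : Fin d) (C : Finset (Fin d)) :
    xHat S n w C x i ^ 2 ≤ K ^ 2 := by
  have hK := h.one_le
  have hP := h.obs_pos i i
  unfold xHat
  split_ifs
  · rw [sq_le_sq, abs_of_nonneg (by linarith : 0 ≤ K), abs_div, abs_of_pos hP]
    calc |x i| / obsProb S n w i i ≤ 1 / obsProb S n w i i :=
          div_le_div_of_nonneg_right (hx i) hP.le
      _ ≤ K := h.one_div_obs_diag_le i
  · rw [zero_pow two_ne_zero]; positivity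

lemma sum_hHat (x : Fin d → ℝ) (i j : Fin d) :
    ∑ C, sampleProb Sᶜ n w C * hHat S n w C x i j = x i * x j := by
  have hP := h.obs_pos i j
  have : ∑ C, sampleProb Sᶜ n w C * hHat S n w C x i j
      = x i * x j / obsProb S n w i j *
        ∑ C, sampleProb Sᶜ n w C * (if i ∈ C ∪ S ∧ j ∈ C ∪ S then 1 else 0) := by
    rw [Finset.mul_sum]
    refine Finset.sum_congr rfl fun C _ => ?_
    simp only [hHat, Matrix.of_apply]
    split_ifs <;> ring
  rw [this, ← obsProb_eq, div_mul_cancel₀ _ hP.ne']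

lemma sum_xHat (x : Fin d → ℝ) (i : Fin d) :
    ∑ C, sampleProb Sᶜ n w C * xHat S n w C x i = x i := by
  have hP := h.obs_pos i i
  have : ∑ C, sampleProb Sᶜ n w C * xHat S n w C x i
      = x i / obsProb S n w i i *
        ∑ C, sampleProb Sᶜ n w C * (if i ∈ C ∪ S ∧ i ∈ C ∪ S then 1 else 0) := by
    rw [Finset.mul_sum]
    refine Finset.sum_congr rfl fun C _ => ?_
    simp only [xHat, and_self]
    split_ifs <;> ring
  rw [this, ← obsProb_eq, div_mul_cancel₀ _ hP.ne']

omit h in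
lemma abs_mul_le_one (x : Fin d → ℝ) (hx : ∀ i, |x i| ≤ 1) (i j : Fin d) : |x i * x j| ≤ 1 := by
  rw [abs_mul]; exact mul_le_one₀ (hx i) (abs_nonneg _) (hx j)

lemma abs_hHat_le (x : Fin d → ℝ) (hx : ∀ i, |x i| ≤ 1) (i j : Fin d) (C : Finset (Fin d)) :
    |hHat S n w C x i j - x i * x j| ≤ g := by
  have hP := h.obs_pos i j
  have hxx := abs_mul_le_one x hx i j
  have hg := h.one_div_obs_le i j
  have h1 : 1 ≤ 1 / obsProb S n w i j := by rw [le_div_iff₀ hP]; linarith [h.obs_le_one i j]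
  simp only [hHat, Matrix.of_apply]
  split_ifs
  · rw [show x i * x j / obsProb S n w i j - x i * x j
      = x i * x j * (1 / obsProb S n w i j - 1) by ring, abs_mul,
      abs_of_nonneg (by linarith : 0 ≤ 1 / obsProb S n w i j - 1)]
    nlinarith [abs_nonneg (x i * x j)]
  · rw [zero_sub, abs_neg]; linarith

lemma sum_hHat_sub_sq_le (x : Fin d → ℝ) (hx : ∀ i, |x i| ≤ 1) (i j : Fin d) :
    ∑ C, sampleProb Sᶜ n w C * (hHat S n w C x i j - x i * x j) ^ 2 ≤ g := by
  have hP := h.obs_pos i j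
  have e1 : ∑ C, sampleProb Sᶜ n w C * hHat S n w C x i j ^ 2
      = (x i * x j) ^ 2 * (1 / obsProb S n w i j) := by
    have : ∑ C, sampleProb Sᶜ n w C * hHat S n w C x i j ^ 2
        = (x i * x j) ^ 2 / obsProb S n w i j ^ 2 *
          ∑ C, sampleProb Sᶜ n w C * (if i ∈ C ∪ S ∧ j ∈ C ∪ S then 1 else 0) := by
      rw [Finset.mul_sum]
      refine Finset.sum_congr rfl fun C _ => ?_
      simp only [hHat, Matrix.of_apply]
      split_ifs <;> ring
    rw [this, ← obsProb_eq]; field_simp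
  have e2 : ∑ C, sampleProb Sᶜ n w C * (hHat S n w C x i j - x i * x j) ^ 2
      = ∑ C, sampleProb Sᶜ n w C * hHat S n w C x i j ^ 2
        - 2 * (x i * x j) * ∑ C, sampleProb Sᶜ n w C * hHat S n w C x i j
        + (x i * x j) ^ 2 * ∑ C, sampleProb Sᶜ n w C := by
    rw [Finset.mul_sum, Finset.mul_sum, ← Finset.sum_sub_distrib, ← Finset.sum_add_distrib]
    exact Finset.sum_congr rfl fun C _ => by ring
  rw [e2, e1, h.sum_hHat, h.sum_one]
  have h2 : (x i * x j) ^ 2 ≤ 1 := (sq_le_one_iff_abs_le_one _).2 (abs_mul_le_one x hx i j)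
  have h3 := h.one_div_obs_le i j
  have h4 : 0 ≤ 1 / obsProb S n w i j := by positivity
  nlinarith [sq_nonneg (x i * x j)]

/-- Exponential moments of the error of one entry of the estimated Gram matrix. -/
lemma sum_exp_hHat_le (x : Fin d → ℝ) (hx : ∀ i, |x i| ≤ 1) (i j : Fin d) (lam : ℝ)
    (hlam : |lam| * g ≤ 3 / 4) :
    ∑ C, sampleProb Sᶜ n w C * Real.exp (lam * (hHat S n w C x i j - x i * x j))
      ≤ Real.exp (2 / 3 * lam ^ 2 * g) := by
  have := sum_mul_exp_le (sampleProb Sᶜ n w) (fun C => lam * (hHat S n w C x i j - x i * x j))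
    (fun C => sampleProb_nonneg _ _ _ _) h.sum_one ?_ (β := 2 / 3) (zbar := lam ^ 2 * g) ?_
    (by norm_num) ?_
  · rwa [mul_assoc]
  · have e : ∑ C, sampleProb Sᶜ n w C * (lam * (hHat S n w C x i j - x i * x j))
        = lam * (∑ C, sampleProb Sᶜ n w C * hHat S n w C x i j
          - x i * x j * ∑ C, sampleProb Sᶜ n w C) := by
      rw [Finset.mul_sum, ← Finset.sum_sub_distrib, Finset.mul_sum]
      exact Finset.sum_congr rfl fun C _ => by ring
    rw [e, h.sum_hHat, h.sum_one]; ring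
  · have e : ∑ C, sampleProb Sᶜ n w C * (lam * (hHat S n w C x i j - x i * x j)) ^ 2
        = lam ^ 2 * ∑ C, sampleProb Sᶜ n w C * (hHat S n w C x i j - x i * x j) ^ 2 := by
      rw [Finset.mul_sum]
      exact Finset.sum_congr rfl fun C _ => by ring
    rw [e]
    exact mul_le_mul_of_nonneg_left (h.sum_hHat_sub_sq_le x hx i j) (sq_nonneg _)
  · intro C
    refine exp_le_quadratic (c := 3 / 4) (by norm_num) (by norm_num) (by norm_num) ?_
    refine (le_abs_self _).trans ?_
    rw [abs_mul]
    exact (mul_le_mul_of_nonneg_left (h.abs_hHat_le x hx i j C) (abs_nonneg _)).trans hlam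

omit h in
lemma rowErr_of_mem (x : Fin d → ℝ) (i j : Fin d) (hj : j ∈ S) (C : Finset (Fin d)) :
    rowErr S n w C x i j = 0 := by
  simp only [rowErr, xHat, hHat, Matrix.of_apply, obsProb_eq_diag S n w i j hj]
  by_cases hi : i ∈ C ∪ S
  · rw [if_pos hi, if_pos ⟨hi, Finset.mem_union_right _ hj⟩]; ring
  · rw [if_neg hi, if_neg (fun h => hi h.1)]; ring

lemma sum_rowErr (x : Fin d → ℝ) (i j : Fin d) :
    ∑ C, sampleProb Sᶜ n w C * rowErr S n w C x i j = 0 := by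
  have : ∑ C, sampleProb Sᶜ n w C * rowErr S n w C x i j
      = (∑ C, sampleProb Sᶜ n w C * xHat S n w C x i) * x j
        - ∑ C, sampleProb Sᶜ n w C * hHat S n w C x i j := by
    rw [Finset.sum_mul, ← Finset.sum_sub_distrib]
    exact Finset.sum_congr rfl fun C _ => by simp only [rowErr]; ring
  rw [this, h.sum_xHat, h.sum_hHat, sub_self]

lemma abs_rowErr_le (x : Fin d → ℝ) (hx : ∀ i, |x i| ≤ 1) (i j : Fin d) (C : Finset (Fin d)) :
    |rowErr S n w C x i j| ≤ g := by
  have hxx := abs_mul_le_one x hx i j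
  have hP := h.obs_pos i j
  have hP' := h.obs_pos i i
  have h1 := h.one_div_obs_le i j
  have h2 := h.one_div_obs_diag_le i
  have h3 : 1 / obsProb S n w i i ≤ 1 / obsProb S n w i j :=
    one_div_le_one_div_of_le hP (obsProb_le_diag S n w i j)
  have h4 : 0 < 1 / obsProb S n w i i := by positivity
  simp only [rowErr, xHat, hHat, Matrix.of_apply]
  by_cases hi : i ∈ C ∪ S
  · by_cases hj : j ∈ C ∪ S
    · rw [if_pos hi, if_pos ⟨hi, hj⟩, show x i / obsProb S n w i i * x j - x i * x j /
        obsProb S n w i j = x i * x j * (1 / obsProb S n w i i - 1 / obsProb S n w i j) by ring,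
        abs_mul, abs_of_nonpos (by linarith : 1 / obsProb S n w i i - 1 / obsProb S n w i j ≤ 0)]
      nlinarith [abs_nonneg (x i * x j)]
    · rw [if_pos hi, if_neg (fun h => hj h.2), sub_zero,
        show x i / obsProb S n w i i * x j = x i * x j * (1 / obsProb S n w i i) by ring, abs_mul,
        abs_of_pos h4]
      nlinarith [abs_nonneg (x i * x j)]
  · rw [if_neg hi, if_neg (fun h => hi h.1)]
    simp only [zero_mul, sub_self, abs_zero]; linarith

lemma sum_rowErr_sq_le (x : Fin d → ℝ) (hx : ∀ i, |x i| ≤ 1) (i j : Fin d) :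
    ∑ C, sampleProb Sᶜ n w C * rowErr S n w C x i j ^ 2 ≤ g := by
  have hP := h.obs_pos i j
  have hP' := h.obs_pos i i
  have e : ∑ C, sampleProb Sᶜ n w C * rowErr S n w C x i j ^ 2
      = (x i * x j) ^ 2 * ((1 / obsProb S n w i i ^ 2) *
            ∑ C, sampleProb Sᶜ n w C * (if i ∈ C ∪ S ∧ i ∈ C ∪ S then 1 else 0)
          + (1 / obsProb S n w i j ^ 2 - 2 / (obsProb S n w i i * obsProb S n w i j)) *
            ∑ C, sampleProb Sᶜ n w C * (if i ∈ C ∪ S ∧ j ∈ C ∪ S then 1 else 0)) := by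
    rw [Finset.mul_sum, Finset.mul_sum, ← Finset.sum_add_distrib, Finset.mul_sum]
    refine Finset.sum_congr rfl fun C _ => ?_
    simp only [rowErr, xHat, hHat, Matrix.of_apply]
    by_cases hi : i ∈ C ∪ S
    · by_cases hj : j ∈ C ∪ S
      · simp only [hi, hj, and_self, if_true]
        field_simp; ring
      · simp only [hi, hj, and_self, and_false, if_true, if_false]
        field_simp; ring
    · simp only [hi, false_and, if_false]; ring
  rw [e, ← obsProb_eq, ← obsProb_eq]
  have h2 : (x i * x j) ^ 2 ≤ 1 := (sq_le_one_iff_abs_le_one _).2 (abs_mul_le_one x hx i j)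
  have h3 := h.one_div_obs_le i j
  have h3' : 1 / obsProb S n w i i ≤ 1 / obsProb S n w i j :=
    one_div_le_one_div_of_le hP (obsProb_le_diag S n w i j)
  have h4 : 0 < 1 / obsProb S n w i i := by positivity
  have e2 : (1 / obsProb S n w i i ^ 2) * obsProb S n w i i
      + (1 / obsProb S n w i j ^ 2 - 2 / (obsProb S n w i i * obsProb S n w i j)) *
        obsProb S n w i j = 1 / obsProb S n w i j - 1 / obsProb S n w i i := by
    field_simp; ring
  rw [e2]
  nlinarith [sq_nonneg (x i * x j)]

/-- Exponential moments of the error of one coordinate of the estimated gradient at `v`: the noise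
enters through `xHat` and has been averaged out, the sampling error enters through `rowErr`. Only
the coordinates of `v` that were not used for the prediction contribute. -/
lemma sum_exp_row_le (x v : Fin d → ℝ) (hx : ∀ i, |x i| ≤ 1) (i : Fin d) (lam σ c β η c₁ c₂ : ℝ)
    (hv : l1 (restr v Sᶜ) ≤ 1)
    (hc : (|lam| * σ * K) ^ 2 / 2 + |lam| * g ≤ c) (hc1 : c ≤ 1)
    (hβ : 1 / 2 + 2 / 9 * c ≤ β) (hβ' : 1 / 2 ≤ β) (hη : 0 < η)
    (hc₁ : 1 + β * (1 + 1 / η) * ((|lam| * σ * K) ^ 2 / 2) ≤ c₁) (hc₂ : 2 * β * (1 + η) ≤ c₂) :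
    ∑ C, sampleProb Sᶜ n w C * Real.exp ((lam * xHat S n w C x i) ^ 2 * σ ^ 2 / 2
        + lam * ∑ j, rowErr S n w C x i j * v j)
      ≤ Real.exp (lam ^ 2 / 2 * (c₁ * σ ^ 2 * K + c₂ * g * l1 (restr v Sᶜ) ^ 2)) := by
  set q := l1 (restr v Sᶜ) with hq
  have hq0 : 0 ≤ q := Finset.sum_nonneg fun _ _ => abs_nonneg _
  have hqs : q = ∑ j ∈ Sᶜ, |v j| := by
    rw [hq, l1, ← Finset.sum_subset (Finset.subset_univ Sᶜ)]
    · exact Finset.sum_congr rfl fun j hj => by simp only [restr, if_pos hj]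
    · intro j _ hj; simp [restr, hj]
  have hg : 0 ≤ g := by linarith [h.one_le, h.le]
  have hZ : ∀ C, ∑ j, rowErr S n w C x i j * v j = ∑ j ∈ Sᶜ, rowErr S n w C x i j * v j := by
    intro C
    rw [← Finset.sum_subset (Finset.subset_univ Sᶜ)]
    intro j _ hj
    rw [rowErr_of_mem x i j (by simpa using hj), zero_mul]
  have hZabs : ∀ C, |∑ j, rowErr S n w C x i j * v j| ≤ g := by
    intro C
    rw [hZ]
    refine (Finset.abs_sum_le_sum_abs _ _).trans ?_
    calc ∑ j ∈ Sᶜ, |rowErr S n w C x i j * v j| ≤ ∑ j ∈ Sᶜ, g * |v j| :=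
          Finset.sum_le_sum fun j _ => by
            rw [abs_mul]
            exact mul_le_mul_of_nonneg_right (h.abs_rowErr_le x hx i j C) (abs_nonneg _)
      _ = g * q := by rw [← Finset.mul_sum, hqs]
      _ ≤ g := mul_le_of_le_one_right hg hv
  have hZsq : ∀ C, (∑ j, rowErr S n w C x i j * v j) ^ 2
      ≤ q * ∑ j ∈ Sᶜ, |v j| * rowErr S n w C x i j ^ 2 := by
    intro C
    rw [hZ, hqs]
    have := Finset.sum_sq_le_sum_mul_sum_of_sq_le_mul Sᶜ
      (r := fun j => rowErr S n w C x i j * v j) (f := fun j => |v j|)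
      (g := fun j => |v j| * rowErr S n w C x i j ^ 2)
      (fun j _ => abs_nonneg _) (fun j _ => by positivity)
      (fun j _ => by
        have : |v j| * |v j| = v j ^ 2 := by rw [← sq, sq_abs]
        rw [← mul_assoc, this]; exact le_of_eq (by ring))
    exact this
  have hu₀ : 0 ≤ (|lam| * σ * K) ^ 2 / 2 := by positivity
  have main := sum_mul_exp_add_le (sampleProb Sᶜ n w)
    (fun C => (lam * xHat S n w C x i) ^ 2 * σ ^ 2 / 2)
    (fun C => lam * ∑ j, rowErr S n w C x i j * v j) (fun C => sampleProb_nonneg _ _ _ _)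
    h.sum_one (u₀ := (|lam| * σ * K) ^ 2 / 2) (ubar := lam ^ 2 / 2 * (σ ^ 2 * K))
    (zbar := lam ^ 2 * (g * q ^ 2)) (β := β) (η := η) (fun C => by positivity) ?_ ?_ ?_ ?_
    (by linarith) hη hu₀ ?_
  · refine main.trans (Real.exp_le_exp.2 ?_)
    have hK := h.one_le
    have e1 : lam ^ 2 / 2 * (σ ^ 2 * K) * (1 + β * (1 + 1 / η) * ((|lam| * σ * K) ^ 2 / 2))
        ≤ lam ^ 2 / 2 * (σ ^ 2 * K) * c₁ := mul_le_mul_of_nonneg_left hc₁ (by positivity)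
    have e2 : lam ^ 2 / 2 * (g * q ^ 2) * (2 * β * (1 + η)) ≤ lam ^ 2 / 2 * (g * q ^ 2) * c₂ :=
      mul_le_mul_of_nonneg_left hc₂ (by positivity)
    nlinarith
  · intro C
    have := h.xHat_sq_le x hx i C
    have e : (|lam| * σ * K) ^ 2 / 2 = lam ^ 2 * σ ^ 2 / 2 * K ^ 2 := by
      rw [mul_pow, mul_pow, sq_abs]; ring
    rw [e, mul_pow]
    have h3 : lam ^ 2 * σ ^ 2 / 2 * xHat S n w C x i ^ 2 ≤ lam ^ 2 * σ ^ 2 / 2 * K ^ 2 :=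
      mul_le_mul_of_nonneg_left this (by positivity)
    linarith
  · have e : ∑ C, sampleProb Sᶜ n w C * ((lam * xHat S n w C x i) ^ 2 * σ ^ 2 / 2)
        = lam ^ 2 / 2 * (σ ^ 2 * ∑ C, sampleProb Sᶜ n w C * xHat S n w C x i ^ 2) := by
      rw [Finset.mul_sum, Finset.mul_sum]
      exact Finset.sum_congr rfl fun C _ => by ring
    rw [e]
    exact mul_le_mul_of_nonneg_left (mul_le_mul_of_nonneg_left (h.sum_xHat_sq_le x hx i)
      (sq_nonneg _)) (by positivity)
  · have e : ∑ C, sampleProb Sᶜ n w C * (lam * ∑ j, rowErr S n w C x i j * v j)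
        = lam * ∑ j, v j * ∑ C, sampleProb Sᶜ n w C * rowErr S n w C x i j := by
      simp only [Finset.mul_sum]
      rw [Finset.sum_comm]
      exact Finset.sum_congr rfl fun j _ => Finset.sum_congr rfl fun C _ => by ring
    rw [e]
    simp [h.sum_rowErr]
  · have e : ∑ C, sampleProb Sᶜ n w C * (lam * ∑ j, rowErr S n w C x i j * v j) ^ 2
        ≤ lam ^ 2 * (q * ∑ j ∈ Sᶜ, |v j| * ∑ C, sampleProb Sᶜ n w C
            * rowErr S n w C x i j ^ 2) := by
      have e' : lam ^ 2 * (q * ∑ j ∈ Sᶜ, |v j| * ∑ C, sampleProb Sᶜ n w C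
            * rowErr S n w C x i j ^ 2)
          = ∑ C, sampleProb Sᶜ n w C * (lam ^ 2 * (q * ∑ j ∈ Sᶜ, |v j| *
            rowErr S n w C x i j ^ 2)) := by
        simp only [Finset.mul_sum]
        rw [Finset.sum_comm]
        exact Finset.sum_congr rfl fun j _ => Finset.sum_congr rfl fun C _ => by ring
      rw [e']
      refine Finset.sum_le_sum fun C _ => mul_le_mul_of_nonneg_left ?_ (sampleProb_nonneg _ _ _ _)
      rw [mul_pow]
      exact mul_le_mul_of_nonneg_left (hZsq C) (sq_nonneg _)
    refine e.trans (mul_le_mul_of_nonneg_left ?_ (sq_nonneg _))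
    calc q * ∑ j ∈ Sᶜ, |v j| * ∑ C, sampleProb Sᶜ n w C * rowErr S n w C x i j ^ 2
        ≤ q * ∑ j ∈ Sᶜ, |v j| * g := mul_le_mul_of_nonneg_left (Finset.sum_le_sum fun j _ =>
          mul_le_mul_of_nonneg_left (h.sum_rowErr_sq_le x hx i j) (abs_nonneg _)) hq0
      _ = g * q ^ 2 := by rw [← Finset.sum_mul, ← hqs]; ring
  · intro C
    refine exp_le_quadratic hc1 hβ hβ' (le_trans ?_ hc)
    have h1 := h.xHat_sq_le x hx i C
    have e : (|lam| * σ * K) ^ 2 / 2 = lam ^ 2 * σ ^ 2 / 2 * K ^ 2 := by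
      rw [mul_pow, mul_pow, sq_abs]; ring
    have h3 : lam ^ 2 * σ ^ 2 / 2 * xHat S n w C x i ^ 2 ≤ lam ^ 2 * σ ^ 2 / 2 * K ^ 2 :=
      mul_le_mul_of_nonneg_left h1 (by positivity)
    have h4 : lam * ∑ j, rowErr S n w C x i j * v j ≤ |lam| * g := by
      refine (le_abs_self _).trans ?_
      rw [abs_mul]
      exact mul_le_mul_of_nonneg_left (hZabs C) (abs_nonneg _)
    rw [e, mul_pow]; linarith

end SampleBounds

end Estimators

end POSLR

namespace POSLR

/-! ### Exponential supermartingales -/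

section Supermartingale

open scoped ENNReal

variable {Ω : Type*} {m mΩ : MeasurableSpace Ω} {P : Measure Ω}

/-- Averaging out a centred Gaussian variable that is independent of `m`. -/
lemma lintegral_mul_exp_gaussian [IsProbabilityMeasure P] (hm : m ≤ mΩ)
    {η : Ω → ℝ} (hη : Measurable η) {v : ℝ≥0} (hlaw : P.map η = gaussianReal 0 v)
    (hind : Indep (MeasurableSpace.comap η inferInstance) m P)
    {W : Ω → ℝ≥0∞} (hW : Measurable[m] W) {α : Ω → ℝ} (hα : Measurable[m] α) :
    ∫⁻ ω, W ω * ENNReal.ofReal (Real.exp (α ω * η ω)) ∂P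
      = ∫⁻ ω, W ω * ENNReal.ofReal (Real.exp (α ω ^ 2 * v / 2)) ∂P := by
  have hW' : Measurable W := hW.mono hm le_rfl
  have hα' : Measurable α := hα.mono hm le_rfl
  have hWα : Measurable[m] (fun ω => (W ω, α ω)) := hW.prodMk hα
  have hWα' : Measurable (fun ω => (W ω, α ω)) := hW'.prodMk hα'
  have hi : IndepFun (fun ω => (W ω, α ω)) η P :=
    (IndepFun_iff_Indep _ _ _).2 (indep_of_indep_of_le_left hind.symm hWα.comap_le)
  have hmap := (indepFun_iff_map_prod_eq_prod_map_map hWα'.aemeasurable hη.aemeasurable).1 hi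
  have hF : Measurable
      (fun p : (ℝ≥0∞ × ℝ) × ℝ => p.1.1 * ENNReal.ofReal (Real.exp (p.1.2 * p.2))) := by
    fun_prop
  have hF1 : Measurable
      (fun p : ℝ≥0∞ × ℝ => p.1 * ENNReal.ofReal (Real.exp (p.2 ^ 2 * v / 2))) := by
    fun_prop
  calc ∫⁻ ω, W ω * ENNReal.ofReal (Real.exp (α ω * η ω)) ∂P
      = ∫⁻ p, p.1.1 * ENNReal.ofReal (Real.exp (p.1.2 * p.2))
          ∂(P.map (fun ω => ((W ω, α ω), η ω))) := by
        rw [lintegral_map hF (hWα'.prodMk hη)]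
    _ = ∫⁻ q, ∫⁻ t, q.1 * ENNReal.ofReal (Real.exp (q.2 * t)) ∂(gaussianReal 0 v)
          ∂(P.map (fun ω => (W ω, α ω))) := by
        rw [hmap, hlaw, lintegral_prod _ hF.aemeasurable]
    _ = ∫⁻ q, q.1 * ENNReal.ofReal (Real.exp (q.2 ^ 2 * v / 2))
          ∂(P.map (fun ω => (W ω, α ω))) := by
        refine lintegral_congr fun q => ?_
        rw [lintegral_const_mul _ (by fun_prop)]
        congr 1
        rw [← ofReal_integral_eq_lintegral_ofReal (integrable_exp_mul_gaussianReal q.2)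
          (Filter.Eventually.of_forall fun _ => (Real.exp_pos _).le)]
        have := congrFun (mgf_id_gaussianReal (μ := 0) (v := v)) q.2
        simp only [mgf, id, zero_mul, zero_add] at this
        rw [this]; congr 2; ring
    _ = _ := by rw [lintegral_map hF1 hWα']

/-- Integration against the indicator of an event whose conditional probability is known. -/
lemma lintegral_indicator_mul_of_condExp [IsProbabilityMeasure P]
    (hm : m ≤ mΩ) {E : Set Ω} (hE : MeasurableSet E) {π : Ω → ℝ} (hπ : Measurable[m] π)
    (hπ0 : ∀ ω, 0 ≤ π ω)
    (hcond : P[E.indicator (fun _ => (1 : ℝ)) | m] =ᵐ[P] π)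
    {H : Ω → ℝ≥0∞} (hH : Measurable[m] H) :
    ∫⁻ ω, E.indicator 1 ω * H ω ∂P = ∫⁻ ω, ENNReal.ofReal (π ω) * H ω ∂P := by
  have hπ' : Measurable π := hπ.mono hm le_rfl
  have hH' : Measurable H := hH.mono hm le_rfl
  have hint : Integrable (E.indicator (fun _ => (1 : ℝ))) P :=
    (integrable_const 1).indicator hE
  have hπint : Integrable π P := integrable_condExp.congr hcond
  have key : (P.withDensity (E.indicator 1)).trim hm
      = (P.withDensity (fun ω => ENNReal.ofReal (π ω))).trim hm := by
    refine @Measure.ext _ m _ _ fun A hA => ?_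
    rw [trim_measurableSet_eq hm hA, trim_measurableSet_eq hm hA,
      withDensity_apply _ (hm A hA), withDensity_apply _ (hm A hA)]
    have h1 : ∫ ω in A, π ω ∂P = ∫ ω in A, E.indicator (fun _ => (1 : ℝ)) ω ∂P := by
      rw [← setIntegral_condExp hm hint hA]
      exact setIntegral_congr_ae (hm A hA) (hcond.mono fun ω h _ => h.symm)
    rw [← ofReal_integral_eq_lintegral_ofReal hπint.integrableOn
      (Filter.Eventually.of_forall hπ0), h1,
      ofReal_integral_eq_lintegral_ofReal hint.integrableOn
      (Filter.Eventually.of_forall fun ω => Set.indicator_nonneg (fun _ _ => zero_le_one) ω)]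
    refine lintegral_congr fun ω => ?_
    by_cases h : ω ∈ E <;> simp [h]
  have h1m : Measurable (E.indicator (1 : Ω → ℝ≥0∞)) := measurable_one.indicator hE
  calc ∫⁻ ω, E.indicator 1 ω * H ω ∂P = ∫⁻ ω, H ω ∂(P.withDensity (E.indicator 1)) := by
        rw [lintegral_withDensity_eq_lintegral_mul _ h1m hH']; rfl
    _ = ∫⁻ ω, H ω ∂((P.withDensity (E.indicator 1)).trim hm) := (lintegral_trim hm hH).symm
    _ = ∫⁻ ω, H ω ∂((P.withDensity (fun ω => ENNReal.ofReal (π ω))).trim hm) := by rw [key]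
    _ = ∫⁻ ω, H ω ∂(P.withDensity (fun ω => ENNReal.ofReal (π ω))) := lintegral_trim hm hH
    _ = _ := by
        rw [lintegral_withDensity_eq_lintegral_mul _ hπ'.ennreal_ofReal hH']; rfl

/-- One step of the exponential supermartingale: `η` is Gaussian and independent of the past `m`,
and `B` is a random choice whose conditional law given `m` and `η` is `π`, where `π` depends on the
past only. -/
lemma lintegral_mul_exp_step_le [IsProbabilityMeasure P] {ι : Type*} [Fintype ι] [DecidableEq ι]
    (hm : m ≤ mΩ)
    {η : Ω → ℝ} (hη : Measurable η) {v : ℝ≥0} (hlaw : P.map η = gaussianReal 0 v)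
    (hind : Indep (MeasurableSpace.comap η inferInstance) m P)
    {B : Ω → ι} (hB : ∀ C, MeasurableSet {ω | B ω = C})
    {π : ι → Ω → ℝ} (hπ : ∀ C, Measurable[m] (π C)) (hπ0 : ∀ C ω, 0 ≤ π C ω)
    (hcond : ∀ C, P[{ω | B ω = C}.indicator (fun _ => (1 : ℝ)) |
        m ⊔ MeasurableSpace.comap η inferInstance] =ᵐ[P] π C)
    {α β : ι → Ω → ℝ} (hα : ∀ C, Measurable[m] (α C)) (hβ : ∀ C, Measurable[m] (β C))
    (hle : ∀ ω, ∑ C, π C ω * Real.exp (α C ω ^ 2 * v / 2 + β C ω) ≤ 1)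
    {G : Ω → ℝ≥0∞} (hG : Measurable[m] G) :
    ∫⁻ ω, G ω * ENNReal.ofReal (Real.exp (α (B ω) ω * η ω + β (B ω) ω)) ∂P ≤ ∫⁻ ω, G ω ∂P := by
  have hmη' : m ⊔ MeasurableSpace.comap η inferInstance ≤ mΩ := sup_le hm hη.comap_le
  have hηm : Measurable[m ⊔ MeasurableSpace.comap η inferInstance] η :=
    (comap_measurable η).mono le_sup_right le_rfl
  have hmono : ∀ {X : Type _} [MeasurableSpace X] {f : Ω → X}, Measurable[m] f →
      Measurable[m ⊔ MeasurableSpace.comap η inferInstance] f :=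
    fun hf => hf.mono le_sup_left le_rfl
  let H : ι → Ω → ℝ≥0∞ := fun C ω => G ω * ENNReal.ofReal (Real.exp (α C ω * η ω + β C ω))
  have hH : ∀ C, Measurable[m ⊔ MeasurableSpace.comap η inferInstance] (H C) := fun C => by
    have h1 := hmono (hα C)
    have h2 := hmono (hβ C)
    have h3 := hmono hG
    exact h3.mul (((h1.mul hηm).add h2).exp.ennreal_ofReal)
  have hsplit : ∀ ω, G ω * ENNReal.ofReal (Real.exp (α (B ω) ω * η ω + β (B ω) ω))
      = ∑ C, {ω | B ω = C}.indicator 1 ω * H C ω := by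
    intro ω
    rw [Finset.sum_eq_single (B ω)]
    · simp [H]
    · intro C _ hC
      simp [Set.indicator, hC.symm]
    · simp
  have hHm : ∀ C, Measurable (H C) := fun C => (hH C).mono hmη' le_rfl
  have hGm : Measurable G := hG.mono hm le_rfl
  have hαm := fun C => (hα C).mono hm le_rfl
  have hβm := fun C => (hβ C).mono hm le_rfl
  have hπm := fun C => (hπ C).mono hm le_rfl
  have hstep : ∀ C, ∫⁻ ω, {ω | B ω = C}.indicator 1 ω * H C ω ∂P
      = ∫⁻ ω, G ω * ENNReal.ofReal (π C ω * Real.exp (α C ω ^ 2 * v / 2 + β C ω)) ∂P := by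
    intro C
    rw [lintegral_indicator_mul_of_condExp hmη' (hB C) (hmono (hπ C)) (hπ0 C) (hcond C) (hH C)]
    have hW : Measurable[m] (fun ω => ENNReal.ofReal (π C ω) * G ω *
        ENNReal.ofReal (Real.exp (β C ω))) :=
      ((hπ C).ennreal_ofReal.mul hG).mul (hβ C).exp.ennreal_ofReal
    have := lintegral_mul_exp_gaussian hm hη hlaw hind hW (hα C)
    calc ∫⁻ ω, ENNReal.ofReal (π C ω) * H C ω ∂P
        = ∫⁻ ω, ENNReal.ofReal (π C ω) * G ω * ENNReal.ofReal (Real.exp (β C ω)) *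
            ENNReal.ofReal (Real.exp (α C ω * η ω)) ∂P := by
          refine lintegral_congr fun ω => ?_
          simp only [H]
          rw [Real.exp_add, ENNReal.ofReal_mul (Real.exp_pos _).le]; ring
      _ = _ := this
      _ = _ := by
          refine lintegral_congr fun ω => ?_
          rw [Real.exp_add, ENNReal.ofReal_mul (hπ0 C ω), ENNReal.ofReal_mul (Real.exp_pos _).le]
          ring
  calc ∫⁻ ω, G ω * ENNReal.ofReal (Real.exp (α (B ω) ω * η ω + β (B ω) ω)) ∂P
      = ∑ C, ∫⁻ ω, {ω | B ω = C}.indicator 1 ω * H C ω ∂P := by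
        simp_rw [hsplit]
        exact lintegral_finsetSum _ fun C _ => ((measurable_one.indicator (hB C)).mul (hHm C))
    _ = ∑ C, ∫⁻ ω, G ω * ENNReal.ofReal (π C ω * Real.exp (α C ω ^ 2 * v / 2 + β C ω)) ∂P :=
        Finset.sum_congr rfl fun C _ => hstep C
    _ = ∫⁻ ω, ∑ C, G ω * ENNReal.ofReal (π C ω * Real.exp (α C ω ^ 2 * v / 2 + β C ω)) ∂P := by
        rw [lintegral_finsetSum]
        intro C _
        have h1 := hαm C
        have h2 := hβm C
        have h3 := hπm C
        fun_prop
    _ ≤ ∫⁻ ω, G ω ∂P := by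
        refine lintegral_mono fun ω => ?_
        rw [← Finset.mul_sum, ← ENNReal.ofReal_sum_of_nonneg
          (fun C _ => mul_nonneg (hπ0 C ω) (Real.exp_pos _).le)]
        exact mul_le_of_le_one_right' (ENNReal.ofReal_le_one.2 (hle ω))

/-- Markov's inequality for an exponential supermartingale: `exp (∑ τ ≤ n, N τ)` has mean at most `1`
as soon as no step increases the mean. -/
lemma measure_le_sum_le [IsProbabilityMeasure P] (ℱ : Filtration ℕ mΩ) (N : ℕ → Ω → ℝ) (s : ℕ)
    (hN : ∀ τ ∈ Finset.Icc 1 s, Measurable[ℱ τ] (N τ))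
    (hstep : ∀ τ ∈ Finset.Icc 1 s, ∀ G : Ω → ℝ≥0∞, Measurable[ℱ (τ - 1)] G →
      ∫⁻ ω, G ω * ENNReal.ofReal (Real.exp (N τ ω)) ∂P ≤ ∫⁻ ω, G ω ∂P) (L : ℝ) :
    P {ω | L ≤ ∑ τ ∈ Finset.Icc 1 s, N τ ω} ≤ ENNReal.ofReal (Real.exp (-L)) := by
  have hmeas : ∀ n ≤ s, Measurable[ℱ n]
      (fun ω => ENNReal.ofReal (Real.exp (∑ τ ∈ Finset.Icc 1 n, N τ ω))) := by
    intro n hn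
    refine Measurable.ennreal_ofReal (Measurable.exp ?_)
    refine Finset.measurable_fun_sum _ fun τ hτ => ?_
    rw [Finset.mem_Icc] at hτ
    exact (hN τ (Finset.mem_Icc.2 ⟨hτ.1, hτ.2.trans hn⟩)).mono (ℱ.mono hτ.2) le_rfl
  have hint : ∀ n ≤ s,
      ∫⁻ ω, ENNReal.ofReal (Real.exp (∑ τ ∈ Finset.Icc 1 n, N τ ω)) ∂P ≤ 1 := by
    intro n
    induction n with
    | zero => intro _; simp
    | succ n ih =>
      intro hn
      have h1 := hstep (n + 1) (Finset.mem_Icc.2 ⟨by omega, hn⟩) _ (hmeas n (by omega))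
      refine le_trans (le_of_eq ?_) (h1.trans (ih (by omega)))
      refine lintegral_congr fun ω => ?_
      rw [Finset.sum_Icc_succ_top (by omega), Real.exp_add, ENNReal.ofReal_mul (Real.exp_pos _).le]
  have hm := (hmeas s le_rfl).mono (ℱ.le s) le_rfl
  have h := mul_meas_ge_le_lintegral hm (μ := P) (ENNReal.ofReal (Real.exp L))
  have hset : {ω | L ≤ ∑ τ ∈ Finset.Icc 1 s, N τ ω} =
      {ω | ENNReal.ofReal (Real.exp L)
        ≤ ENNReal.ofReal (Real.exp (∑ τ ∈ Finset.Icc 1 s, N τ ω))} := by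
    ext ω
    simp only [Set.mem_ofPred_eq]
    rw [ENNReal.ofReal_le_ofReal_iff (Real.exp_pos _).le, Real.exp_le_exp]
  rw [hset]
  have h2 := h.trans (hint s le_rfl)
  rw [Real.exp_neg, ENNReal.ofReal_inv_of_pos (Real.exp_pos _)]
  rw [ENNReal.le_inv_iff_mul_le, mul_comm]
  exact h2

end Supermartingale

end POSLR

namespace POSLR

/-! ### Error bounds for the Dantzig selector under the compatibility condition -/

section Dantzig

variable {d : ℕ}

lemma l1_nonneg (w : Fin d → ℝ) : 0 ≤ l1 w := Finset.sum_nonneg fun _ _ => abs_nonneg _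

lemma l1_restr (w : Fin d → ℝ) (S : Finset (Fin d)) : l1 (restr w S) = ∑ j ∈ S, |w j| := by
  rw [l1, ← Finset.sum_subset (Finset.subset_univ S)]
  · exact Finset.sum_congr rfl fun j hj => by simp only [restr, if_pos hj]
  · intro j _ hj; simp [restr, hj]

lemma l1_restr_add_compl (w : Fin d → ℝ) (S : Finset (Fin d)) :
    l1 (restr w S) + l1 (restr w Sᶜ) = l1 w := by
  rw [l1_restr, l1_restr, l1, Finset.sum_add_sum_compl]

lemma l1_restr_le (w : Fin d → ℝ) (S : Finset (Fin d)) : l1 (restr w S) ≤ l1 w := by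
  rw [← l1_restr_add_compl w S]; linarith [l1_nonneg (restr w Sᶜ)]

lemma abs_dotProduct_le (v x : Fin d → ℝ) (c : ℝ) (hx : ∀ i, |x i| ≤ c) :
    |v ⬝ᵥ x| ≤ l1 v * c := by
  unfold dotProduct l1
  refine (Finset.abs_sum_le_sum_abs _ _).trans ?_
  rw [Finset.sum_mul]
  refine Finset.sum_le_sum fun i _ => ?_
  rw [abs_mul]
  exact mul_le_mul_of_nonneg_left (hx i) (abs_nonneg _)

lemma eq_zero_of_notMem_supp {w : Fin d → ℝ} {i : Fin d} (hi : i ∉ supp w) : w i = 0 := by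
  simpa [supp] using hi

/-- A vector that is not longer than `w` in `ℓ₁`-norm differs from `w` by an element of the cone of
the support of `w`. -/
lemma l1_sub_compl_le {v w : Fin d → ℝ} (h : l1 v ≤ l1 w) :
    l1 (restr (v - w) (supp w)ᶜ) ≤ l1 (restr (v - w) (supp w)) := by
  have h0 : l1 (restr w (supp w)ᶜ) = 0 := by
    rw [l1_restr]
    refine Finset.sum_eq_zero fun j hj => ?_
    rw [eq_zero_of_notMem_supp (Finset.mem_compl.1 hj), abs_zero]
  have h1 : l1 (restr (v - w) (supp w)ᶜ) = l1 (restr v (supp w)ᶜ) := by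
    rw [l1_restr, l1_restr]
    refine Finset.sum_congr rfl fun j hj => ?_
    rw [Pi.sub_apply, eq_zero_of_notMem_supp (Finset.mem_compl.1 hj), sub_zero]
  have h2 : l1 (restr w (supp w)) ≤ l1 (restr v (supp w)) + l1 (restr (v - w) (supp w)) := by
    rw [l1_restr, l1_restr, l1_restr, ← Finset.sum_add_distrib]
    refine Finset.sum_le_sum fun j _ => ?_
    have := abs_sub_abs_le_abs_sub (w j) (v j)
    rw [Pi.sub_apply, abs_sub_comm (v j)]; linarith
  have h3 := l1_restr_add_compl v (supp w)
  have h4 := l1_restr_add_compl w (supp w)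
  linarith

/-- Two feasible vectors: the residual of their difference is at most twice the threshold. -/
lemma abs_mulVec_sub_le {b : Fin d → ℝ} {H : Matrix (Fin d) (Fin d) ℝ} {s : ℕ} {γ : ℝ}
    {v w : Fin d → ℝ} (hv : DSFeasible b H s γ v) (hw : DSFeasible b H s γ w) (i : Fin d) :
    |1 / (s : ℝ) * (H.mulVec (v - w)) i| ≤ 2 * γ := by
  have h1 := abs_le.1 (hv i)
  have h2 := abs_le.1 (hw i)
  rw [Matrix.mulVec_sub, Pi.sub_apply, mul_sub, abs_le]
  constructor <;> linarith [h1.1, h1.2, h2.1, h2.2]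

lemma sum_sq_dotProduct (x : ℕ → Fin d → ℝ) (I : Finset ℕ) (v : Fin d → ℝ) :
    ∑ τ ∈ I, (x τ ⬝ᵥ v) ^ 2 = ∑ i, v i * ∑ j, (∑ τ ∈ I, x τ i * x τ j) * v j := by
  have : ∀ τ, (x τ ⬝ᵥ v) ^ 2 = ∑ i, v i * ∑ j, (x τ i * x τ j) * v j := by
    intro τ
    rw [sq, dotProduct, Finset.sum_mul_sum]
    refine Finset.sum_congr rfl fun i _ => ?_
    rw [Finset.mul_sum]
    exact Finset.sum_congr rfl fun j _ => by ring
  simp_rw [this]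
  rw [Finset.sum_comm]
  refine Finset.sum_congr rfl fun i _ => ?_
  rw [← Finset.mul_sum, Finset.sum_comm]
  congr 1
  refine Finset.sum_congr rfl fun j _ => ?_
  rw [Finset.sum_mul]

/-- The basic error bound: the compatibility condition for the true Gram matrix is transferred to
its estimate `H`, which is entrywise within `E` of it. -/
lemma dantzig_error {b : Fin d → ℝ} {H : Matrix (Fin d) (Fin d) ℝ} {s k : ℕ} {γ E δS : ℝ}
    {x : ℕ → Fin d → ℝ} {v w : Fin d → ℝ} (hs : 1 ≤ s)
    (hk : (supp w).card ≤ k) (hcompat : Compatible δS (supp w) 1 x s)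
    (hw : DSFeasible b H s γ w) (hv : DSSolution b H s γ v)
    (hH : ∀ i j, |H i j - ∑ τ ∈ Finset.Icc 1 s, x τ i * x τ j| ≤ E) :
    δS ^ 2 * l1 (restr (v - w) (supp w))
      ≤ k * (4 * γ + 4 * (E / s) * l1 (restr (v - w) (supp w))) := by
  set u := v - w with hu
  set D := l1 (restr u (supp w)) with hD
  have hs' : (0 : ℝ) < s := by exact_mod_cast hs
  obtain ⟨⟨i₀, hi₀⟩, hcomp⟩ := hcompat
  have hE : 0 ≤ E := (abs_nonneg _).trans (hH i₀ i₀)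
  have hγ : 0 ≤ γ := (abs_nonneg _).trans (hw i₀)
  have hcone : l1 (restr u (supp w)ᶜ) ≤ D := l1_sub_compl_le (hv.2 w hw)
  have hD0 : 0 ≤ D := l1_nonneg _
  have hl1 : l1 u ≤ 2 * D := by
    have := l1_restr_add_compl u (supp w); linarith
  rcases eq_or_lt_of_le hD0 with h0 | hpos
  · rw [← h0]; simp only [mul_zero, add_zero]; positivity
  have hune : u ≠ 0 := by
    intro h
    have : l1 u = 0 := by simp [h, l1]
    have := l1_restr_le u (supp w)
    linarith
  have h1 := hcomp u ⟨hune, by linarith⟩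
  rw [le_div_iff₀ (by positivity)] at h1
  have hquad : ∑ τ ∈ Finset.Icc 1 s, (x τ ⬝ᵥ u) ^ 2 ≤ s * (2 * γ * l1 u) + E * l1 u ^ 2 := by
    rw [sum_sq_dotProduct]
    have hrow : ∀ i, |∑ j, (∑ τ ∈ Finset.Icc 1 s, x τ i * x τ j) * u j|
        ≤ s * (2 * γ) + E * l1 u := by
      intro i
      have e : ∑ j, (∑ τ ∈ Finset.Icc 1 s, x τ i * x τ j) * u j
          = s * (1 / (s : ℝ) * (H.mulVec u) i)
            - ∑ j, (H i j - ∑ τ ∈ Finset.Icc 1 s, x τ i * x τ j) * u j := by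
        simp only [sub_mul, Finset.sum_sub_distrib, Matrix.mulVec, dotProduct]
        field_simp; ring
      rw [e]
      refine (abs_sub _ _).trans (add_le_add ?_ ?_)
      · rw [abs_mul, abs_of_pos hs']
        exact mul_le_mul_of_nonneg_left (abs_mulVec_sub_le hv.1 hw i) hs'.le
      · refine (Finset.abs_sum_le_sum_abs _ _).trans ?_
        rw [l1, Finset.mul_sum]
        refine Finset.sum_le_sum fun j _ => ?_
        rw [abs_mul]
        exact mul_le_mul_of_nonneg_right (hH i j) (abs_nonneg _)
    calc ∑ i, u i * ∑ j, (∑ τ ∈ Finset.Icc 1 s, x τ i * x τ j) * u j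
        ≤ ∑ i, |u i| * (s * (2 * γ) + E * l1 u) := by
          refine Finset.sum_le_sum fun i _ => ?_
          refine (le_abs_self _).trans ?_
          rw [abs_mul]
          exact mul_le_mul_of_nonneg_left (hrow i) (abs_nonneg _)
      _ = s * (2 * γ * l1 u) + E * l1 u ^ 2 := by
          rw [← Finset.sum_mul, ← l1]; ring
  have hk' : ((supp w).card : ℝ) ≤ k := by exact_mod_cast hk
  have hq0 : 0 ≤ ∑ τ ∈ Finset.Icc 1 s, (x τ ⬝ᵥ u) ^ 2 := Finset.sum_nonneg fun _ _ => sq_nonneg _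
  have h2 : δS ^ 2 * (s * D ^ 2) ≤ k * (s * (2 * γ * (2 * D)) + E * (2 * D) ^ 2) := by
    refine h1.trans (mul_le_mul hk' (hquad.trans ?_) hq0 (Nat.cast_nonneg _))
    have hl0 := l1_nonneg u
    gcongr
  have h3 : δS ^ 2 * D * (s * D) ≤ k * (4 * γ + 4 * (E / s) * D) * (s * D) := by
    have : k * (4 * γ + 4 * (E / s) * D) * (s * D)
        = k * (s * (2 * γ * (2 * D)) + E * (2 * D) ^ 2) := by
      field_simp; ring
    rw [this]; linarith
  exact le_of_mul_le_mul_right h3 (by positivity)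

/-- The `k` largest entries carry at least as much mass as any `k` others. -/
lemma sum_sdiff_le_of_isTop {k : ℕ} {v : Fin d → ℝ} {A S : Finset (Fin d)} (hA : IsTop k v A)
    (hS : S.card ≤ k) : ∑ j ∈ S \ A, |v j| ≤ ∑ j ∈ A \ S, |v j| := by
  have hcard : (S \ A).card ≤ (A \ S).card := by
    have h1 := Finset.card_sdiff_add_card_inter S A
    have h2 := Finset.card_sdiff_add_card_inter A S
    rw [Finset.inter_comm] at h2
    have := hA.1
    omega
  rcases (S \ A).eq_empty_or_nonempty with h | h
  · rw [h, Finset.sum_empty]; exact Finset.sum_nonneg fun _ _ => abs_nonneg _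
  · obtain ⟨j₀, hj₀, hmax⟩ := Finset.exists_max_image (S \ A) (fun j => |v j|) h
    have h1 : ∑ j ∈ S \ A, |v j| ≤ (S \ A).card • |v j₀| := Finset.sum_le_card_nsmul _ _ _ hmax
    have h2 : (A \ S).card • |v j₀| ≤ ∑ j ∈ A \ S, |v j| :=
      Finset.card_nsmul_le_sum _ _ _ fun i hi =>
        hA.2 i (Finset.mem_sdiff.1 hi).1 j₀ (Finset.mem_sdiff.1 hj₀).2
    refine h1.trans (le_trans ?_ h2)
    exact nsmul_le_nsmul_left (abs_nonneg _) hcard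

/-- The mass of `w` outside the `k` largest entries of an estimate `v` is controlled by the
estimation error. -/
lemma l1_restr_compl_top_le {k : ℕ} {v w : Fin d → ℝ} {A : Finset (Fin d)} (hA : IsTop k v A)
    (hk : (supp w).card ≤ k) (h : l1 v ≤ l1 w) :
    l1 (restr w Aᶜ) ≤ 2 * l1 (restr (v - w) (supp w)) := by
  have hcone := l1_sub_compl_le h
  have h0 : l1 (restr w Aᶜ) = ∑ j ∈ supp w \ A, |w j| := by
    rw [l1_restr]
    symm
    refine Finset.sum_subset (fun j hj => ?_) fun j hj hj' => ?_
    · rw [Finset.mem_compl]; exact (Finset.mem_sdiff.1 hj).2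
    · have : j ∉ supp w := fun h => hj' (Finset.mem_sdiff.2 ⟨h, Finset.mem_compl.1 hj⟩)
      rw [eq_zero_of_notMem_supp this, abs_zero]
  have h1 : ∑ j ∈ supp w \ A, |w j|
      ≤ ∑ j ∈ supp w \ A, |(v - w) j| + ∑ j ∈ supp w \ A, |v j| := by
    rw [← Finset.sum_add_distrib]
    refine Finset.sum_le_sum fun j _ => ?_
    have := abs_sub_abs_le_abs_sub (w j) (v j)
    rw [Pi.sub_apply, abs_sub_comm (v j)]; linarith
  have h2 := sum_sdiff_le_of_isTop hA hk
  have h3 : ∑ j ∈ A \ supp w, |v j| ≤ l1 (restr (v - w) (supp w)ᶜ) := by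
    rw [l1_restr]
    calc ∑ j ∈ A \ supp w, |v j| = ∑ j ∈ A \ supp w, |(v - w) j| := by
          refine Finset.sum_congr rfl fun j hj => ?_
          rw [Pi.sub_apply, eq_zero_of_notMem_supp (Finset.mem_sdiff.1 hj).2, sub_zero]
      _ ≤ _ := Finset.sum_le_sum_of_subset_of_nonneg
          (fun j hj => Finset.mem_compl.2 (Finset.mem_sdiff.1 hj).2) fun _ _ _ => abs_nonneg _
  have h4 : ∑ j ∈ supp w \ A, |(v - w) j| ≤ l1 (restr (v - w) (supp w)) := by
    rw [l1_restr]
    exact Finset.sum_le_sum_of_subset_of_nonneg Finset.sdiff_subset fun _ _ _ => abs_nonneg _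
  linarith

lemma l1_restr_top_sub_le {k : ℕ} {v w : Fin d → ℝ} {A : Finset (Fin d)} (hA : IsTop k v A)
    (hk : (supp w).card ≤ k) (h : l1 v ≤ l1 w) :
    l1 (restr v A - w) ≤ 3 * l1 (restr (v - w) (supp w)) := by
  have hcone := l1_sub_compl_le h
  have h1 : l1 (restr v A - w) ≤ l1 (v - w) + l1 (restr v Aᶜ) := by
    unfold l1
    rw [← Finset.sum_add_distrib]
    refine Finset.sum_le_sum fun j _ => ?_
    by_cases hj : j ∈ A
    · simp [restr, hj]
    · simp only [Pi.sub_apply, restr, hj, if_false, Finset.mem_compl, not_false_eq_true, if_true]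
      have := abs_sub_abs_le_abs_sub (w j) (v j)
      rw [abs_sub_comm (v j), zero_sub, abs_neg]; linarith
  have h2 : l1 (restr v Aᶜ) ≤ l1 (restr v (supp w)ᶜ) := by
    have e1 := l1_restr_add_compl v A
    have e2 := l1_restr_add_compl v (supp w)
    have e3 := sum_sdiff_le_of_isTop hA hk
    have e4 : l1 (restr v (supp w)) ≤ l1 (restr v A) := by
      rw [l1_restr, l1_restr, ← Finset.sum_inter_add_sum_sdiff (supp w) A,
        ← Finset.sum_inter_add_sum_sdiff A (supp w), Finset.inter_comm A]
      linarith
    linarith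
  have h3 : l1 (restr v (supp w)ᶜ) = l1 (restr (v - w) (supp w)ᶜ) := by
    rw [l1_restr, l1_restr]
    refine Finset.sum_congr rfl fun j hj => ?_
    rw [Pi.sub_apply, eq_zero_of_notMem_supp (Finset.mem_compl.1 hj), sub_zero]
  have h4 := l1_restr_add_compl (v - w) (supp w)
  linarith

lemma l1_sub_le (v w : Fin d → ℝ) : l1 (v - w) ≤ l1 v + l1 w := by
  unfold l1
  rw [← Finset.sum_add_distrib]
  exact Finset.sum_le_sum fun j _ => by rw [Pi.sub_apply]; exact abs_sub _ _

/-- Signs can be chosen on `S` so that no cross terms increase a sum of squares. -/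
lemma exists_signs (x : ℕ → Fin d → ℝ) (I : Finset ℕ) (S : Finset (Fin d)) :
    ∃ ε : Fin d → ℝ, (∀ i, |ε i| = 1) ∧
      ∑ τ ∈ I, (∑ i ∈ S, ε i * x τ i) ^ 2 ≤ ∑ τ ∈ I, ∑ i ∈ S, x τ i ^ 2 := by
  induction S using Finset.induction_on with
  | empty => exact ⟨fun _ => 1, by simp, by simp⟩
  | insert a S ha ih =>
    obtain ⟨ε, hε, h⟩ := ih
    set c := ∑ τ ∈ I, (∑ i ∈ S, ε i * x τ i) * x τ a with hc
    have : ∃ t : ℝ, |t| = 1 ∧ t * c ≤ 0 := by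
      rcases le_total c 0 with h0 | h0
      · exact ⟨1, by simp, by linarith⟩
      · exact ⟨-1, by simp, by linarith⟩
    obtain ⟨t, ht, htc⟩ := this
    refine ⟨fun i => if i = a then t else ε i, fun i => ?_, ?_⟩
    · dsimp only; split_ifs
      · exact ht
      · exact hε i
    · have e : ∀ τ, ∑ i ∈ insert a S, (if i = a then t else ε i) * x τ i
          = t * x τ a + ∑ i ∈ S, ε i * x τ i := by
        intro τ
        rw [Finset.sum_insert ha, if_pos rfl]
        congr 1
        refine Finset.sum_congr rfl fun i hi => ?_
        rw [if_neg (fun h' : i = a => ha (h' ▸ hi))]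
      have ht2 : t ^ 2 = 1 := by rw [← sq_abs, ht, one_pow]
      calc ∑ τ ∈ I, (∑ i ∈ insert a S, (if i = a then t else ε i) * x τ i) ^ 2
          = ∑ τ ∈ I, x τ a ^ 2 + 2 * (t * c) + ∑ τ ∈ I, (∑ i ∈ S, ε i * x τ i) ^ 2 := by
            simp_rw [e]
            rw [hc, Finset.mul_sum, Finset.mul_sum, ← Finset.sum_add_distrib,
              ← Finset.sum_add_distrib]
            refine Finset.sum_congr rfl fun τ _ => ?_
            linear_combination (x τ a ^ 2) * ht2
        _ ≤ ∑ τ ∈ I, x τ a ^ 2 + ∑ τ ∈ I, ∑ i ∈ S, x τ i ^ 2 := by linarith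
        _ = _ := by
            rw [← Finset.sum_add_distrib]
            exact Finset.sum_congr rfl fun τ _ => by rw [Finset.sum_insert ha]

/-- The compatibility constant of data bounded by `1` is at most `1`. -/
lemma sq_le_one_of_compatible {δS : ℝ} {S : Finset (Fin d)} {x : ℕ → Fin d → ℝ} {s : ℕ}
    (hs : 1 ≤ s) (hx : ∀ τ ∈ Finset.Icc 1 s, ∀ i, |x τ i| ≤ 1)
    (hcompat : Compatible δS S 1 x s) : δS ^ 2 ≤ 1 := by
  obtain ⟨ε, hε, h⟩ := exists_signs x (Finset.Icc 1 s) S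
  obtain ⟨hne, hcomp⟩ := hcompat
  have hs' : (0 : ℝ) < s := by exact_mod_cast hs
  have hcard : (0 : ℝ) < S.card := by exact_mod_cast hne.card_pos
  have hl : l1 (restr (restr ε S) S) = S.card := by
    rw [l1_restr]
    rw [Finset.sum_congr rfl (g := fun _ => (1 : ℝ)) (fun j hj => by simp [restr, hj, hε])]
    simp
  have hl' : l1 (restr (restr ε S) Sᶜ) = 0 := by
    rw [l1_restr]
    refine Finset.sum_eq_zero fun j hj => ?_
    simp [restr, Finset.mem_compl.1 hj]
  have hne0 : restr ε S ≠ 0 := by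
    intro h0
    rw [h0] at hl
    have : l1 (restr (0 : Fin d → ℝ) S) = 0 := by rw [l1_restr]; simp
    rw [this] at hl; linarith
  refine (hcomp (restr ε S) ⟨hne0, by rw [hl, hl']; linarith⟩).trans ?_
  rw [hl, div_le_one (by positivity)]
  have e : ∀ τ, x τ ⬝ᵥ restr ε S = ∑ i ∈ S, ε i * x τ i := by
    intro τ
    rw [dotProduct, ← Finset.sum_subset (Finset.subset_univ S)]
    · exact Finset.sum_congr rfl fun j hj => by simp only [restr, if_pos hj]; ring
    · intro j _ hj; simp [restr, hj]
  simp_rw [e]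
  have h2 : ∑ τ ∈ Finset.Icc 1 s, ∑ i ∈ S, x τ i ^ 2 ≤ s * S.card := by
    calc ∑ τ ∈ Finset.Icc 1 s, ∑ i ∈ S, x τ i ^ 2 ≤ ∑ τ ∈ Finset.Icc 1 s, ∑ i ∈ S, (1 : ℝ) :=
          Finset.sum_le_sum fun τ hτ => Finset.sum_le_sum fun i _ =>
            (sq_le_one_iff_abs_le_one _).2 (hx τ hτ i)
      _ = _ := by simp
  calc (S.card : ℝ) * ∑ τ ∈ Finset.Icc 1 s, (∑ i ∈ S, ε i * x τ i) ^ 2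
      ≤ S.card * (s * S.card) := mul_le_mul_of_nonneg_left (h.trans h2) hcard.le
    _ = _ := by ring

end Dantzig

end POSLR

namespace POSLR

/-! ### The parameters in normalized form -/

namespace Params

variable (p : Params)

/-- The inverse of the lower bound for the probability that an attribute is observed. -/
noncomputable def K : ℝ := (p.d' - 1) / ((p.k₀ : ℝ) - 1)

/-- The ratio `g / K`. -/
noncomputable def R : ℝ := (p.d' - 2) / ((p.k₀ : ℝ) - 2)

/-- The sparsity in units of the squared compatibility constant. -/
noncomputable def m : ℝ := p.k / p.δS ^ 2

/-- The coefficient of the `1/√s`-term of the threshold. -/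
noncomputable def A : ℝ := 6.9 + p.κ * (p.σ : ℝ)

/-- The coefficient of the `1/s`-term of the threshold. -/
noncomputable def α : ℝ := 8 / 3 + 2 * (p.σ : ℝ)

/-- The geometric mean of `L₁` and `L₂`. -/
noncomputable def G : ℝ := √(p.L₁ * p.L₂)

/-- The unit in which `s * γHat s` is measured; it equals `√(g L₁ s₀)`. -/
noncomputable def Θ : ℝ := 24 * p.m * p.g * p.G

/-- The `1/√s`-term of the threshold at `s = s₀`, in units of `Θ / s₀`. -/
noncomputable def a : ℝ := p.A / √p.R

/-- The `1/s`-term of the threshold at `s = s₀`, in units of `Θ / s₀`. -/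
noncomputable def e : ℝ := p.α * p.L₁ / (24 * p.m * p.G)

/-- The variant of `s₀` with `L₁` in place of `L₂`. -/
noncomputable def Y : ℝ := 576 * p.m ^ 2 * p.g * p.L₁

/-- The conditions on the parameters. The bound `δS ≤ 1` is a consequence of the compatibility
condition. -/
structure Admissible : Prop where
  hk : 3 ≤ p.k
  hk₀ : 3 ≤ p.k₀
  hd : p.k + p.k₀ ≤ p.d
  hδ₀ : 0 < p.δ
  hδ₁ : p.δ < 1
  hδS : 0 < p.δS
  hδS1 : p.δS ^ 2 ≤ 1
  hκ : 1.2 ≤ p.κ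
  hσκ : p.σ ≤ 1 ∨ 1.7 ≤ p.κ

namespace Admissible

set_option linter.unusedSectionVars false

variable {p} (h : p.Admissible)
include h

lemma k_ge : (3 : ℝ) ≤ p.k := by exact_mod_cast h.hk

lemma k₀_ge : (3 : ℝ) ≤ p.k₀ := by exact_mod_cast h.hk₀

lemma k₀_le : (p.k₀ : ℝ) ≤ p.d' := by
  have : (p.k : ℝ) + p.k₀ ≤ p.d := by exact_mod_cast h.hd
  unfold d'; linarith

lemma d_ge : (6 : ℝ) ≤ p.d := by
  have : (p.k : ℝ) + p.k₀ ≤ p.d := by exact_mod_cast h.hd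
  linarith [h.k_ge, h.k₀_ge]

lemma one_le_K : 1 ≤ p.K := by
  have := h.k₀_ge; have := h.k₀_le
  unfold K; rw [le_div_iff₀ (by linarith)]; linarith

lemma one_le_R : 1 ≤ p.R := by
  have := h.k₀_ge; have := h.k₀_le
  unfold R; rw [le_div_iff₀ (by linarith)]; linarith

lemma g_eq : p.g = p.K * p.R := by
  unfold g K R; rw [div_mul_div_comm]

lemma K_le_g : p.K ≤ p.g := by
  have := h.one_le_K; have := h.one_le_R
  rw [h.g_eq]; nlinarith

lemma R_le_g : p.R ≤ p.g := by
  have := h.one_le_K; have := h.one_le_R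
  rw [h.g_eq]; nlinarith

lemma one_le_g : 1 ≤ p.g := h.one_le_K.trans h.K_le_g

lemma m_ge : 3 ≤ p.m := by
  have h1 := h.hδS1
  have h2 : 0 < p.δS ^ 2 := by have := h.hδS; positivity
  unfold m; rw [le_div_iff₀ h2]; nlinarith [h.k_ge]

lemma σ_nonneg : 0 ≤ (p.σ : ℝ) := p.σ.2

lemma σ_le : 1.7 * (p.σ : ℝ) ≤ p.A := by
  have hσ := h.σ_nonneg
  have hκ := h.hκ
  unfold A
  rcases h.hσκ with h1 | h1
  · have h1' : (p.σ : ℝ) ≤ 1 := by exact_mod_cast h1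
    nlinarith
  · nlinarith

lemma A_ge : 6.9 ≤ p.A := by
  have hσ := h.σ_nonneg
  have hκ := h.hκ
  unfold A; nlinarith

lemma α_ge : 8 / 3 ≤ p.α := by
  have hσ := h.σ_nonneg
  unfold α; linarith

lemma L₁_eq : p.L₁ = Real.log p.d - Real.log p.δ := by
  unfold L₁; rw [Real.log_div (by linarith [h.d_ge]) h.hδ₀.ne']

lemma L₂_eq : p.L₂ = 2 * Real.log p.d - Real.log p.δ := by
  unfold L₂
  have := h.d_ge
  rw [Real.log_div (by positivity) h.hδ₀.ne', Real.log_pow]; norm_num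

lemma log_d_ge : 7 / 4 ≤ Real.log p.d := by
  have h1 : (7 / 4 : ℝ) ≤ Real.log 6 := by
    rw [Real.le_log_iff_exp_le (by norm_num)]
    have h2 : Real.exp (7 / 4) ^ 4 ≤ 6 ^ 4 := by
      rw [← Real.exp_nat_mul]
      have e7 : Real.exp (((4 : ℕ) : ℝ) * (7 / 4)) = Real.exp 1 ^ 7 := by
        rw [← Real.exp_nat_mul]; norm_num
      rw [e7]
      calc Real.exp 1 ^ 7 ≤ 2.7182818286 ^ 7 :=
            pow_le_pow_left₀ (Real.exp_pos _).le Real.exp_one_lt_d9.le _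
        _ ≤ 6 ^ 4 := by norm_num
    exact le_of_pow_le_pow_left₀ (by norm_num) (by norm_num) h2
  exact h1.trans (Real.log_le_log (by norm_num) h.d_ge)

lemma log_δ_neg : Real.log p.δ < 0 := Real.log_neg h.hδ₀ h.hδ₁

lemma L₁_ge : 7 / 4 ≤ p.L₁ := by
  rw [h.L₁_eq]; linarith [h.log_d_ge, h.log_δ_neg]

lemma L₁_le_L₂ : p.L₁ ≤ p.L₂ := by
  rw [h.L₁_eq, h.L₂_eq]; linarith [h.log_d_ge]

lemma L₂_le : p.L₂ ≤ 2 * p.L₁ := by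
  rw [h.L₁_eq, h.L₂_eq]; linarith [h.log_δ_neg]

lemma L₂_ge : 7 / 2 ≤ p.L₂ := by
  rw [h.L₂_eq]; linarith [h.log_d_ge, h.log_δ_neg]

lemma L₁_pos : 0 < p.L₁ := by linarith [h.L₁_ge]

lemma L₂_pos : 0 < p.L₂ := by linarith [h.L₂_ge]

lemma G_sq : p.G ^ 2 = p.L₁ * p.L₂ :=
  Real.sq_sqrt (mul_nonneg h.L₁_pos.le h.L₂_pos.le)

lemma G_pos : 0 < p.G := Real.sqrt_pos.2 (mul_pos h.L₁_pos h.L₂_pos)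

lemma L₁_le_G : p.L₁ ≤ p.G := by
  refine Real.le_sqrt_of_sq_le ?_
  nlinarith [h.L₁_pos, h.L₁_le_L₂]

lemma G_le_L₂ : p.G ≤ p.L₂ := by
  refine Real.sqrt_le_iff.2 ⟨h.L₂_pos.le, ?_⟩
  nlinarith [h.L₂_pos, h.L₁_le_L₂]

lemma s₀_eq : p.s₀ = 576 * p.m ^ 2 * p.g * p.L₂ := by
  have := h.hδS
  unfold s₀ m; field_simp; ring

lemma s₁_eq : p.s₁ = p.s₀ * (p.R * p.L₁) := by
  unfold s₁ s₀ R; ring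

lemma Y_pos : 0 < p.Y := by
  have := h.m_ge; have := h.one_le_g; have := h.L₁_pos
  unfold Y; positivity

lemma s₀_pos : 0 < p.s₀ := by
  have := h.m_ge; have := h.one_le_g; have := h.L₂_pos
  rw [h.s₀_eq]; positivity

lemma Y_le : p.Y ≤ p.s₀ := by
  have := h.m_ge; have := h.one_le_g
  rw [h.s₀_eq, Y]
  exact mul_le_mul_of_nonneg_left h.L₁_le_L₂ (by positivity)

lemma s₀_le : p.s₀ ≤ 2 * p.Y := by
  have := h.m_ge; have := h.one_le_g
  rw [h.s₀_eq, Y]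
  have := mul_le_mul_of_nonneg_left h.L₂_le (by positivity : 0 ≤ 576 * p.m ^ 2 * p.g)
  linarith

lemma m_sq_ge : 9 ≤ p.m ^ 2 := by nlinarith [h.m_ge]

lemma Y_ge : 5184 * (p.g * p.L₁) ≤ p.Y := by
  have h1 : 0 ≤ p.g * p.L₁ := mul_nonneg (by linarith [h.one_le_g]) h.L₁_pos.le
  unfold Y; nlinarith [h.m_sq_ge]

lemma s₀_ge : 5184 * (p.g * p.L₂) ≤ p.s₀ := by
  have h1 : 0 ≤ p.g * p.L₂ := mul_nonneg (by linarith [h.one_le_g]) h.L₂_pos.le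
  rw [h.s₀_eq]; nlinarith [h.m_sq_ge]

lemma s₀_ge' : 18144 ≤ p.s₀ := by
  have h1 := h.s₀_ge
  nlinarith [h.one_le_g, h.L₂_ge]

lemma Θ_pos : 0 < p.Θ := by
  have := h.m_ge; have := h.one_le_g; have := h.G_pos
  unfold Θ; positivity

lemma Θ_sq : p.Θ ^ 2 = p.g * p.L₁ * p.s₀ := by
  unfold Θ; rw [h.s₀_eq, mul_pow, h.G_sq]; ring

lemma sqrt_gL₁_mul : √(p.g * p.L₁) * √p.s₀ = p.Θ := by
  rw [← Real.sqrt_mul (mul_nonneg (by linarith [h.one_le_g]) h.L₁_pos.le), ← h.Θ_sq,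
    Real.sqrt_sq h.Θ_pos.le]

lemma sqrt_s₀ : √p.s₀ = 24 * p.m * √(p.g * p.L₂) := by
  have := h.m_ge
  rw [h.s₀_eq, show 576 * p.m ^ 2 * p.g * p.L₂ = (24 * p.m) ^ 2 * (p.g * p.L₂) by ring,
    Real.sqrt_mul (by positivity), Real.sqrt_sq (by positivity)]

lemma sqrt_3gL₁ : √(3 * p.g * p.L₁) = √3 * √(p.g * p.L₁) := by
  rw [mul_assoc, Real.sqrt_mul (by norm_num)]

lemma sqrt_s₀_pos : 0 < √p.s₀ := Real.sqrt_pos.2 h.s₀_pos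

lemma a_pos : 0 < p.a := by
  have := h.A_ge; have := h.one_le_R
  unfold a; positivity

lemma e_pos : 0 < p.e := by
  have := h.α_ge; have := h.m_ge; have := h.G_pos; have := h.L₁_pos
  unfold e; positivity

lemma e_mul_Θ : p.e * p.Θ = p.α * p.g * p.L₁ := by
  have := h.m_ge; have := h.G_pos
  unfold e Θ; field_simp

lemma a_mul_sqrt_R : p.a * √p.R = p.A := by
  have := h.one_le_R
  unfold a
  rw [div_mul_cancel₀]; positivity

lemma α_mul_L₁ : p.α * p.L₁ / p.m = 24 * p.e * p.G := by
  have := h.m_ge; have := h.G_pos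
  unfold e; field_simp

/-- The noise term of the threshold in units of `Θ`. -/
lemma A_mul_sqrt (s : ℝ) (hs : 0 ≤ s) :
    p.A * √(p.K * p.L₁ * s) = p.Θ * (p.a * √(s / p.s₀)) := by
  have hK : 0 ≤ p.K := by linarith [h.one_le_K]
  have hR : 0 < p.R := by linarith [h.one_le_R]
  have h0 := h.s₀_pos
  have hL := h.L₁_pos
  rw [← h.a_mul_sqrt_R, ← h.sqrt_gL₁_mul, h.g_eq, Real.sqrt_div hs]
  have e1 : √(p.K * p.R * p.L₁) = √p.R * √(p.K * p.L₁) := by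
    rw [← Real.sqrt_mul hR.le]; congr 1; ring
  have e2 : √(p.K * p.L₁ * s) = √(p.K * p.L₁) * √s := Real.sqrt_mul (by positivity) _
  rw [e1, e2]
  have := h.sqrt_s₀_pos
  field_simp

/-- The threshold, multiplied by the number of rounds. -/
lemma mul_γHat (s : ℕ) (hs : 1 ≤ s) :
    s * p.γHat s = p.e * p.Θ + p.Θ * (p.a * √(s / p.s₀)) + s * p.ν s := by
  have hs' : (0 : ℝ) < s := by exact_mod_cast hs
  have hK : 0 ≤ p.K := by linarith [h.one_le_K]
  have hL := h.L₁_pos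
  rw [h.e_mul_Θ, ← h.A_mul_sqrt s hs'.le]
  have e1 : √((p.d' - 1) / ((s : ℝ) * ((p.k₀ : ℝ) - 1)) * p.L₁) = √(p.K * p.L₁ * s) / s := by
    have : (p.d' - 1) / ((s : ℝ) * ((p.k₀ : ℝ) - 1)) * p.L₁ = p.K * p.L₁ * s / (s : ℝ) ^ 2 := by
      have := h.k₀_ge
      have : (p.k₀ : ℝ) - 1 ≠ 0 := by linarith
      unfold K; field_simp
    rw [this, Real.sqrt_div (by positivity), Real.sqrt_sq hs'.le]
  unfold γHat
  rw [e1]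
  unfold α A
  field_simp

lemma mul_ν_of_le (s : ℕ) (hs0 : s ≤ p.n₀) :
    s * p.ν s = 2 * √3 * √(p.g * p.L₁) * √s := by
  unfold ν
  rw [if_pos hs0, h.sqrt_3gL₁]
  have h2 : (s : ℝ) / √s = √s := Real.div_sqrt
  linear_combination (2 * √3 * √(p.g * p.L₁)) * h2

lemma mul_νA : ((p.n₀ : ℝ) + 1) * p.νA = √3 * √(p.g * p.L₁) * (2 * √p.s₀ + 2) := by
  have := h.hδS
  unfold νA
  rw [h.sqrt_3gL₁, h.sqrt_s₀]
  unfold m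
  have : (0 : ℝ) < (p.n₀ : ℝ) + 1 := by positivity
  field_simp
  ring

omit h in
lemma μ₁_pos : 0 < μ₁ := by
  have h3 : √3 < 2 := by rw [Real.sqrt_lt' (by norm_num)]; norm_num
  unfold μ₁; apply div_pos <;> linarith

lemma a₂_pos : 0 < p.a₂ := by
  have hA := h.A_ge; have := h.L₁_pos
  unfold A at hA
  unfold a₂; positivity

/-- `a₄` in normalized form. -/
lemma a₄_eq : p.a₄ = p.a₁ / p.m + p.G * (128 * p.a + 256 * √3 * (1 + 1 / √p.s₀)) := by
  have hδ := h.hδS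
  have hg := h.one_le_g
  have hk := h.k_ge
  have hm := h.m_ge
  have hR : 0 < p.R := by linarith [h.one_le_R]
  have hL := h.L₁_pos
  have hL2 := h.L₂_pos
  have e1 : p.δS ^ 2 * (p.a₁ / p.k) = p.a₁ / p.m := by unfold m; field_simp
  have e2 : ((p.k₀ : ℝ) - 2) / (p.d' - 2) * p.L₂ = p.L₂ / p.R := by
    unfold R
    rw [div_div_eq_mul_div]; ring
  have e3 : p.δS ^ 2 / (p.k * √p.g) = 24 * √p.L₂ / √p.s₀ := by
    rw [h.sqrt_s₀, Real.sqrt_mul (by linarith)]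
    have h1 : 0 < √p.g := Real.sqrt_pos.2 (by linarith)
    have h2 : 0 < √p.L₂ := Real.sqrt_pos.2 hL2
    unfold m; field_simp
  unfold a₄
  rw [e1, e2, e3, Real.sqrt_div hL2.le]
  unfold a₃ a₂ G a A
  rw [Real.sqrt_mul (by norm_num) p.L₁, Real.sqrt_mul hL.le p.L₂]
  have h1 : 0 < √p.R := Real.sqrt_pos.2 hR
  have h2 := h.sqrt_s₀_pos
  field_simp
  ring

lemma a₁_div_m_le : p.a₁ / p.m ≤ p.G * (192 * p.e) := by
  have h1 := h.α_mul_L₁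
  have hm := h.m_ge
  have hσ := h.σ_nonneg
  have hL := h.L₁_pos
  have h2 : p.a₁ ≤ 8 * (p.α * p.L₁) := by unfold a₁ α; nlinarith
  have : p.a₁ / p.m ≤ 8 * (p.α * p.L₁) / p.m := div_le_div_of_nonneg_right h2 (by linarith)
  rw [mul_div_assoc, h1] at this; linarith

lemma le_a₁_div_m : p.G * (128 * p.e) ≤ p.a₁ / p.m := by
  have h1 := h.α_mul_L₁
  have hm := h.m_ge
  have hσ := h.σ_nonneg
  have hL := h.L₁_pos
  have h2 : 16 / 3 * (p.α * p.L₁) ≤ p.a₁ := by unfold a₁ α; nlinarith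
  have : 16 / 3 * (p.α * p.L₁) / p.m ≤ p.a₁ / p.m := div_le_div_of_nonneg_right h2 (by linarith)
  rw [mul_div_assoc, h1] at this; linarith

lemma le_a₄ : 128 * p.G * (p.a + p.e + 2 * √3) ≤ p.a₄ := by
  rw [h.a₄_eq]
  have h1 := h.le_a₁_div_m
  have h2 : 0 ≤ p.G * (256 * √3 * (1 / √p.s₀)) := by have := h.G_pos; positivity
  nlinarith

lemma a₄_pos : 0 < p.a₄ := lt_of_lt_of_le
  (by have := h.G_pos; have := h.a_pos; have := h.e_pos; positivity) h.le_a₄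

lemma sqrt_R_L₂ : √(((p.k₀ : ℝ) - 2) / ((p.d' - 2) * p.L₂)) = 1 / √(p.R * p.L₂) := by
  have hR := h.one_le_R
  have hL2 := h.L₂_pos
  rw [one_div, ← Real.sqrt_inv]
  congr 1
  unfold R
  have := h.k₀_ge; have := h.k₀_le
  have : (p.k₀ : ℝ) - 2 ≠ 0 := by linarith
  have : p.d' - 2 ≠ 0 := by linarith
  field_simp

omit h in
lemma nine_sub_pos : 5.5 < 9 - 2 * √3 := by
  have h3 : √3 < 1.75 := by rw [Real.sqrt_lt' (by norm_num)]; norm_num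
  linarith

lemma a₂_le_a₅ : p.a₂ ≤ p.a₅ := by
  have h1 := nine_sub_pos
  have h2 := h.a₂_pos
  have h3 := h.σ_nonneg
  have hk := h.k_ge
  have hδ := h.hδS
  unfold a₅
  have e1 : 0 ≤ 36 / (9 - 2 * √3) *
      (p.δS ^ 2 * ((2 + (p.σ : ℝ)) / (9 * p.k)) + 8 / √3
        + (√3 / 9 * p.δS ^ 2) / (p.k * √(p.g * p.L₂))) :=
    mul_nonneg (div_nonneg (by norm_num) (by linarith)) (by positivity)
  have e2 : 0 ≤ 2 * √3 * p.a₂ / (9 - 2 * √3) * √(((p.k₀ : ℝ) - 2) / ((p.d' - 2) * p.L₂)) :=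
    mul_nonneg (div_nonneg (by positivity) (by linarith)) (by positivity)
  linarith

lemma a₅_pos : 0 < p.a₅ := h.a₂_pos.trans_le h.a₂_le_a₅

lemma sqrt_RL₂_ge : 1.87 ≤ √(p.R * p.L₂) := by
  refine Real.le_sqrt_of_sq_le ?_
  nlinarith [h.one_le_R, h.L₂_ge]

omit h in
lemma sqrt_six_le : √6 < 2.45 := by rw [Real.sqrt_lt' (by norm_num)]; norm_num

lemma μ₂_eq : p.μ₂ = 1 / (1 - √6 / (9 * √(p.R * p.L₂))) := rfl

lemma μ₂_denom_pos : 0.8 < 1 - √6 / (9 * √(p.R * p.L₂)) := by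
  have h1 := h.sqrt_RL₂_ge
  have h2 := sqrt_six_le
  have : √6 / (9 * √(p.R * p.L₂)) < 0.2 := by
    rw [div_lt_iff₀ (by linarith)]; linarith
  linarith

lemma one_le_μ₂ : 1 ≤ p.μ₂ := by
  have h1 := h.μ₂_denom_pos
  rw [h.μ₂_eq, le_div_iff₀ (by linarith)]
  have : 0 ≤ √6 / (9 * √(p.R * p.L₂)) := by positivity
  linarith

lemma μ₂_le : p.μ₂ ≤ 1.25 := by
  have h1 := h.μ₂_denom_pos
  rw [h.μ₂_eq, div_le_iff₀ (by linarith)]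
  linarith

lemma mul_νB : ((p.n₁ : ℝ) + 1) * p.νB = √3 * √(p.g * p.L₁) * (2 * √p.s₀ + 2
    + μ₁ * p.a₄ * p.m ^ 2 * p.g * √(∑ τ ∈ Finset.Icc (p.n₀ + 1) p.n₁, 1 / (τ : ℝ) ^ 2)) := by
  have hδ := h.hδS
  unfold νB
  rw [h.sqrt_3gL₁, h.sqrt_s₀]
  have : (0 : ℝ) < (p.n₁ : ℝ) + 1 := by positivity
  have e1 : 48 * (p.k : ℝ) / p.δS ^ 2 = 48 * p.m := by unfold m; ring
  have e2 : μ₁ * p.a₄ * (p.k : ℝ) ^ 2 * p.g / p.δS ^ 4 = μ₁ * p.a₄ * p.m ^ 2 * p.g := by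
    unfold m; field_simp
  rw [e1, e2]
  field_simp
  ring

/-- Lower bound for the part `ν` of the threshold after the first phase. -/
lemma le_mul_ν (s : ℕ) (hs0 : p.n₀ < s) : 2 * √3 * p.Θ ≤ s * p.ν s := by
  have hs' : (0 : ℝ) < s := by exact_mod_cast (by omega : 0 < s)
  have hμ := μ₁_pos
  have ha4 := h.a₄_pos
  have ha5 := h.a₅_pos
  have hμ2 := h.one_le_μ₂
  have hg := h.one_le_g
  have hm := h.m_ge
  have hδ := h.hδS
  have base : 2 * √3 * p.Θ ≤ √3 * √(p.g * p.L₁) * (2 * √p.s₀ + 2) := by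
    rw [← h.sqrt_gL₁_mul]
    have : 0 ≤ √3 * √(p.g * p.L₁) := by positivity
    nlinarith
  have baseB : 2 * √3 * p.Θ ≤ ((p.n₁ : ℝ) + 1) * p.νB := by
    rw [h.mul_νB]
    refine base.trans (mul_le_mul_of_nonneg_left ?_ (by positivity))
    have : 0 ≤ μ₁ * p.a₄ * p.m ^ 2 * p.g
        * √(∑ τ ∈ Finset.Icc (p.n₀ + 1) p.n₁, 1 / (τ : ℝ) ^ 2) := by
      positivity
    linarith
  unfold ν
  rw [if_neg (by omega)]
  split_ifs with h1 h2 h3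
  · have : (s : ℝ) = p.n₀ + 1 := by rw [h1]; push_cast; ring
    rw [this, h.mul_νA]; exact base
  · rw [mul_add]
    have e1 : (s : ℝ) * (((p.n₀ : ℝ) + 1) / s * p.νA) = ((p.n₀ : ℝ) + 1) * p.νA := by field_simp
    rw [e1, h.mul_νA]
    refine base.trans (le_add_of_nonneg_right ?_)
    positivity
  · have : (s : ℝ) = p.n₁ + 1 := by rw [h3]; push_cast; ring
    rw [this]; exact baseB
  · rw [mul_add]
    have e1 : (s : ℝ) * (((p.n₁ : ℝ) + 1) / s * p.νB) = ((p.n₁ : ℝ) + 1) * p.νB := by field_simp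
    rw [e1]
    refine baseB.trans (le_add_of_nonneg_right ?_)
    positivity

end Admissible

end Params

end POSLR

namespace POSLR

/-! ### Upper bounds for the threshold after the first phase -/

section Sums

lemma sum_le_of_telescope (f F : ℕ → ℝ) (n N : ℕ) (hnN : n ≤ N)
    (h : ∀ τ, n ≤ τ → f (τ + 1) ≤ F τ - F (τ + 1)) :
    ∑ τ ∈ Finset.Ioc n N, f τ ≤ F n - F N := by
  induction N, hnN using Nat.le_induction with
  | base => simp
  | succ N hN ih =>
    rw [Finset.sum_Ioc_succ_top hN]
    linarith [h N hN]

lemma sum_one_div_sq_le (n N : ℕ) (hn : 1 ≤ n) :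
    ∑ τ ∈ Finset.Ioc n N, 1 / (τ : ℝ) ^ 2 ≤ 1 / (n : ℝ) := by
  rcases le_total n N with h | h
  · have := sum_le_of_telescope (fun τ => 1 / (τ : ℝ) ^ 2) (fun τ => 1 / (τ : ℝ)) n N h ?_
    · have h2 : (0 : ℝ) ≤ 1 / (N : ℝ) := by positivity
      linarith
    · intro τ hτ
      have hτ' : (0 : ℝ) < τ := by exact_mod_cast (by omega : 0 < τ)
      push_cast
      rw [div_sub_div _ _ hτ'.ne' (by positivity), div_le_div_iff₀ (by positivity) (by positivity)]
      nlinarith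
  · rw [Finset.Ioc_eq_empty (by omega)]; simp

lemma sum_one_div_mul_sqrt_le (n N : ℕ) (hn : 1 ≤ n) :
    ∑ τ ∈ Finset.Ioc n N, 1 / ((τ : ℝ) * √τ) ≤ 2 / √n := by
  rcases le_total n N with h | h
  · have := sum_le_of_telescope (fun τ => 1 / ((τ : ℝ) * √τ)) (fun τ => 2 / √(τ : ℝ)) n N h ?_
    · have h2 : (0 : ℝ) ≤ 2 / √(N : ℝ) := by positivity
      linarith
    · intro τ hτ
      have hτ' : (0 : ℝ) < τ := by exact_mod_cast (by omega : 0 < τ)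
      push_cast
      set u := √(τ : ℝ) with hu
      set v := √((τ : ℝ) + 1) with hv
      have hu0 : 0 < u := Real.sqrt_pos.2 hτ'
      have hv0 : 0 < v := Real.sqrt_pos.2 (by linarith)
      have hu2 : u ^ 2 = τ := Real.sq_sqrt hτ'.le
      have hv2 : v ^ 2 = τ + 1 := Real.sq_sqrt (by linarith)
      have huv : u ≤ v := Real.sqrt_le_sqrt (by linarith)
      rw [← hv2, div_sub_div _ _ hu0.ne' hv0.ne', div_le_div_iff₀ (by positivity) (by positivity)]
      -- the claim is `u ≤ 2 * v * (v - u) * v`, where `(v - u) * (v + u) = 1`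
      have h1 : (v - u) * (v + u) = 1 := by nlinarith
      have h2 : 1 ≤ 2 * v * (v - u) := by nlinarith
      have h3 : u * v * 1 ≤ v ^ 2 * (2 * v * (v - u)) := by
        apply mul_le_mul _ h2 zero_le_one (by positivity)
        nlinarith
      nlinarith
  · rw [Finset.Ioc_eq_empty (by omega)]; simp; positivity

lemma sum_one_div_le_log (n N : ℕ) (hn : 1 ≤ n) (hnN : n ≤ N) :
    ∑ τ ∈ Finset.Ioc n N, 1 / (τ : ℝ) ≤ Real.log (N / n) := by
  have := sum_le_of_telescope (fun τ => 1 / (τ : ℝ)) (fun τ => -Real.log (τ : ℝ)) n N hnN ?_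
  · have hn' : (0 : ℝ) < n := by exact_mod_cast hn
    have hN' : (0 : ℝ) < N := by exact_mod_cast (by omega : 0 < N)
    rw [Real.log_div hN'.ne' hn'.ne']; linarith
  · intro τ hτ
    have hτ' : (0 : ℝ) < τ := by exact_mod_cast (by omega : 0 < τ)
    push_cast
    have h1 := Real.log_le_sub_one_of_pos (x := (τ : ℝ) / (τ + 1)) (by positivity)
    rw [Real.log_div hτ'.ne' (by positivity)] at h1
    have h2 : (τ : ℝ) / (τ + 1) - 1 = -(1 / ((τ : ℝ) + 1)) := by field_simp; ring
    linarith

lemma log_le_div_exp_one {x : ℝ} (hx : 0 < x) : Real.log x ≤ x / Real.exp 1 := by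
  have h := Real.log_le_sub_one_of_pos (x := x / Real.exp 1) (by positivity)
  rw [Real.log_div hx.ne' (Real.exp_pos _).ne', Real.log_exp] at h
  linarith

end Sums

namespace Params

variable (p : Params)

/-- The constant in the upper bound `Θ * (b + 1.07 * a * √(s / s₀))` for `s * γHat s` after the first
phase. The three summands collect what does not depend on the noise, the contribution of the
`1/√s`-term to the second phase of `ν`, and the `1/s`-term with its contribution to that phase; the
factor `1.07` covers the third phase. -/
noncomputable def b : ℝ := 5.65 + 0.63 * p.a + 1.95 * p.e

namespace Admissible

set_option linter.unusedSectionVars false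

variable {p} (h : p.Admissible)
include h

lemma s₀_le_n₀ : p.s₀ ≤ p.n₀ := Nat.le_ceil _

lemma n₀_lt : (p.n₀ : ℝ) < p.s₀ + 1 := Nat.ceil_lt_add_one h.s₀_pos.le

lemma s₁_le_n₁ : p.s₁ ≤ p.n₁ := Nat.le_ceil _

lemma one_le_n₀ : 1 ≤ p.n₀ := by
  have : (1 : ℝ) ≤ p.n₀ := by linarith [h.s₀_le_n₀, h.s₀_ge']
  exact_mod_cast this

lemma s₁_ge : p.s₀ * p.L₁ ≤ p.s₁ := by
  rw [h.s₁_eq]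
  have := h.s₀_pos
  have := h.L₁_pos
  have := h.one_le_R
  gcongr
  nlinarith

lemma s₁_pos : 0 < p.s₁ := lt_of_lt_of_le (mul_pos h.s₀_pos h.L₁_pos) h.s₁_ge

lemma n₁_pos : (0 : ℝ) < p.n₁ := h.s₁_pos.trans_le h.s₁_le_n₁

variable (hL : 24 ≤ p.L₁)
include hL

lemma L₂_ge_25 : 25 ≤ p.L₂ := by
  have h1 := h.L₁_eq
  have h2 := h.L₂_eq
  linarith [h.log_d_ge]

lemma s₀_ge_of_L₁ : 129600 ≤ p.s₀ := by
  have h1 := h.s₀_ge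
  nlinarith [h.one_le_g, h.L₂_ge_25 hL]

lemma sqrt_s₀_ge : 360 ≤ √p.s₀ :=
  Real.le_sqrt_of_sq_le (by linarith [h.s₀_ge_of_L₁ hL])

omit h hL in
lemma sqrt_three_bounds : 1.732 < √3 ∧ √3 < 1.7321 := by
  constructor
  · rw [Real.lt_sqrt (by norm_num)]; norm_num
  · rw [Real.sqrt_lt' (by norm_num)]; norm_num

lemma μ₁_le : μ₁ ≤ 1.62585 := by
  have h1 := sqrt_three_bounds.2
  unfold μ₁
  rw [div_le_iff₀ (by linarith)]; linarith

lemma sqrt_RL₂_ge_five : 5 ≤ √(p.R * p.L₂) := by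
  refine Real.le_sqrt_of_sq_le ?_
  nlinarith [h.one_le_R, h.L₂_ge_25 hL]

lemma μ₂_le_of_L₁ : p.μ₂ ≤ 1.058 := by
  have h1 := h.sqrt_RL₂_ge_five hL
  have h2 := sqrt_six_le
  have : √6 / (9 * √(p.R * p.L₂)) ≤ 0.0545 := by
    rw [div_le_iff₀ (by linarith)]; linarith
  rw [h.μ₂_eq, div_le_iff₀ (by linarith)]
  linarith

/-- The contribution of the second phase to `ν`. -/
lemma phase_two_term_le (N : ℕ) :
    μ₁ * p.a₄ * p.m ^ 2 * p.g * √(∑ τ ∈ Finset.Icc (p.n₀ + 1) N, 1 / (τ : ℝ) ^ 2)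
      ≤ √p.s₀ * (1.2552 + 0.36131 * p.a + 0.542 * p.e) := by
  have hs := h.sqrt_s₀_pos
  have hs0 := h.s₀_pos
  have hL2 := h.L₂_pos
  have hμ := μ₁_pos
  have ha4 := h.a₄_pos
  have ha := h.a_pos
  have he := h.e_pos
  have hg := h.one_le_g
  have hm := h.m_ge
  have h1 : √(∑ τ ∈ Finset.Icc (p.n₀ + 1) N, 1 / (τ : ℝ) ^ 2) ≤ 1 / √p.s₀ := by
    rw [one_div, ← Real.sqrt_inv]
    refine Real.sqrt_le_sqrt ?_
    have : Finset.Icc (p.n₀ + 1) N = Finset.Ioc p.n₀ N := by ext; simp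
    rw [this]
    refine (sum_one_div_sq_le p.n₀ N h.one_le_n₀).trans ?_
    rw [one_div]
    exact inv_anti₀ hs0 h.s₀_le_n₀
  have h2 : p.m ^ 2 * p.g = p.s₀ / (576 * p.L₂) := by rw [h.s₀_eq]; field_simp
  have h3 : p.a₄ ≤ p.L₂ * (128 * p.a + 444.67 + 192 * p.e) := by
    rw [h.a₄_eq]
    have h4 := h.a₁_div_m_le
    have h5 : 1 / √p.s₀ ≤ 1 / 360 := one_div_le_one_div_of_le (by norm_num) (h.sqrt_s₀_ge hL)
    have h6 := sqrt_three_bounds.2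
    have h7 : 256 * √3 * (1 + 1 / √p.s₀) ≤ 444.67 := by
      have : √3 * (1 + 1 / √p.s₀) ≤ 1.7321 * (1 + 1 / 360) := by gcongr
      linarith
    have h8 : p.G * (192 * p.e + 128 * p.a + 444.67) ≤ p.L₂ * (192 * p.e + 128 * p.a + 444.67) :=
      mul_le_mul_of_nonneg_right h.G_le_L₂ (by positivity)
    have h9 : p.G * (256 * √3 * (1 + 1 / √p.s₀)) ≤ p.G * 444.67 :=
      mul_le_mul_of_nonneg_left h7 h.G_pos.le
    linarith
  have h4 : μ₁ * p.a₄ ≤ 1.62585 * (p.L₂ * (128 * p.a + 444.67 + 192 * p.e)) :=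
    mul_le_mul (h.μ₁_le hL) h3 ha4.le (by norm_num)
  calc μ₁ * p.a₄ * p.m ^ 2 * p.g * √(∑ τ ∈ Finset.Icc (p.n₀ + 1) N, 1 / (τ : ℝ) ^ 2)
      = μ₁ * p.a₄ * (p.s₀ / (576 * p.L₂)) * √(∑ τ ∈ Finset.Icc (p.n₀ + 1) N, 1 / (τ : ℝ) ^ 2) := by
        rw [← h2]; ring
    _ ≤ 1.62585 * (p.L₂ * (128 * p.a + 444.67 + 192 * p.e)) * (p.s₀ / (576 * p.L₂))
          * (1 / √p.s₀) := by gcongr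
    _ = √p.s₀ * (1.62585 / 576 * (128 * p.a + 444.67 + 192 * p.e)) := by
        have e1 : p.s₀ * (1 / √p.s₀) = √p.s₀ := by rw [mul_one_div, Real.div_sqrt]
        have e2 : 1.62585 * (p.L₂ * (128 * p.a + 444.67 + 192 * p.e)) * (p.s₀ / (576 * p.L₂))
            * (1 / √p.s₀) = 1.62585 / 576 * (128 * p.a + 444.67 + 192 * p.e)
            * (p.s₀ * (1 / √p.s₀)) := by field_simp
        rw [e2, e1]; ring
    _ ≤ _ := by
        refine mul_le_mul_of_nonneg_left ?_ hs.le
        linarith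

lemma a₅_le : p.a₅ ≤ 0.29 * (24 * (p.A * √p.L₂)) := by
  have h1 := nine_sub_pos
  have h3 := sqrt_three_bounds
  have hσ := h.σ_nonneg
  have hσA := h.σ_le
  have hA := h.A_ge
  have hk := h.k_ge
  have hδ := h.hδS
  have hδ1 := h.hδS1
  have hL2 : 5 ≤ √p.L₂ := Real.le_sqrt_of_sq_le (by linarith [h.L₂_ge_25 hL])
  have hL12 : √p.L₁ ≤ √p.L₂ := Real.sqrt_le_sqrt h.L₁_le_L₂
  have hden : 36 / (9 - 2 * √3) ≤ 6.5035 := by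
    rw [div_le_iff₀ (by linarith)]; linarith
  have ha2 : p.a₂ ≤ 16 / 3 * (p.A * √p.L₂) := by
    have : p.a₂ = 16 / 3 * (p.A * √p.L₁) := by unfold a₂ A; ring
    rw [this]; gcongr
  have hRL : 1 / √(p.R * p.L₂) ≤ 1 / 5 :=
    one_div_le_one_div_of_le (by norm_num) (h.sqrt_RL₂_ge_five hL)
  have t1 : p.δS ^ 2 * ((2 + (p.σ : ℝ)) / (9 * p.k)) ≤ (2 + (p.σ : ℝ)) / 27 := by
    calc p.δS ^ 2 * ((2 + (p.σ : ℝ)) / (9 * p.k)) ≤ 1 * ((2 + (p.σ : ℝ)) / (9 * 3)) := by gcongr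
      _ = _ := by ring
  have t2 : 8 / √3 ≤ 4.619 := by rw [div_le_iff₀ (by linarith)]; linarith
  have hgL : 5 ≤ √(p.g * p.L₂) := by
    refine Real.le_sqrt_of_sq_le ?_
    nlinarith [h.one_le_g, h.L₂_ge_25 hL]
  have t3 : (√3 / 9 * p.δS ^ 2) / (p.k * √(p.g * p.L₂)) ≤ 0.0129 := by
    rw [div_le_iff₀ (by positivity)]
    have e1 : √3 / 9 * p.δS ^ 2 ≤ 1.7321 / 9 * 1 := by gcongr; linarith
    have e2 : 3 * 5 ≤ p.k * √(p.g * p.L₂) := by gcongr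
    linarith
  have t4 : 36 / (9 - 2 * √3) * (p.δS ^ 2 * ((2 + (p.σ : ℝ)) / (9 * p.k)) + 8 / √3
        + (√3 / 9 * p.δS ^ 2) / (p.k * √(p.g * p.L₂)))
      ≤ 6.5035 * ((2 + (p.σ : ℝ)) / 27 + 4.619 + 0.0129) := by
    refine mul_le_mul hden (by linarith) (by positivity) (by norm_num)
  have t5 : 2 * √3 * p.a₂ / (9 - 2 * √3) * √(((p.k₀ : ℝ) - 2) / ((p.d' - 2) * p.L₂))
      ≤ 0.1252 * p.a₂ := by
    rw [h.sqrt_R_L₂]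
    have ha := h.a₂_pos
    have e1 : 2 * √3 * p.a₂ / (9 - 2 * √3) ≤ 0.626 * p.a₂ := by
      rw [div_le_iff₀ (by linarith)]
      nlinarith
    have e0 : 0 ≤ 2 * √3 * p.a₂ / (9 - 2 * √3) := div_nonneg (by positivity) (by linarith)
    calc 2 * √3 * p.a₂ / (9 - 2 * √3) * (1 / √(p.R * p.L₂)) ≤ 0.626 * p.a₂ * (1 / 5) := by gcongr
      _ = _ := by ring
  have t6 : 6.9 * 5 ≤ p.A * √p.L₂ := by gcongr
  have t7 : p.A * 5 ≤ p.A * √p.L₂ := by gcongr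
  unfold a₅
  nlinarith

/-- The contribution of the third phase to `ν`. -/
lemma phase_three_term_le (s : ℕ) (hs : p.n₁ + 1 < s) :
    p.μ₂ * p.a₅ / p.δS ^ 2 * √(∑ τ ∈ Finset.Icc (p.n₁ + 1) (s - 1),
          (p.k : ℝ) ^ 2 * (p.d' - 1) / ((τ : ℝ) * ((p.k₀ : ℝ) - 1)))
      ≤ √p.s₀ * (0.0381 * p.a * √(s / p.s₀)) := by
  have hδ := h.hδS
  have hm := h.m_ge
  have hk0 := h.k₀_ge
  have hK := h.one_le_K
  have hR := h.one_le_R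
  have hL2 := h.L₂_pos
  have hs0 := h.s₀_pos
  have hss := h.sqrt_s₀_pos
  have hs1 := h.s₁_pos
  have hA := h.A_ge
  have ha5 := h.a₅_pos
  have hμ2 := h.one_le_μ₂
  have hs' : (0 : ℝ) < s := by exact_mod_cast (by omega : 0 < s)
  have hn1 : 1 ≤ p.n₁ := by exact_mod_cast (by exact_mod_cast h.n₁_pos : 0 < p.n₁)
  have e1 : ∑ τ ∈ Finset.Icc (p.n₁ + 1) (s - 1),
      (p.k : ℝ) ^ 2 * (p.d' - 1) / ((τ : ℝ) * ((p.k₀ : ℝ) - 1))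
      = (p.k : ℝ) ^ 2 * (p.K * ∑ τ ∈ Finset.Ioc p.n₁ (s - 1), 1 / (τ : ℝ)) := by
    have : Finset.Icc (p.n₁ + 1) (s - 1) = Finset.Ioc p.n₁ (s - 1) := by
      ext; simp
    rw [this, Finset.mul_sum, Finset.mul_sum]
    refine Finset.sum_congr rfl fun τ hτ => ?_
    have h1 : (p.k₀ : ℝ) - 1 ≠ 0 := by linarith
    unfold K
    rw [mul_comm (τ : ℝ), ← div_div]; ring
  have e2 : ∑ τ ∈ Finset.Ioc p.n₁ (s - 1), 1 / (τ : ℝ) ≤ s / p.s₁ / Real.exp 1 := by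
    refine (sum_one_div_le_log p.n₁ (s - 1) hn1 (by omega)).trans ?_
    have h3 : ((s - 1 : ℕ) : ℝ) / p.n₁ ≤ s / p.s₁ := by
      have : ((s - 1 : ℕ) : ℝ) ≤ s := by exact_mod_cast Nat.sub_le _ _
      have := h.s₁_le_n₁
      gcongr
    have h4 : (0 : ℝ) < ((s - 1 : ℕ) : ℝ) / p.n₁ := by
      have : (0 : ℝ) < ((s - 1 : ℕ) : ℝ) := by exact_mod_cast (by omega : 0 < s - 1)
      have := h.n₁_pos
      positivity
    exact (Real.log_le_log h4 h3).trans (log_le_div_exp_one (by positivity))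
  have e3 : p.K * ∑ τ ∈ Finset.Ioc p.n₁ (s - 1), 1 / (τ : ℝ)
      ≤ (s / p.s₀) * p.K / (p.R * 65.2) := by
    have h5 : (65.2 : ℝ) ≤ p.L₁ * Real.exp 1 := by
      have := Real.exp_one_gt_d9
      nlinarith
    have h6 : s / p.s₁ / Real.exp 1 ≤ (s / p.s₀) / (p.R * 65.2) := by
      rw [h.s₁_eq, div_div, div_div]
      refine div_le_div_of_nonneg_left hs'.le (by positivity) ?_
      have : p.s₀ * (p.R * 65.2) ≤ p.s₀ * (p.R * (p.L₁ * Real.exp 1)) := by gcongr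
      linarith
    calc p.K * ∑ τ ∈ Finset.Ioc p.n₁ (s - 1), 1 / (τ : ℝ) ≤ p.K * ((s / p.s₀) / (p.R * 65.2)) :=
          mul_le_mul_of_nonneg_left (e2.trans h6) (by linarith)
      _ = _ := by ring
  have e4 : √((p.k : ℝ) ^ 2 * (p.K * ∑ τ ∈ Finset.Ioc p.n₁ (s - 1), 1 / (τ : ℝ)))
      ≤ p.k * (√(s / p.s₀) * √p.K / (√p.R * 8.07)) := by
    rw [Real.sqrt_mul (by positivity), Real.sqrt_sq (by positivity)]
    refine mul_le_mul_of_nonneg_left ?_ (by positivity)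
    refine (Real.sqrt_le_sqrt e3).trans ?_
    rw [Real.sqrt_div (by positivity), Real.sqrt_mul (by positivity), Real.sqrt_mul (by linarith)]
    have : 8.07 ≤ √65.2 := Real.le_sqrt_of_sq_le (by norm_num)
    have : 0 < √p.R := Real.sqrt_pos.2 (by linarith)
    gcongr
  have e5 : √p.s₀ = 24 * p.m * (√p.K * √p.R * √p.L₂) := by
    rw [h.sqrt_s₀, h.g_eq, Real.sqrt_mul (by positivity), Real.sqrt_mul (by linarith)]
  have hRp : 0 < √p.R := Real.sqrt_pos.2 (by linarith)
  rw [e1]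
  calc p.μ₂ * p.a₅ / p.δS ^ 2 * √((p.k : ℝ) ^ 2 * (p.K * ∑ τ ∈ Finset.Ioc p.n₁ (s - 1), 1 / (τ : ℝ)))
      ≤ 1.058 * (0.29 * (24 * (p.A * √p.L₂))) / p.δS ^ 2
          * (p.k * (√(s / p.s₀) * √p.K / (√p.R * 8.07))) := by
        have := h.μ₂_le_of_L₁ hL
        have := h.a₅_le hL
        gcongr
    _ = 1.058 * 0.29 / 8.07 * (24 * p.m * (√p.K * √p.L₂) * (p.A / √p.R) * √(s / p.s₀)) := by
        unfold m; field_simp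
    _ = 1.058 * 0.29 / 8.07 * (√p.s₀ * p.a * √(s / p.s₀)) / √p.R := by
        rw [e5]; unfold a; field_simp
    _ ≤ 1.058 * 0.29 / 8.07 * (√p.s₀ * p.a * √(s / p.s₀)) / 1 := by
        have : 1 ≤ √p.R := Real.one_le_sqrt.2 hR
        have := h.a_pos
        gcongr
    _ ≤ _ := by
        have : 0 ≤ √p.s₀ * p.a * √(s / p.s₀) := by have := h.a_pos; positivity
        linarith

/-- Upper bound for the part `ν` of the threshold. -/
lemma mul_ν_le (s : ℕ) (hs : p.n₀ + 1 < s) :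
    s * p.ν s ≤ p.Θ * (5.65 + 0.63 * p.a + 0.95 * p.e + 0.07 * p.a * √(s / p.s₀)) := by
  have hs' : (0 : ℝ) < s := by exact_mod_cast (by omega : 0 < s)
  have h3 := sqrt_three_bounds
  have hS := h.sqrt_s₀_ge hL
  have hδ := h.hδS
  have ha := h.a_pos
  have he := h.e_pos
  have hΘ := h.Θ_pos
  have hr : 0 ≤ √(s / p.s₀) := Real.sqrt_nonneg _
  set Z := √3 * √(p.g * p.L₁) with hZ
  have hZ0 : 0 ≤ Z := by positivity
  have hZΘ : Z * √p.s₀ = √3 * p.Θ := by rw [← h.sqrt_gL₁_mul, hZ]; ring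
  have key : ∀ V W : ℝ, V ≤ √p.s₀ * (1.2552 + 0.36131 * p.a + 0.542 * p.e) →
      W ≤ √p.s₀ * (0.0381 * p.a * √(s / p.s₀)) →
      Z * (2 * √p.s₀ + 2 + V + W)
        ≤ p.Θ * (5.65 + 0.63 * p.a + 0.95 * p.e + 0.07 * p.a * √(s / p.s₀)) := by
    intro V W hV hW
    have h1 : 2 * √p.s₀ + 2 + V + W ≤ √p.s₀ * (2 + 1 / 180 + (1.2552 + 0.36131 * p.a + 0.542 * p.e)
        + 0.0381 * p.a * √(s / p.s₀)) := by linarith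
    calc Z * (2 * √p.s₀ + 2 + V + W)
        ≤ Z * (√p.s₀ * (2 + 1 / 180 + (1.2552 + 0.36131 * p.a + 0.542 * p.e)
          + 0.0381 * p.a * √(s / p.s₀))) := mul_le_mul_of_nonneg_left h1 hZ0
      _ = p.Θ * (√3 * (2 + 1 / 180 + (1.2552 + 0.36131 * p.a + 0.542 * p.e)
          + 0.0381 * p.a * √(s / p.s₀))) := by rw [← mul_assoc, hZΘ]; ring
      _ ≤ _ := by
          refine mul_le_mul_of_nonneg_left ?_ hΘ.le
          have har : 0 ≤ p.a * √(s / p.s₀) := by positivity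
          calc √3 * (2 + 1 / 180 + (1.2552 + 0.36131 * p.a + 0.542 * p.e)
              + 0.0381 * p.a * √(s / p.s₀))
              ≤ 1.7321 * (2 + 1 / 180 + (1.2552 + 0.36131 * p.a + 0.542 * p.e)
              + 0.0381 * p.a * √(s / p.s₀)) := by gcongr; exact h3.2.le
            _ ≤ _ := by nlinarith
  have hW0 : (0 : ℝ) ≤ √p.s₀ * (0.0381 * p.a * √(s / p.s₀)) := by positivity
  have eA := h.mul_νA
  have eB := h.mul_νB
  rw [← hZ] at eA eB
  unfold ν
  rw [if_neg (by omega), if_neg (by omega)]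
  split_ifs with h1 h2
  · have e0 : √(∑ τ ∈ Finset.Icc (p.n₀ + 1) (s - 1), (p.k : ℝ) ^ 4 * p.g ^ 2 / (τ : ℝ) ^ 2)
        = p.k ^ 2 * p.g * √(∑ τ ∈ Finset.Icc (p.n₀ + 1) (s - 1), 1 / (τ : ℝ) ^ 2) := by
      have hg := h.one_le_g
      rw [← Real.sqrt_sq (by positivity : (0 : ℝ) ≤ p.k ^ 2 * p.g), ← Real.sqrt_mul (by positivity),
        Finset.mul_sum]
      congr 1
      exact Finset.sum_congr rfl fun τ _ => by ring
    have e1 : (s : ℝ) * (((p.n₀ : ℝ) + 1) / s * p.νA + 1 / (s : ℝ) * √(3 * p.g * p.L₁)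
        * (μ₁ * p.a₄ / p.δS ^ 4) * √(∑ τ ∈ Finset.Icc (p.n₀ + 1) (s - 1),
          (p.k : ℝ) ^ 4 * p.g ^ 2 / (τ : ℝ) ^ 2))
        = Z * (2 * √p.s₀ + 2 + μ₁ * p.a₄ * p.m ^ 2 * p.g *
          √(∑ τ ∈ Finset.Icc (p.n₀ + 1) (s - 1), 1 / (τ : ℝ) ^ 2) + 0) := by
      rw [e0, h.sqrt_3gL₁, ← hZ, add_zero, mul_add Z, ← eA]
      unfold m; field_simp
    rw [e1]
    exact key _ _ (h.phase_two_term_le hL _) hW0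
  · have : (s : ℝ) = p.n₁ + 1 := by rw [h2]; push_cast; ring
    have e1 : (s : ℝ) * p.νB = Z * (2 * √p.s₀ + 2 + μ₁ * p.a₄ * p.m ^ 2 * p.g *
          √(∑ τ ∈ Finset.Icc (p.n₀ + 1) p.n₁, 1 / (τ : ℝ) ^ 2) + 0) := by
      rw [this, add_zero]; exact eB
    rw [e1]
    exact key _ _ (h.phase_two_term_le hL _) hW0
  · have e1 : (s : ℝ) * (((p.n₁ : ℝ) + 1) / s * p.νB + 1 / (s : ℝ) * √(3 * p.g * p.L₁)
        * (p.μ₂ * p.a₅ / p.δS ^ 2) * √(∑ τ ∈ Finset.Icc (p.n₁ + 1) (s - 1),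
          (p.k : ℝ) ^ 2 * (p.d' - 1) / ((τ : ℝ) * ((p.k₀ : ℝ) - 1))))
        = Z * (2 * √p.s₀ + 2 + μ₁ * p.a₄ * p.m ^ 2 * p.g *
          √(∑ τ ∈ Finset.Icc (p.n₀ + 1) p.n₁, 1 / (τ : ℝ) ^ 2) +
          p.μ₂ * p.a₅ / p.δS ^ 2 * √(∑ τ ∈ Finset.Icc (p.n₁ + 1) (s - 1),
          (p.k : ℝ) ^ 2 * (p.d' - 1) / ((τ : ℝ) * ((p.k₀ : ℝ) - 1)))) := by
      rw [h.sqrt_3gL₁, ← hZ, mul_add Z, ← eB]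
      generalize √(∑ τ ∈ Finset.Icc (p.n₁ + 1) (s - 1),
          (p.k : ℝ) ^ 2 * (p.d' - 1) / ((τ : ℝ) * ((p.k₀ : ℝ) - 1))) = W
      field_simp
    rw [e1]
    exact key _ _ (h.phase_two_term_le hL _) (h.phase_three_term_le hL s (by omega))

/-- The upper bound for the threshold in normalized form. -/
lemma mul_γHat_le (s : ℕ) (hs : p.n₀ + 1 < s) :
    s * p.γHat s ≤ p.Θ * (p.b + 1.07 * p.a * √(s / p.s₀)) := by
  rw [h.mul_γHat s (by omega)]
  have := h.mul_ν_le hL s hs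
  unfold b
  nlinarith

end Admissible

end Params

end POSLR

namespace POSLR

/-! ### The recursion for the estimation error -/

lemma sum_radius_sq_le (α β : ℝ) (hα : 0 ≤ α) (hβ : 0 ≤ β) (n N : ℕ) (hn : 1 ≤ n) (hnN : n ≤ N) :
    ∑ τ ∈ Finset.Ioc n N, (β ^ 2 * (1 / (τ : ℝ) ^ 2) + 2 * α * β * (1 / ((τ : ℝ) * √τ))
      + α ^ 2 * (1 / (τ : ℝ)))
      ≤ β ^ 2 / n + 4 * α * β / √n + α ^ 2 * Real.log (N / n) := by
  rw [Finset.sum_add_distrib, Finset.sum_add_distrib, ← Finset.mul_sum, ← Finset.mul_sum,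
    ← Finset.mul_sum]
  have h1 := mul_le_mul_of_nonneg_left (sum_one_div_sq_le n N hn) (sq_nonneg β)
  have h2 := mul_le_mul_of_nonneg_left (sum_one_div_mul_sqrt_le n N hn)
    (by positivity : 0 ≤ 2 * α * β)
  have h3 := mul_le_mul_of_nonneg_left (sum_one_div_le_log n N hn hnN) (sq_nonneg α)
  have e1 : β ^ 2 * (1 / (n : ℝ)) = β ^ 2 / n := by ring
  have e2 : 2 * α * β * (2 / √(n : ℝ)) = 4 * α * β / √n := by ring
  linarith

lemma radius_sq_eq (α β : ℝ) (τ : ℝ) (hτ : 0 < τ) :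
    (β / τ + α / √τ) ^ 2 = β ^ 2 * (1 / τ ^ 2) + 2 * α * β * (1 / (τ * √τ)) + α ^ 2 * (1 / τ) := by
  have h : √τ ^ 2 = τ := Real.sq_sqrt hτ.le
  have h0 : 0 < √τ := Real.sqrt_pos.2 hτ
  rw [add_sq, div_pow, div_pow, h]
  field_simp

namespace Params

variable (p : Params)

/-- From round `n₂` on the error bound for the estimators is used; before, they are only known to be
bounded. The factor `7 / 4` balances the cost of the early rounds against the quality of the error
bound, which is poor for small `s / s₀`. -/
noncomputable def n₂ : ℕ := ⌈7 / 4 * p.s₀⌉₊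

namespace Admissible

set_option linter.unusedSectionVars false

variable {p} (h : p.Admissible)
include h

lemma le_n₂ : 7 / 4 * p.s₀ ≤ p.n₂ := Nat.le_ceil _

lemma n₂_lt : (p.n₂ : ℝ) < 7 / 4 * p.s₀ + 1 :=
  Nat.ceil_lt_add_one (by linarith [h.s₀_pos])

lemma n₀_add_one_le_n₂ : p.n₀ + 1 ≤ p.n₂ := by
  have : ((p.n₀ + 1 : ℕ) : ℝ) ≤ p.n₂ := by
    push_cast; linarith [h.n₀_lt, h.le_n₂, h.s₀_ge']
  exact_mod_cast this

lemma one_le_n₂ : 1 ≤ p.n₂ := le_trans (by omega) h.n₀_add_one_le_n₂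

lemma b_pos : 0 < p.b := by
  have := h.a_pos; have := h.e_pos
  unfold b; linarith

lemma sqrt_ratio_le (s : ℝ) (hs : 7 / 4 * p.s₀ ≤ s) : √(p.s₀ / s) ≤ 0.756 := by
  have h0 := h.s₀_pos
  have hs' : 0 < s := by linarith
  rw [Real.sqrt_le_left (by norm_num), div_le_iff₀ hs']
  nlinarith

/-- In the first phase the threshold dominates the deviations allowed by the total variance. -/
lemma variance_le_early (s : ℕ) (hs : 1 ≤ s) (hs0 : s ≤ p.n₀) (Q : ℝ) (hQ : Q ≤ s) :
    2 * p.L₁ * (13 / 9 * (p.σ : ℝ) ^ 2 * p.K * s + 16 / 3 * p.g * Q) ≤ (s * p.γHat s) ^ 2 := by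
  have hs' : (0 : ℝ) < s := by exact_mod_cast hs
  have hK := h.one_le_K
  have hg := h.one_le_g
  have hL := h.L₁_pos
  have hσ := h.σ_nonneg
  have hA := h.σ_le
  have ha := h.a_pos
  have he := h.e_pos
  have hΘ := h.Θ_pos
  rw [h.mul_γHat s hs, ← h.A_mul_sqrt s hs'.le, h.mul_ν_of_le s hs0]
  set u := √(p.K * p.L₁ * s) with hu
  have hu2 : u ^ 2 = p.K * p.L₁ * s := Real.sq_sqrt (by positivity)
  have hu0 : 0 ≤ u := Real.sqrt_nonneg _
  set v := √(p.g * p.L₁) * √s with hv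
  have hv2 : v ^ 2 = p.g * p.L₁ * s := by
    rw [hv, mul_pow, Real.sq_sqrt (by positivity), Real.sq_sqrt hs'.le]
  have hv0 : 0 ≤ v := by positivity
  have h3 : √3 ^ 2 = 3 := Real.sq_sqrt (by norm_num)
  have e0 : p.e * p.Θ + p.A * u + 2 * √3 * √(p.g * p.L₁) * √s
      = p.e * p.Θ + (p.A * u + 2 * √3 * v) := by rw [hv]; ring
  rw [e0]
  have h1 : (p.A * u) ^ 2 + (2 * √3 * v) ^ 2 ≤ (p.e * p.Θ + (p.A * u + 2 * √3 * v)) ^ 2 := by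
    have hA0 : 0 ≤ p.A := by linarith [h.A_ge]
    have x1 : 0 ≤ p.e * p.Θ := by positivity
    have x2 : 0 ≤ p.A * u := by positivity
    have x3 : 0 ≤ 2 * √3 * v := by positivity
    nlinarith [mul_nonneg x1 x2, mul_nonneg x1 x3, mul_nonneg x2 x3]
  refine le_trans ?_ h1
  have e1 : (2 * √3 * v) ^ 2 = 12 * (p.g * p.L₁ * s) := by
    rw [mul_pow, mul_pow, h3, hv2]; ring
  have e2 : (p.A * u) ^ 2 = p.A ^ 2 * (p.K * p.L₁ * s) := by rw [mul_pow, hu2]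
  rw [e1, e2]
  have hA2 : 2.89 * (p.σ : ℝ) ^ 2 ≤ p.A ^ 2 := by nlinarith
  have y1 : 2.89 * (p.σ : ℝ) ^ 2 * (p.K * p.L₁ * s) ≤ p.A ^ 2 * (p.K * p.L₁ * s) :=
    mul_le_mul_of_nonneg_right hA2 (by positivity)
  have y2 : p.L₁ * p.g * Q ≤ p.L₁ * p.g * s := mul_le_mul_of_nonneg_left hQ (by positivity)
  have y3 : 0 ≤ (p.σ : ℝ) ^ 2 * (p.K * p.L₁ * s) := by positivity
  have y4 : 0 ≤ p.L₁ * p.g * s := by positivity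
  linarith

omit h in
/-- The inequality that closes the induction over the rounds, in normalized form: `u` stands for
`a * √(s / s₀)`, the noise takes the share `0.695 * u ^ 2` and the sampling the rest of the left hand
side, and the right hand side is a lower bound for the squared threshold. -/
lemma recursion_poly (a e b u : ℝ) (ha : 0 ≤ a) (he : 0 ≤ e) (hb : b = 5.65 + 0.63 * a + 1.95 * e)
    (ha7 : a ^ 2 ≤ 7) (hu : 1.4142 * a ≤ u) :
    0.695 * u ^ 2 + 2.0808 * (1.7502 + 0.17623 * (4 / 7 * b ^ 2 + 3.024 * 1.07 * a * b
      + 1.1449 * (4 / 7 * u ^ 2 - a ^ 2))) ≤ (e + u + 3.464) ^ 2 := by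
  subst hb
  have ha3 : a ≤ 2.646 := by nlinarith
  have h1 : 0 ≤ u - 1.4142 * a := by linarith
  have h2 : 0 ≤ e * (u - 1.4142 * a) := mul_nonneg he h1
  have h3 : 0 ≤ a * (u - 1.4142 * a) := mul_nonneg ha h1
  have h4 : 0 ≤ a * (2.646 - a) := mul_nonneg ha (by linarith)
  have h5 : 0 ≤ e * (2.646 - a) := mul_nonneg he (by linarith)
  nlinarith [sq_nonneg e, mul_nonneg ha he, sq_nonneg (u - 1.4142 * a)]

/-- The missed mass in units of `s₀`, in terms of the `1/√s`-term of the threshold. -/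
lemma missed_mass_le (hL : 24 ≤ p.L₁) (s : ℕ) (hn2s : p.n₂ < s) (Q : ℝ)
    (hQ' : Q ≤ p.n₂ + 1 + 1.586 / 9 * p.s₀ * ∑ τ ∈ Finset.Ioc p.n₂ (s - 1),
      (p.b * √p.s₀ / τ + 1.07 * p.a / √τ) ^ 2) :
    Q / p.s₀ ≤ 1.7502 + 0.17623 * (4 / 7 * p.b ^ 2 + 3.024 * 1.07 * p.a * p.b
      + 1.1449 * (4 / 7 * (p.a * √(s / p.s₀)) ^ 2 - p.a ^ 2)) := by
  have h0 := h.s₀_pos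
  have ha := h.a_pos
  have hb := h.b_pos
  have hs' : (0 : ℝ) < s := by exact_mod_cast (by omega : 0 < s)
  set t := √(s / p.s₀) with ht
  have ht2 : t ^ 2 = s / p.s₀ := Real.sq_sqrt (by positivity)
  have hn2pos : (0 : ℝ) < p.n₂ := by exact_mod_cast h.one_le_n₂
  have hn2le := h.le_n₂
  have hsum : ∑ τ ∈ Finset.Ioc p.n₂ (s - 1), (p.b * √p.s₀ / τ + 1.07 * p.a / √τ) ^ 2
      ≤ 4 / 7 * p.b ^ 2 + 3.024 * 1.07 * p.a * p.b
        + 1.1449 * (4 / 7 * (p.a * t) ^ 2 - p.a ^ 2) := by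
    have e1 : ∑ τ ∈ Finset.Ioc p.n₂ (s - 1), (p.b * √p.s₀ / τ + 1.07 * p.a / √τ) ^ 2
        = ∑ τ ∈ Finset.Ioc p.n₂ (s - 1), ((p.b * √p.s₀) ^ 2 * (1 / (τ : ℝ) ^ 2)
          + 2 * (1.07 * p.a) * (p.b * √p.s₀) * (1 / ((τ : ℝ) * √τ))
          + (1.07 * p.a) ^ 2 * (1 / (τ : ℝ))) := by
      refine Finset.sum_congr rfl fun τ hτ => ?_
      rw [Finset.mem_Ioc] at hτ
      exact radius_sq_eq _ _ _ (by exact_mod_cast (by omega : 0 < τ))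
    rw [e1]
    refine (sum_radius_sq_le (1.07 * p.a) (p.b * √p.s₀) (by positivity) (by positivity) p.n₂ (s - 1)
      h.one_le_n₂ (by omega)).trans ?_
    have t1 : (p.b * √p.s₀) ^ 2 / p.n₂ ≤ 4 / 7 * p.b ^ 2 := by
      rw [mul_pow, Real.sq_sqrt h0.le, div_le_iff₀ hn2pos]
      have := mul_le_mul_of_nonneg_left hn2le (sq_nonneg p.b)
      linarith
    have t2 : 4 * (1.07 * p.a) * (p.b * √p.s₀) / √p.n₂ ≤ 3.024 * 1.07 * p.a * p.b := by
      have e2 : √p.s₀ / √p.n₂ ≤ 0.756 := by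
        rw [← Real.sqrt_div h0.le]; exact h.sqrt_ratio_le _ hn2le
      have e3 : 4 * (1.07 * p.a) * (p.b * √p.s₀) / √p.n₂
          = 4 * (1.07 * p.a) * p.b * (√p.s₀ / √p.n₂) := by ring
      rw [e3]
      have := mul_le_mul_of_nonneg_left e2 (by positivity : 0 ≤ 4 * (1.07 * p.a) * p.b)
      linarith
    have t3 : Real.log (((s - 1 : ℕ) : ℝ) / p.n₂) ≤ 4 / 7 * t ^ 2 - 1 := by
      have hs1pos : (0 : ℝ) < ((s - 1 : ℕ) : ℝ) := by
        have := h.one_le_n₂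
        exact_mod_cast (by omega : 0 < s - 1)
      refine (Real.log_le_sub_one_of_pos (by positivity)).trans ?_
      have : ((s - 1 : ℕ) : ℝ) / p.n₂ ≤ s / (7 / 4 * p.s₀) := by
        have : ((s - 1 : ℕ) : ℝ) ≤ s := by exact_mod_cast Nat.sub_le _ _
        gcongr
      rw [ht2]
      have e4 : (s : ℝ) / (7 / 4 * p.s₀) = 4 / 7 * (s / p.s₀) := by field_simp
      linarith
    have t4 := mul_le_mul_of_nonneg_left t3 (sq_nonneg (1.07 * p.a))
    have e5 : (1.07 * p.a) ^ 2 * (4 / 7 * t ^ 2 - 1)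
        = 1.1449 * (4 / 7 * (p.a * t) ^ 2 - p.a ^ 2) := by ring
    linarith
  rw [div_le_iff₀ h0]
  refine (hQ').trans ?_
  have hS := h.s₀_ge_of_L₁ hL
  have h6 := h.n₂_lt
  set W := ∑ τ ∈ Finset.Ioc p.n₂ (s - 1), (p.b * √p.s₀ / τ + 1.07 * p.a / √τ) ^ 2
  have hW0 : 0 ≤ W := Finset.sum_nonneg fun _ _ => sq_nonneg _
  have h7 : 1.586 / 9 * p.s₀ * W ≤ 0.17623 * p.s₀ * W := by
    have : 0 ≤ p.s₀ * W := by positivity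
    linarith
  have h8 := mul_le_mul_of_nonneg_left hsum (by positivity : 0 ≤ 0.17623 * p.s₀)
  linarith

/-- After the first phase the threshold dominates the deviations allowed by the total variance,
provided the mass missed by the predictions obeys the error bound. -/
lemma variance_le_late (hL : 24 ≤ p.L₁) (s : ℕ) (hs0 : p.n₀ < s) (Q : ℝ) (hQ : Q ≤ s)
    (hQ' : p.n₂ < s → Q ≤ p.n₂ + 1 + 1.586 / 9 * p.s₀ * ∑ τ ∈ Finset.Ioc p.n₂ (s - 1),
      (p.b * √p.s₀ / τ + 1.07 * p.a / √τ) ^ 2) :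
    2 * p.L₁ * (1.004 * (p.σ : ℝ) ^ 2 * p.K * s + 1.0404 * p.g * Q) ≤ (s * p.γHat s) ^ 2 := by
  have hs1 : 1 ≤ s := by omega
  have hs' : (0 : ℝ) < s := by exact_mod_cast hs1
  have hK := h.one_le_K
  have hg := h.one_le_g
  have hLp := h.L₁_pos
  have hσ := h.σ_nonneg
  have hA := h.σ_le
  have ha := h.a_pos
  have he := h.e_pos
  have hb := h.b_pos
  have hΘ := h.Θ_pos
  have h0 := h.s₀_pos
  have hν := h.le_mul_ν s hs0
  have h3 := sqrt_three_bounds.1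
  set t := √(s / p.s₀) with ht
  have ht0 : 0 ≤ t := Real.sqrt_nonneg _
  have ht2 : t ^ 2 = s / p.s₀ := Real.sq_sqrt (by positivity)
  have hlow : p.Θ * (p.e + p.a * t + 3.464) ≤ s * p.γHat s := by
    rw [h.mul_γHat s hs1, ← ht]
    have := mul_le_mul_of_nonneg_right h3.le hΘ.le
    linarith
  have hsq : p.Θ ^ 2 * (p.e + p.a * t + 3.464) ^ 2 ≤ (s * p.γHat s) ^ 2 := by
    rw [← mul_pow]
    exact pow_le_pow_left₀ (by positivity) hlow 2
  refine le_trans ?_ hsq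
  have hnoise : 2 * p.L₁ * (1.004 * (p.σ : ℝ) ^ 2 * p.K * s)
      ≤ p.Θ ^ 2 * (0.695 * (p.a * t) ^ 2) := by
    have e1 : p.Θ ^ 2 * (p.a * t) ^ 2 = p.A ^ 2 * (p.K * p.L₁ * s) := by
      rw [← mul_pow, ← h.A_mul_sqrt s hs'.le, mul_pow, Real.sq_sqrt (by positivity)]
    have hA2 : 2.89 * (p.σ : ℝ) ^ 2 ≤ p.A ^ 2 := by
      have := pow_le_pow_left₀ (by positivity) hA 2
      linarith
    have y1 : 2.89 * (p.σ : ℝ) ^ 2 * (p.K * p.L₁ * s) ≤ p.A ^ 2 * (p.K * p.L₁ * s) :=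
      mul_le_mul_of_nonneg_right hA2 (by positivity)
    have y3 : 0 ≤ (p.σ : ℝ) ^ 2 * (p.K * p.L₁ * s) := by positivity
    have : p.Θ ^ 2 * (0.695 * (p.a * t) ^ 2) = 0.695 * (p.A ^ 2 * (p.K * p.L₁ * s)) := by
      rw [← e1]; ring
    rw [this]; linarith
  have hsamp : 2 * p.L₁ * (1.0404 * p.g * Q) = p.Θ ^ 2 * (2.0808 * (Q / p.s₀)) := by
    rw [h.Θ_sq]; field_simp; ring
  suffices hmain : 0.695 * (p.a * t) ^ 2 + 2.0808 * (Q / p.s₀) ≤ (p.e + p.a * t + 3.464) ^ 2 by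
    have := mul_le_mul_of_nonneg_left hmain (sq_nonneg p.Θ)
    linarith
  have hQt : Q / p.s₀ ≤ t ^ 2 := by rw [ht2]; exact div_le_div_of_nonneg_right hQ h0.le
  have hat : 0 ≤ p.a * t := by positivity
  have hbase : (p.a * t) ^ 2 + 11.999 ≤ (p.e + p.a * t + 3.464) ^ 2 := by
    have := mul_nonneg he.le hat
    linarith [sq_nonneg p.e]
  by_cases hcase : (s : ℝ) ≤ 2 * p.s₀
  · have : t ^ 2 ≤ 2 := by rw [ht2, div_le_iff₀ h0]; exact hcase
    linarith [sq_nonneg (p.a * t)]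
  rw [not_le] at hcase
  have ht2' : 2 ≤ t ^ 2 := by rw [ht2, le_div_iff₀ h0]; exact hcase.le
  by_cases ha7 : 7 ≤ p.a ^ 2
  · -- here the noise term alone covers the trivial bound `Q ≤ s`
    have : 7 * t ^ 2 ≤ (p.a * t) ^ 2 := by
      rw [mul_pow]; exact mul_le_mul_of_nonneg_right ha7 (sq_nonneg t)
    linarith [sq_nonneg (p.a * t)]
  rw [not_le] at ha7
  have hn2s : p.n₂ < s := by
    have : (p.n₂ : ℝ) < s := by linarith [h.n₂_lt, h.s₀_ge']
    exact_mod_cast this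
  have hQfin := h.missed_mass_le hL s hn2s Q (hQ' hn2s)
  rw [← ht] at hQfin
  have hpoly := recursion_poly p.a p.e p.b (p.a * t) ha.le he.le rfl ha7.le (by
    have : 1.4142 ≤ t := le_of_pow_le_pow_left₀ two_ne_zero ht0 (by norm_num; linarith)
    rw [mul_comm]
    exact mul_le_mul_of_nonneg_left this ha.le)
  linarith

/-- The error bound in normalized form. -/
lemma error_sq_le (hL : 24 ≤ p.L₁) (s : ℕ) (hs : p.n₂ < s) (D : ℝ) (hD : 0 ≤ D)
    (herr : p.δS ^ 2 * D
      ≤ p.k * (4 * p.γHat s + 4 * (2 * √6 / 3 * √(p.g * s * p.L₂) / s) * D)) :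
    D ^ 2 * (1 - √6 / 9 * √(p.s₀ / s)) ^ 2
      ≤ p.Y / 36 * (p.b * √p.s₀ / s + 1.07 * p.a / √s) ^ 2 := by
  have hδ := h.hδS
  have hm := h.m_ge
  have hg := h.one_le_g
  have hL2 := h.L₂_pos
  have h0 := h.s₀_pos
  have ha := h.a_pos
  have hb := h.b_pos
  have hs' : (0 : ℝ) < s := by exact_mod_cast (by omega : 0 < s)
  have hss : 0 < √(s : ℝ) := Real.sqrt_pos.2 hs'
  have hs2 : √(s : ℝ) ^ 2 = s := Real.sq_sqrt hs'.le
  have hX := h.sqrt_s₀_pos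
  have hX2 : √p.s₀ ^ 2 = p.s₀ := Real.sq_sqrt h0.le
  have h1 : D ≤ p.m * (4 * p.γHat s + 4 * (2 * √6 / 3 * √(p.g * s * p.L₂) / s) * D) := by
    have : p.m * (4 * p.γHat s + 4 * (2 * √6 / 3 * √(p.g * s * p.L₂) / s) * D)
        = p.k * (4 * p.γHat s + 4 * (2 * √6 / 3 * √(p.g * s * p.L₂) / s) * D) / p.δS ^ 2 := by
      unfold m; ring
    rw [this, le_div_iff₀ (by positivity)]; linarith
  have h2 : p.m * (4 * (2 * √6 / 3 * √(p.g * s * p.L₂) / s)) = √6 / 9 * √(p.s₀ / s) := by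
    rw [show p.g * s * p.L₂ = p.g * p.L₂ * s by ring, Real.sqrt_mul (by positivity),
      Real.sqrt_div h0.le, h.sqrt_s₀]
    have : (s : ℝ) = √s * √s := (Real.mul_self_sqrt hs'.le).symm
    rw [div_eq_mul_inv _ (s : ℝ), this]
    simp only [Real.mul_self_sqrt hs'.le]
    field_simp
    rw [hs2]; ring
  have h3 : D * (1 - √6 / 9 * √(p.s₀ / s)) ≤ 4 * p.m * p.γHat s := by
    rw [← h2]; linarith
  have h4 : 4 * p.m * p.γHat s ≤ 4 * p.m * (p.Θ * (p.b + 1.07 * p.a * √(s / p.s₀))) / s := by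
    rw [le_div_iff₀ hs']
    have := h.mul_γHat_le hL s (by have := h.n₀_add_one_le_n₂; omega)
    have := mul_le_mul_of_nonneg_left this (by positivity : 0 ≤ 4 * p.m)
    linarith
  have hz := h.sqrt_ratio_le s (by
    have : (p.n₂ : ℝ) < s := by exact_mod_cast hs
    linarith [h.le_n₂])
  have h6 := sqrt_six_le
  have hden : 0 ≤ 1 - √6 / 9 * √(p.s₀ / s) := by
    have : √6 / 9 * √(p.s₀ / s) ≤ 2.45 / 9 * 0.756 := by gcongr
    linarith
  have h5 := pow_le_pow_left₀ (mul_nonneg hD hden) (h3.trans h4) 2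
  rw [mul_pow] at h5
  refine h5.trans (le_of_eq ?_)
  rw [div_pow, mul_pow, mul_pow p.Θ, h.Θ_sq, Real.sqrt_div hs'.le]
  have e1 : p.Y = 576 * p.m ^ 2 * p.g * p.L₁ := rfl
  rw [e1]
  have e2 : p.b * √p.s₀ / s + 1.07 * p.a / √s = √p.s₀ * (p.b + 1.07 * p.a * (√s / √p.s₀)) / s := by
    field_simp
    linear_combination (-1.07 * p.a) * hs2
  rw [e2, div_pow, mul_pow √p.s₀, hX2]
  ring

/-- The error bound with the denominator replaced by its smallest value, attained at `s = n₂`. -/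
lemma error_sq_le' (hL : 24 ≤ p.L₁) (s : ℕ) (hs : p.n₂ < s) (D : ℝ) (hD : 0 ≤ D)
    (herr : p.δS ^ 2 * D
      ≤ p.k * (4 * p.γHat s + 4 * (2 * √6 / 3 * √(p.g * s * p.L₂) / s) * D)) :
    D ^ 2 ≤ 1.586 * (p.Y / 36 * (p.b * √p.s₀ / s + 1.07 * p.a / √s) ^ 2) := by
  have h1 := h.error_sq_le hL s hs D hD herr
  have hz := h.sqrt_ratio_le s (by
    have : (p.n₂ : ℝ) < s := by exact_mod_cast hs
    linarith [h.le_n₂])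
  have h6 : √6 < 2.4495 := by rw [Real.sqrt_lt' (by norm_num)]; norm_num
  -- `√(4 / 7) ≤ 0.756` and `0.79424 ^ 2 * 1.586 ≥ 1`
  have hden : 0.79424 ≤ 1 - √6 / 9 * √(p.s₀ / s) := by
    have : √6 / 9 * √(p.s₀ / s) ≤ 2.4495 / 9 * 0.756 := by gcongr
    linarith
  have h2 : 0.79424 ^ 2 ≤ (1 - √6 / 9 * √(p.s₀ / s)) ^ 2 := pow_le_pow_left₀ (by norm_num) hden 2
  have h3 := mul_le_mul_of_nonneg_left h2 (sq_nonneg D)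
  linarith [sq_nonneg D]

/-- A sharper version of the error bound for the terms that are summed over all rounds. -/
lemma error_sq_le_sum (hL : 24 ≤ p.L₁) (s : ℕ) (hs : p.n₂ < s) (D : ℝ) (hD : 0 ≤ D)
    (herr : p.δS ^ 2 * D
      ≤ p.k * (4 * p.γHat s + 4 * (2 * √6 / 3 * √(p.g * s * p.L₂) / s) * D)) :
    D ^ 2 ≤ p.Y / 36 * (1.586 * (p.b ^ 2 * p.s₀) * (1 / (s : ℝ) ^ 2)
      + (2 * 1.586 * (1.07 * p.a) * (p.b * √p.s₀) + 0.8 * (1.07 * p.a) ^ 2 * √p.s₀)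
        * (1 / ((s : ℝ) * √s)) + (1.07 * p.a) ^ 2 * (1 / (s : ℝ))) := by
  have h1 := h.error_sq_le hL s hs D hD herr
  have h0 := h.s₀_pos
  have ha := h.a_pos
  have hb := h.b_pos
  have hY := h.Y_pos
  have hs' : (0 : ℝ) < s := by exact_mod_cast (by omega : 0 < s)
  have hss : 0 < √(s : ℝ) := Real.sqrt_pos.2 hs'
  have hz := h.sqrt_ratio_le s (by
    have : (p.n₂ : ℝ) < s := by exact_mod_cast hs
    linarith [h.le_n₂])
  have h6 : √6 < 2.4495 := by rw [Real.sqrt_lt' (by norm_num)]; norm_num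
  have h60 : 0 ≤ √6 := Real.sqrt_nonneg _
  set z := √(p.s₀ / s) with hzdef
  have hz0 : 0 ≤ z := Real.sqrt_nonneg _
  set w := (1 - √6 / 9 * z) ^ 2 with hw
  have hc : √6 / 9 ≤ 0.27217 := by linarith
  have hden : 1 - 0.27217 * z ≤ 1 - √6 / 9 * z := by
    have := mul_le_mul_of_nonneg_right hc hz0
    linarith
  have hw1 : (1 - 0.27217 * z) ^ 2 ≤ w := pow_le_pow_left₀ (by nlinarith) hden 2
  have hw2 : 1 ≤ w * 1.586 := by nlinarith
  -- the factor `1 + 0.8 * z` tends to `1` as `s` grows, which matters for the sum of the `1 / s`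
  have hw3 : 1 ≤ w * (1 + 0.8 * z) := by
    have e : 1 ≤ (1 - 0.27217 * z) ^ 2 * (1 + 0.8 * z) := by
      have : 0 ≤ z * (0.25566 - 0.361396 * z + 0.05926 * z ^ 2) := by
        refine mul_nonneg hz0 ?_
        nlinarith [sq_nonneg (z - 0.756)]
      nlinarith [pow_nonneg hz0 3]
    exact e.trans (mul_le_mul_of_nonneg_right hw1 (by positivity))
  have hwpos : 0 < w := by nlinarith
  rw [radius_sq_eq _ _ _ hs'] at h1
  have hX2 : √p.s₀ ^ 2 = p.s₀ := Real.sq_sqrt h0.le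
  have hzs : z * (1 / (s : ℝ)) = √p.s₀ * (1 / ((s : ℝ) * √s)) := by
    rw [hzdef, Real.sqrt_div h0.le]; field_simp
  set P₁ := p.b ^ 2 * p.s₀ * (1 / (s : ℝ) ^ 2) with hP1
  set P₂ := (1.07 * p.a) * (p.b * √p.s₀) * (1 / ((s : ℝ) * √s)) with hP2
  set P₃ := (1.07 * p.a) ^ 2 * (1 / (s : ℝ)) with hP3
  have p1 : 0 ≤ P₁ := by positivity
  have p2 : 0 ≤ P₂ := by positivity
  have p3 : 0 ≤ P₃ := by positivity
  have e1 : (p.b * √p.s₀) ^ 2 * (1 / (s : ℝ) ^ 2) + 2 * (1.07 * p.a) * (p.b * √p.s₀)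
      * (1 / ((s : ℝ) * √s)) + (1.07 * p.a) ^ 2 * (1 / (s : ℝ)) = P₁ + 2 * P₂ + P₃ := by
    rw [mul_pow, hX2]; ring
  have e2 : 1.586 * (p.b ^ 2 * p.s₀) * (1 / (s : ℝ) ^ 2)
      + (2 * 1.586 * (1.07 * p.a) * (p.b * √p.s₀) + 0.8 * (1.07 * p.a) ^ 2 * √p.s₀)
        * (1 / ((s : ℝ) * √s)) + (1.07 * p.a) ^ 2 * (1 / (s : ℝ))
      = 1.586 * (P₁ + 2 * P₂) + (1 + 0.8 * z) * P₃ := by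
    have : z * P₃ = (1.07 * p.a) ^ 2 * (√p.s₀ * (1 / ((s : ℝ) * √s))) := by
      rw [hP3, ← hzs]; ring
    linear_combination (-0.8) * this
  rw [e1] at h1
  rw [e2]
  refine le_of_mul_le_mul_right (h1.trans ?_) hwpos
  have f1 : P₁ + 2 * P₂ ≤ w * 1.586 * (P₁ + 2 * P₂) := le_mul_of_one_le_left (by positivity) hw2
  have f2 : P₃ ≤ w * (1 + 0.8 * z) * P₃ := le_mul_of_one_le_left p3 hw3
  calc p.Y / 36 * (P₁ + 2 * P₂ + P₃)
      ≤ p.Y / 36 * (w * 1.586 * (P₁ + 2 * P₂) + w * (1 + 0.8 * z) * P₃) := by gcongr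
    _ = _ := by ring

/-- The leading part of the regret bound in normalized form. -/
lemma le_mainBound (T : ℕ) (hT : (p.s₁ + 1) ^ 2 < (T : ℝ)) :
    4 * p.s₀ + 1.2 * p.Y * (p.a + p.e + 2 * √3) ^ 2
      + 4 / 9 * p.Y * p.a ^ 2 * Real.log (T / (p.s₁ + 1)) ≤ p.mainBound T := by
  have hδ := h.hδS
  have hs1 := h.s₁_pos
  have hlog : 0 ≤ Real.log (T / (p.s₁ + 1)) := by
    apply Real.log_nonneg
    rw [le_div_iff₀ (by linarith)]
    nlinarith
  have hL2 := h.L₂_pos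
  have hg := h.one_le_g
  have hm := h.m_ge
  have hK := h.one_le_K
  have hR := h.one_le_R
  have hL1 := h.L₁_pos
  have hG := h.G_sq
  have ha := h.a_pos
  have he := h.e_pos
  unfold mainBound
  refine add_le_add (add_le_add ?_ ?_) ?_
  · apply le_of_eq; unfold s₀; ring
  · have h1 := pow_le_pow_left₀ (by have := h.G_pos; positivity) h.le_a₄ 2
    have e1 : 2.7 * p.a₄ ^ 2 * (p.k : ℝ) ^ 2 * p.g / (64 * p.δS ^ 4 * p.L₂)
        = 2.7 * p.m ^ 2 * p.g / (64 * p.L₂) * p.a₄ ^ 2 := by unfold m; field_simp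
    rw [e1]
    refine le_trans (le_of_eq ?_) (mul_le_mul_of_nonneg_left h1 (by positivity))
    rw [mul_pow, mul_pow, hG]
    unfold Y; field_simp; ring
  · have e1 : (p.k : ℝ) ^ 2 * (p.d' - 1) / (p.δS ^ 4 * ((p.k₀ : ℝ) - 1)) = p.m ^ 2 * p.K := by
      unfold m K
      have : (p.k₀ : ℝ) - 1 ≠ 0 := by linarith [h.k₀_ge]
      field_simp
    rw [e1]
    refine mul_le_mul_of_nonneg_right ?_ hlog
    have h2 : p.a₂ ^ 2 = 256 / 9 * p.A ^ 2 * p.L₁ := by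
      unfold a₂ A; rw [mul_pow, Real.sq_sqrt hL1.le]; ring
    have h3 : p.A ^ 2 = p.a ^ 2 * p.R := by
      rw [← h.a_mul_sqrt_R, mul_pow, Real.sq_sqrt (by linarith)]
    have h4 : p.a₂ ^ 2 ≤ p.μ₂ ^ 2 * p.a₅ ^ 2 := by
      rw [← mul_pow]
      refine pow_le_pow_left₀ h.a₂_pos.le ?_ 2
      have := h.one_le_μ₂
      have := h.a₂_le_a₅
      have := h.a₅_pos
      nlinarith
    calc 4 / 9 * p.Y * p.a ^ 2 = 9 * p.a₂ ^ 2 * (p.m ^ 2 * p.K) := by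
          rw [h2, h3]; unfold Y; rw [h.g_eq]; ring
      _ ≤ 9 * (p.μ₂ ^ 2 * p.a₅ ^ 2) * (p.m ^ 2 * p.K) := by gcongr
      _ = _ := by ring

omit h in
/-- The comparison of the summed squared errors with the leading part of the regret bound, both in units
of `Y`. -/
lemma mainBound_poly (a e b Λ : ℝ) (ha : 0 ≤ a) (he : 0 ≤ e) (hb : b = 5.65 + 0.63 * a + 1.95 * e)
    (hΛ : 1.3 ≤ Λ) :
    6.001 + 0.22658 * b ^ 2 + 1.2831 * a * b + 0.3463 * a ^ 2
      ≤ 1.2 * (a + e + 3.464) ^ 2 + a ^ 2 * Λ := by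
  subst hb
  have h1 : a ^ 2 * 1.3 ≤ a ^ 2 * Λ := mul_le_mul_of_nonneg_left hΛ (sq_nonneg a)
  refine le_trans ?_ (add_le_add_right h1 _)
  nlinarith [sq_nonneg (a - e), mul_nonneg ha he, sq_nonneg (a - 0.3), sq_nonneg (e - a)]

lemma n₂_lt_of_lt (T : ℕ) (hT : (p.s₁ + 1) ^ 2 < (T : ℝ)) : p.n₂ + 1 < T := by
  have h1 := h.n₂_lt
  have h2 := h.s₁_ge
  have h3 := h.L₁_ge
  have h4 := h.s₀_ge'
  have h5 : p.s₀ * (7 / 4) ≤ p.s₀ * p.L₁ := mul_le_mul_of_nonneg_left h3 (by linarith)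
  have : ((p.n₂ + 1 : ℕ) : ℝ) < T := by push_cast; nlinarith
  exact_mod_cast this

/-- The logarithm of `T / s₀` exceeds that of `T / (s₁ + 1)` by at most half of the latter, because
`T` is larger than `(s₁ + 1) ^ 2`. -/
lemma log_ratio_le (hL : 24 ≤ p.L₁) (T : ℕ) (hT : (p.s₁ + 1) ^ 2 < (T : ℝ)) :
    0.28623 * Real.log (T / p.s₀) + 1.3 ≤ 4 / 9 * Real.log (T / (p.s₁ + 1)) := by
  have h0 := h.s₀_pos
  have hs1 := h.s₁_pos
  have hT2 := h.n₂_lt_of_lt T hT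
  have hTpos : (0 : ℝ) < T := by exact_mod_cast (by omega : 0 < T)
  have hL1 := h.L₁_pos
  have hR := h.one_le_R
  obtain ⟨y, hy⟩ : ∃ y, y = p.R * p.L₁ := ⟨_, rfl⟩
  have hy0 : 24 ≤ y := by rw [hy]; nlinarith
  have hs1y : p.s₁ = p.s₀ * y := by rw [hy]; exact h.s₁_eq
  have hXy : 5184 * y ≤ p.s₀ := by
    have := h.Y_ge; have := h.Y_le; have := h.R_le_g
    rw [hy]; nlinarith
  have l1 : Real.log (T / p.s₀) = Real.log (T / (p.s₁ + 1)) + Real.log ((p.s₁ + 1) / p.s₀) := by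
    rw [← Real.log_mul (by positivity) (by positivity)]
    congr 1; field_simp
  have l2 : Real.log ((p.s₁ + 1) / p.s₀) ≤ Real.log y + 0.001 := by
    have : (p.s₁ + 1) / p.s₀ ≤ y * Real.exp 0.001 := by
      rw [div_le_iff₀ h0, hs1y]
      have := Real.add_one_le_exp (0.001 : ℝ)
      have h1 : y * p.s₀ * (0.001 + 1) ≤ y * p.s₀ * Real.exp 0.001 :=
        mul_le_mul_of_nonneg_left this (by positivity)
      have h2 : 24 * 129600 ≤ y * p.s₀ := by
        have := h.s₀_ge_of_L₁ hL
        gcongr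
      linarith
    have h3 := Real.log_le_log (by positivity) this
    rwa [Real.log_mul (by positivity) (Real.exp_pos _).ne', Real.log_exp] at h3
  have l3 : Real.log 5184 + 2 * Real.log y ≤ Real.log (T / (p.s₁ + 1)) := by
    have e1 : Real.log 5184 + 2 * Real.log y = Real.log (5184 * y ^ 2) := by
      rw [Real.log_mul (by norm_num) (by positivity), Real.log_pow]; norm_num
    rw [e1]
    refine Real.log_le_log (by positivity) ?_
    rw [le_div_iff₀ (by linarith)]
    have : 5184 * y ^ 2 ≤ p.s₁ + 1 := by
      rw [hs1y]; nlinarith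
    nlinarith
  have l4 : 8.5 ≤ Real.log 5184 := by
    rw [Real.le_log_iff_exp_le (by norm_num)]
    have h2 : Real.exp 8.5 ^ 2 ≤ 5184 ^ 2 := by
      rw [← Real.exp_nat_mul]
      have e7 : Real.exp (((2 : ℕ) : ℝ) * 8.5) = Real.exp 1 ^ 17 := by
        rw [← Real.exp_nat_mul]; norm_num
      rw [e7]
      calc Real.exp 1 ^ 17 ≤ 2.7182818286 ^ 17 :=
            pow_le_pow_left₀ (Real.exp_pos _).le Real.exp_one_lt_d9.le _
        _ ≤ 5184 ^ 2 := by norm_num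
    exact le_of_pow_le_pow_left₀ (by norm_num) (by norm_num) h2
  have l5 : 0 ≤ Real.log y := Real.log_nonneg (by linarith)
  rw [l1]; linarith

/-- The sum of the squared errors of the predictions is below the leading part of the regret
bound. -/
lemma sum_error_le_mainBound (hL : 24 ≤ p.L₁) (T : ℕ) (hT : (p.s₁ + 1) ^ 2 < (T : ℝ)) :
    4 * ((p.n₂ : ℝ) + 1) + ∑ s ∈ Finset.Ioc p.n₂ (T - 1),
      9 * (p.Y / 36 * (1.586 * (p.b ^ 2 * p.s₀) * (1 / (s : ℝ) ^ 2)
      + (2 * 1.586 * (1.07 * p.a) * (p.b * √p.s₀) + 0.8 * (1.07 * p.a) ^ 2 * √p.s₀)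
        * (1 / ((s : ℝ) * √s)) + (1.07 * p.a) ^ 2 * (1 / (s : ℝ)))) ≤ p.mainBound T := by
  refine le_trans ?_ (h.le_mainBound T hT)
  have h0 := h.s₀_pos
  have ha := h.a_pos
  have he := h.e_pos
  have hb := h.b_pos
  have hY := h.Y_pos
  have hX := h.sqrt_s₀_pos
  have hn2le := h.le_n₂
  have hn2pos : (0 : ℝ) < p.n₂ := by exact_mod_cast h.one_le_n₂
  have hT2 := h.n₂_lt_of_lt T hT
  have hs1 := h.s₁_pos
  have hX2 : √p.s₀ ^ 2 = p.s₀ := Real.sq_sqrt h0.le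
  rw [← Finset.mul_sum, ← Finset.mul_sum, Finset.sum_add_distrib, Finset.sum_add_distrib,
    ← Finset.mul_sum, ← Finset.mul_sum, ← Finset.mul_sum]
  have S1 : ∑ s ∈ Finset.Ioc p.n₂ (T - 1), 1 / (s : ℝ) ^ 2 ≤ 4 / 7 / p.s₀ := by
    refine (sum_one_div_sq_le _ _ h.one_le_n₂).trans ?_
    rw [div_div, div_le_div_iff₀ hn2pos (by positivity)]; linarith
  have S2 : ∑ s ∈ Finset.Ioc p.n₂ (T - 1), 1 / ((s : ℝ) * √s) ≤ 1.512 / √p.s₀ := by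
    refine (sum_one_div_mul_sqrt_le _ _ h.one_le_n₂).trans ?_
    have e2 : √p.s₀ / √p.n₂ ≤ 0.756 := by
      rw [← Real.sqrt_div h0.le]; exact h.sqrt_ratio_le _ hn2le
    rw [le_div_iff₀ hX, div_mul_eq_mul_div, mul_div_assoc]; linarith
  have S3 : ∑ s ∈ Finset.Ioc p.n₂ (T - 1), 1 / (s : ℝ) ≤ Real.log (T / p.s₀) := by
    refine (sum_one_div_le_log _ _ h.one_le_n₂ (by omega)).trans ?_
    have hTpos : (0 : ℝ) < ((T - 1 : ℕ) : ℝ) := by exact_mod_cast (by omega : 0 < T - 1)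
    refine Real.log_le_log (by positivity) ?_
    have : ((T - 1 : ℕ) : ℝ) ≤ T := by exact_mod_cast Nat.sub_le _ _
    have : p.s₀ ≤ p.n₂ := by linarith
    gcongr
  have hlog := h.log_ratio_le hL T hT
  have hmain := mainBound_poly p.a p.e p.b
    (4 / 9 * Real.log (T / (p.s₁ + 1)) - 0.28623 * Real.log (T / p.s₀)) ha.le he.le rfl
    (by linarith)
  have h3 := sqrt_three_bounds.1
  have hsq3 : (p.a + p.e + 3.464) ^ 2 ≤ (p.a + p.e + 2 * √3) ^ 2 :=
    pow_le_pow_left₀ (by positivity) (by linarith) 2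
  have hmain' := mul_le_mul_of_nonneg_left
    (hmain.trans (add_le_add_left (mul_le_mul_of_nonneg_left hsq3 (by norm_num)) _)) hY.le
  have B1 : 1.586 * (p.b ^ 2 * p.s₀) * ∑ s ∈ Finset.Ioc p.n₂ (T - 1), 1 / (s : ℝ) ^ 2
      ≤ 1.586 * 4 / 7 * p.b ^ 2 := by
    calc _ ≤ 1.586 * (p.b ^ 2 * p.s₀) * (4 / 7 / p.s₀) := by gcongr
      _ = _ := by field_simp
  have B2 : (2 * 1.586 * (1.07 * p.a) * (p.b * √p.s₀) + 0.8 * (1.07 * p.a) ^ 2 * √p.s₀)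
        * ∑ s ∈ Finset.Ioc p.n₂ (T - 1), 1 / ((s : ℝ) * √s)
      ≤ 1.512 * (2 * 1.586 * (1.07 * p.a) * p.b + 0.8 * (1.07 * p.a) ^ 2) := by
    calc _ ≤ (2 * 1.586 * (1.07 * p.a) * (p.b * √p.s₀) + 0.8 * (1.07 * p.a) ^ 2 * √p.s₀)
          * (1.512 / √p.s₀) := by gcongr
      _ = _ := by field_simp
  have B3 := mul_le_mul_of_nonneg_left S3 (sq_nonneg (1.07 * p.a))
  have hsum := mul_le_mul_of_nonneg_left (add_le_add (add_le_add B1 B2) B3)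
    (by positivity : 0 ≤ p.Y / 36)
  have hn2 := h.n₂_lt
  have hs0Y := h.s₀_le
  have hSbig := h.s₀_ge_of_L₁ hL
  have hp : 0 ≤ p.Y * (p.b * p.b) := by positivity
  have hp2 : 0 ≤ p.Y * (p.a * p.b) := by positivity
  have hp3 : 0 ≤ p.Y * (p.a * p.a) := by positivity
  have hTn : (p.n₂ : ℝ) + 1 < T := by exact_mod_cast hT2
  have hp4 : 0 ≤ p.Y * (p.a ^ 2 * Real.log (T / p.s₀)) := by
    have : 0 ≤ Real.log (T / p.s₀) := by
      apply Real.log_nonneg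
      rw [le_div_iff₀ h0]; linarith
    positivity
  have hs0Y' : 4 * ((p.n₂ : ℝ) + 1) ≤ 4 * p.s₀ + 6.001 * p.Y := by linarith
  linarith

end Admissible

end Params

end POSLR

namespace POSLR

/-! ### The size of the regret bound -/

namespace Params.Admissible

variable {p : Params} (h : p.Admissible)
include h

lemma g_le : p.g ≤ 4.5 * (p.d' ^ 2 / (p.k₀ : ℝ) ^ 2) := by
  have h1 := h.k₀_ge
  have h2 := h.k₀_le
  have hK : p.K ≤ 1.5 * (p.d' / p.k₀) := by
    unfold K
    rw [← mul_div_assoc, div_le_div_iff₀ (by linarith) (by linarith)]; nlinarith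
  have hR : p.R ≤ 3 * (p.d' / p.k₀) := by
    unfold R
    rw [← mul_div_assoc, div_le_div_iff₀ (by linarith) (by linarith)]; nlinarith
  have hK1 := h.one_le_K
  have hR1 := h.one_le_R
  have h3 : 0 ≤ p.d' / p.k₀ := div_nonneg (by linarith) (by linarith)
  rw [h.g_eq]
  calc p.K * p.R ≤ 1.5 * (p.d' / p.k₀) * (3 * (p.d' / p.k₀)) :=
        mul_le_mul hK hR (by linarith) (by positivity)
    _ = _ := by rw [← div_pow]; ring

lemma K_le : p.K ≤ 1.5 * (p.d' / p.k₀) := by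
  have h1 := h.k₀_ge
  have h2 := h.k₀_le
  unfold K
  rw [← mul_div_assoc, div_le_div_iff₀ (by linarith) (by linarith)]; nlinarith

lemma σ_le_κσ : 1.2 * (p.σ : ℝ) ≤ p.κ * (p.σ : ℝ) :=
  mul_le_mul_of_nonneg_right h.hκ h.σ_nonneg

lemma a_le : p.a ≤ 6.9 * (1 + p.κ * (p.σ : ℝ)) := by
  have hσ := h.σ_nonneg
  have hκ := h.σ_le_κσ
  have hR : 1 ≤ √p.R := Real.one_le_sqrt.2 h.one_le_R
  have : p.a ≤ p.A := div_le_self (by linarith [h.A_ge]) hR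
  refine this.trans ?_
  unfold A; linarith

lemma a₄_le : p.a₄ ≤ p.G * (1339 * (1 + p.κ * (p.σ : ℝ))) := by
  have hσ := h.σ_nonneg
  have hκ := h.σ_le_κσ
  have hG := h.G_pos
  have hm := h.m_ge
  have hL := h.L₁_pos
  have he : p.e ≤ 0.038 * (1 + p.κ * (p.σ : ℝ)) := by
    unfold e
    rw [div_le_iff₀ (by positivity)]
    have h1 : p.α ≤ 8 / 3 * (1 + p.κ * (p.σ : ℝ)) := by unfold α; linarith
    have h2 : 3 * p.L₁ ≤ p.m * p.G := mul_le_mul hm h.L₁_le_G hL.le (by linarith)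
    calc p.α * p.L₁ ≤ 8 / 3 * (1 + p.κ * (p.σ : ℝ)) * p.L₁ := by gcongr
      _ = 8 / 9 * (1 + p.κ * (p.σ : ℝ)) * (3 * p.L₁) := by ring
      _ ≤ 8 / 9 * (1 + p.κ * (p.σ : ℝ)) * (p.m * p.G) := by gcongr; linarith
      _ ≤ 0.038 * (1 + p.κ * (p.σ : ℝ)) * (24 * p.m * p.G) := by
        have : 0 ≤ (1 + p.κ * (p.σ : ℝ)) * (p.m * p.G) :=
          mul_nonneg (by linarith) (by positivity)
        linarith
  have hs : 1 / √p.s₀ ≤ 0.01 := by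
    rw [div_le_iff₀ h.sqrt_s₀_pos]
    have : (100 : ℝ) ≤ √p.s₀ := Real.le_sqrt_of_sq_le (by linarith [h.s₀_ge'])
    linarith
  have h3 : √3 * (1 + 1 / √p.s₀) ≤ 1.7321 * 1.01 := by
    have h4 : √3 ≤ 1.7321 := by rw [Real.sqrt_le_left (by norm_num)]; norm_num
    have := h.sqrt_s₀_pos
    gcongr; linarith
  have ha := h.a_le
  rw [h.a₄_eq]
  calc p.a₁ / p.m + p.G * (128 * p.a + 256 * √3 * (1 + 1 / √p.s₀))
      ≤ p.G * (192 * p.e) + p.G * (128 * p.a + 256 * √3 * (1 + 1 / √p.s₀)) := by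
        gcongr; exact h.a₁_div_m_le
    _ = p.G * (192 * p.e + 128 * p.a + 256 * (√3 * (1 + 1 / √p.s₀))) := by ring
    _ ≤ _ := by gcongr; linarith

lemma a₅_le_sqrt : p.a₅ ≤ 73 * (1 + p.κ * (p.σ : ℝ)) * √p.L₁ := by
  have hσ := h.σ_nonneg
  have hκ := h.σ_le_κσ
  have hm := h.m_ge
  have hg := h.one_le_g
  have hδ := h.hδS
  have hk := h.k_ge
  have h3 : √3 < 1.7321 := by rw [Real.sqrt_lt' (by norm_num)]; norm_num
  have h3' : 1.732 < √3 := by rw [Real.lt_sqrt (by norm_num)]; norm_num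
  have hL : 1.32 ≤ √p.L₁ := Real.le_sqrt_of_sq_le (by norm_num; linarith [h.L₁_ge])
  have hgL : 1.87 ≤ √(p.g * p.L₂) := Real.le_sqrt_of_sq_le (by nlinarith [h.L₂_ge])
  have hden : 5.5358 ≤ 9 - 2 * √3 := by linarith
  have t1 : p.δS ^ 2 * ((2 + (p.σ : ℝ)) / (9 * p.k)) ≤ 2 / 27 * (1 + p.κ * (p.σ : ℝ)) := by
    have e : p.δS ^ 2 * ((2 + (p.σ : ℝ)) / (9 * p.k)) = (2 + (p.σ : ℝ)) / (9 * p.m) := by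
      unfold m; field_simp
    rw [e, div_le_iff₀ (by positivity)]
    have : (1 + p.κ * (p.σ : ℝ)) * 3 ≤ (1 + p.κ * (p.σ : ℝ)) * p.m :=
      mul_le_mul_of_nonneg_left hm (by linarith)
    linarith
  have t2 : 8 / √3 ≤ 4.62 := by rw [div_le_iff₀ (by linarith)]; linarith
  have t3 : (√3 / 9 * p.δS ^ 2) / (p.k * √(p.g * p.L₂)) ≤ 0.0344 := by
    have e : (√3 / 9 * p.δS ^ 2) / (p.k * √(p.g * p.L₂)) = √3 / 9 / (p.m * √(p.g * p.L₂)) := by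
      unfold m; field_simp
    rw [e, div_le_iff₀ (by positivity)]
    have : 3 * 1.87 ≤ p.m * √(p.g * p.L₂) := mul_le_mul hm hgL (by norm_num) (by linarith)
    linarith
  have t4 : p.a₂ ≤ 36.8 * (1 + p.κ * (p.σ : ℝ)) * √p.L₁ := by
    unfold a₂
    refine mul_le_mul_of_nonneg_right ?_ (Real.sqrt_nonneg _)
    linarith
  have t5 : 2 * √3 * p.a₂ / (9 - 2 * √3) * √(((p.k₀ : ℝ) - 2) / ((p.d' - 2) * p.L₂))
      ≤ 0.335 * p.a₂ := by
    rw [h.sqrt_R_L₂]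
    have h1 := h.sqrt_RL₂_ge
    have h2 := h.a₂_pos
    rw [div_mul_div_comm, div_le_iff₀ (by positivity)]
    have : 5.5358 * 1.87 ≤ (9 - 2 * √3) * √(p.R * p.L₂) :=
      mul_le_mul hden h1 (by norm_num) (by linarith)
    have := mul_le_mul_of_nonneg_left this h2.le
    have := mul_le_mul_of_nonneg_left h3.le h2.le
    linarith
  have t6 : 36 / (9 - 2 * √3) ≤ 6.51 := by rw [div_le_iff₀ (by linarith)]; linarith
  have hc : 0 ≤ p.κ * (p.σ : ℝ) := by linarith
  unfold a₅
  have t7 : 36 / (9 - 2 * √3) * (p.δS ^ 2 * ((2 + (p.σ : ℝ)) / (9 * p.k)) + 8 / √3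
        + (√3 / 9 * p.δS ^ 2) / (p.k * √(p.g * p.L₂)))
      ≤ 6.51 * (4.73 * (1 + p.κ * (p.σ : ℝ))) := by
    refine mul_le_mul t6 (by linarith) (by positivity) (by norm_num)
  have t8 : (1 + p.κ * (p.σ : ℝ)) * 1.32 ≤ (1 + p.κ * (p.σ : ℝ)) * √p.L₁ :=
    mul_le_mul_of_nonneg_left hL (by linarith)
  linarith

lemma le_mainBound_of_s₀ (T : ℕ) (hT : (p.s₁ + 1) ^ 2 < (T : ℝ)) :
    4 * p.s₀ ≤ p.mainBound T := by
  have hlog0 : 0 ≤ Real.log (T / (p.s₁ + 1)) := by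
    have := h.s₁_pos
    apply Real.log_nonneg
    rw [le_div_iff₀ (by linarith)]; nlinarith
  have hY := h.Y_pos
  have h1 : 0 ≤ 1.2 * p.Y * (p.a + p.e + 2 * √3) ^ 2
      + 4 / 9 * p.Y * p.a ^ 2 * Real.log (T / (p.s₁ + 1)) := by positivity
  linarith [h.le_mainBound T hT]

lemma mainBound_pos (T : ℕ) (hT : (p.s₁ + 1) ^ 2 < (T : ℝ)) : 0 < p.mainBound T :=
  lt_of_lt_of_le (mul_pos (by norm_num) h.s₀_pos) (h.le_mainBound_of_s₀ T hT)

/-- The leading part of the regret bound without its dependence on the noise coefficient. -/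
lemma mainBound_le (T : ℕ) (hT : (p.s₁ + 1) ^ 2 < (T : ℝ)) :
    p.mainBound T ≤ (1 + p.κ * (p.σ : ℝ)) ^ 2 * (80500 * (p.m ^ 2 * p.g * p.L₁)
      + 75000 * (p.m ^ 2 * p.K * (Real.log (T / (p.s₁ + 1)) * p.L₁))) := by
  have hδ := h.hδS
  have hσ := h.σ_nonneg
  have hκ := h.σ_le_κσ
  have hm := h.m_ge
  have hg := h.one_le_g
  have hK := h.one_le_K
  have hL1 := h.L₁_pos
  have hL2 := h.L₂_pos
  have hs1 := h.s₁_pos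
  have hk0 := h.k₀_ge
  set c := 1 + p.κ * (p.σ : ℝ) with hc
  have hc1 : 1 ≤ c := by linarith
  have hc2 : 1 ≤ c ^ 2 := one_le_pow₀ hc1
  have hlog0 : 0 ≤ Real.log (T / (p.s₁ + 1)) := by
    apply Real.log_nonneg
    rw [le_div_iff₀ (by linarith)]; nlinarith
  have hX : 0 ≤ p.m ^ 2 * p.g * p.L₁ := by positivity
  have hX' : 0 ≤ c ^ 2 * (p.m ^ 2 * p.g * p.L₁) := by positivity
  have hZ : 0 ≤ c ^ 2 * (p.m ^ 2 * p.K * (Real.log (T / (p.s₁ + 1)) * p.L₁)) := by positivity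
  have M1 : 48 ^ 2 * (p.k : ℝ) ^ 2 * p.g / p.δS ^ 4 * p.L₂
      ≤ 4608 * (c ^ 2 * (p.m ^ 2 * p.g * p.L₁)) := by
    have e : 48 ^ 2 * (p.k : ℝ) ^ 2 * p.g / p.δS ^ 4 * p.L₂ = 2304 * (p.m ^ 2 * p.g * p.L₂) := by
      unfold m; field_simp; ring
    rw [e]
    have h1 : p.m ^ 2 * p.g * p.L₂ ≤ p.m ^ 2 * p.g * (2 * p.L₁) := by gcongr; exact h.L₂_le
    have h2 : p.m ^ 2 * p.g * p.L₁ ≤ c ^ 2 * (p.m ^ 2 * p.g * p.L₁) := le_mul_of_one_le_left hX hc2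
    linarith
  have M2 : 2.7 * p.a₄ ^ 2 * (p.k : ℝ) ^ 2 * p.g / (64 * p.δS ^ 4 * p.L₂)
      ≤ 2.7 / 64 * 1339 ^ 2 * (c ^ 2 * (p.m ^ 2 * p.g * p.L₁)) := by
    have h1 := pow_le_pow_left₀ h.a₄_pos.le h.a₄_le 2
    have e : 2.7 * p.a₄ ^ 2 * (p.k : ℝ) ^ 2 * p.g / (64 * p.δS ^ 4 * p.L₂)
        = 2.7 / 64 * (p.m ^ 2 * p.g / p.L₂) * p.a₄ ^ 2 := by unfold m; field_simp
    rw [e]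
    calc 2.7 / 64 * (p.m ^ 2 * p.g / p.L₂) * p.a₄ ^ 2
        ≤ 2.7 / 64 * (p.m ^ 2 * p.g / p.L₂) * (p.G * (1339 * c)) ^ 2 :=
          mul_le_mul_of_nonneg_left h1 (by positivity)
      _ = _ := by rw [mul_pow, h.G_sq]; field_simp
  have M3 : 9 * p.μ₂ ^ 2 * p.a₅ ^ 2 * ((p.k : ℝ) ^ 2 * (p.d' - 1) / (p.δS ^ 4 * ((p.k₀ : ℝ) - 1)))
      * Real.log (T / (p.s₁ + 1))
      ≤ 9 * 1.25 ^ 2 * 73 ^ 2 * (c ^ 2 * (p.m ^ 2 * p.K * (Real.log (T / (p.s₁ + 1)) * p.L₁))) := by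
    have h1 := pow_le_pow_left₀ h.a₅_pos.le h.a₅_le_sqrt 2
    have h2 : p.μ₂ ^ 2 ≤ 1.25 ^ 2 := pow_le_pow_left₀ (by linarith [h.one_le_μ₂]) h.μ₂_le 2
    have e : (p.k : ℝ) ^ 2 * (p.d' - 1) / (p.δS ^ 4 * ((p.k₀ : ℝ) - 1)) = p.m ^ 2 * p.K := by
      unfold m K
      have : (p.k₀ : ℝ) - 1 ≠ 0 := by linarith
      field_simp
    rw [e]
    calc 9 * p.μ₂ ^ 2 * p.a₅ ^ 2 * (p.m ^ 2 * p.K) * Real.log (T / (p.s₁ + 1))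
        ≤ 9 * 1.25 ^ 2 * (73 * c * √p.L₁) ^ 2 * (p.m ^ 2 * p.K) * Real.log (T / (p.s₁ + 1)) := by
          gcongr
      _ = _ := by rw [mul_pow _ √p.L₁, Real.sq_sqrt hL1.le]; ring
  unfold mainBound
  linarith

/-- The regret bound is at most a constant times the bracket of the asymptotic bound. -/
lemma regretBound_le (T : ℕ) (hT : (p.s₁ + 1) ^ 2 < (T : ℝ)) :
    p.regretBound T ≤ 10 ^ 7 * (1 + p.κ * (p.σ : ℝ)) ^ 2 *
        ((p.k : ℝ) ^ 2 * p.d' ^ 2 / (p.δS ^ 4 * (p.k₀ : ℝ) ^ 2) * Real.log (p.d / p.δ)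
          + (p.k : ℝ) ^ 2 * p.d' / (p.δS ^ 4 * (p.k₀ : ℝ)) * Real.log T
            * Real.log (p.d * T / p.δ)) := by
  have hδ := h.hδS
  have hσ := h.σ_nonneg
  have hκ := h.σ_le_κσ
  have hm := h.m_ge
  have hg := h.one_le_g
  have hK := h.one_le_K
  have hL1 := h.L₁_pos
  have hL2 := h.L₂_pos
  have hs1 := h.s₁_pos
  have hk0 := h.k₀_ge
  have hdk := h.k₀_le
  have hT1 : 1 < (T : ℝ) := by nlinarith
  set c := 1 + p.κ * (p.σ : ℝ) with hc
  have hc1 : 1 ≤ c := by linarith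
  have hc2 : 1 ≤ c ^ 2 := one_le_pow₀ hc1
  have hlogT : 0 ≤ Real.log T := Real.log_nonneg hT1.le
  have hlog0 : 0 ≤ Real.log (T / (p.s₁ + 1)) := by
    apply Real.log_nonneg
    rw [le_div_iff₀ (by linarith)]; nlinarith
  have hlog : Real.log (T / (p.s₁ + 1)) ≤ Real.log T :=
    Real.log_le_log (by positivity) (div_le_self (by linarith) (by linarith))
  have hlogd : p.L₁ ≤ Real.log (p.d * T / p.δ) := by
    have := h.d_ge
    have := h.hδ₀
    refine Real.log_le_log (by positivity) ?_
    gcongr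
    exact le_mul_of_one_le_right (by linarith) hT1.le
  set X₁ := p.m ^ 2 * (p.d' ^ 2 / (p.k₀ : ℝ) ^ 2) * p.L₁ with hX1
  set X₂ := p.m ^ 2 * (p.d' / p.k₀) * Real.log T * Real.log (p.d * T / p.δ) with hX2
  have hd : 1 ≤ p.d' / p.k₀ := by rw [le_div_iff₀ (by linarith)]; linarith
  have hX20 : 0 ≤ X₂ := by have := hL1.le.trans hlogd; positivity
  have hX1L : p.L₁ ≤ X₁ := by
    rw [hX1, ← div_pow]
    refine le_mul_of_one_le_left hL1.le ?_
    exact one_le_mul_of_one_le_of_one_le (one_le_pow₀ (by linarith)) (one_le_pow₀ hd)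
  have eB : (p.k : ℝ) ^ 2 * p.d' ^ 2 / (p.δS ^ 4 * (p.k₀ : ℝ) ^ 2) * Real.log (p.d / p.δ)
          + (p.k : ℝ) ^ 2 * p.d' / (p.δS ^ 4 * (p.k₀ : ℝ)) * Real.log T
            * Real.log (p.d * T / p.δ) = X₁ + X₂ := by
    rw [hX1, hX2]; unfold m L₁; field_simp
  rw [eB]
  have hgX : p.m ^ 2 * p.g * p.L₁ ≤ 4.5 * X₁ := by
    calc p.m ^ 2 * p.g * p.L₁ ≤ p.m ^ 2 * (4.5 * (p.d' ^ 2 / (p.k₀ : ℝ) ^ 2)) * p.L₁ := by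
          gcongr; exact h.g_le
      _ = _ := by ring
  have hKX : p.m ^ 2 * p.K * (Real.log (T / (p.s₁ + 1)) * p.L₁) ≤ 1.5 * X₂ := by
    calc p.m ^ 2 * p.K * (Real.log (T / (p.s₁ + 1)) * p.L₁)
        ≤ p.m ^ 2 * (1.5 * (p.d' / p.k₀)) * (Real.log T * Real.log (p.d * T / p.δ)) := by
          gcongr; exact h.K_le
      _ = _ := by ring
  have hX10 : 0 ≤ X₁ := hL1.le.trans hX1L
  have hM : p.mainBound T ≤ 4 * 10 ^ 5 * (c ^ 2 * (X₁ + X₂)) := by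
    refine (h.mainBound_le T hT).trans ?_
    rw [← hc]
    have y : 0 ≤ X₁ + X₂ := by positivity
    calc c ^ 2 * (80500 * (p.m ^ 2 * p.g * p.L₁)
          + 75000 * (p.m ^ 2 * p.K * (Real.log (T / (p.s₁ + 1)) * p.L₁)))
        ≤ c ^ 2 * (4 * 10 ^ 5 * (X₁ + X₂)) := by
          refine mul_le_mul_of_nonneg_left ?_ (sq_nonneg c)
          linarith
      _ = _ := by ring
  have hM0 := (h.mainBound_pos T hT).le
  have hlδ : Real.log (1 / p.δ) ≤ p.L₁ := by
    have := h.d_ge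
    have := h.hδ₀
    refine Real.log_le_log (by positivity) ?_
    gcongr; linarith
  have hlδ0 : 0 ≤ Real.log (1 / p.δ) := by
    rw [one_div, Real.log_inv]; linarith [h.log_δ_neg]
  have hN : 2 * (p.σ : ℝ) * √(2 * p.mainBound T * Real.log (1 / p.δ))
      ≤ p.mainBound T + 2 * (p.σ : ℝ) ^ 2 * Real.log (1 / p.δ) := by
    have e1 : √(2 * p.mainBound T * Real.log (1 / p.δ))
        = √(p.mainBound T) * √(2 * Real.log (1 / p.δ)) := by
      rw [← Real.sqrt_mul hM0]; ring_nf
    have e2 := Real.sq_sqrt hM0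
    have e3 := Real.sq_sqrt (by linarith : 0 ≤ 2 * Real.log (1 / p.δ))
    rw [e1]
    nlinarith [sq_nonneg (√(p.mainBound T) - p.σ * √(2 * Real.log (1 / p.δ)))]
  have hσc : (p.σ : ℝ) ^ 2 * Real.log (1 / p.δ) ≤ c ^ 2 * X₁ := by
    have : (p.σ : ℝ) ≤ c := by linarith
    gcongr; exact hlδ.trans hX1L
  have y2 : 0 ≤ c ^ 2 * X₂ := by positivity
  have y1 : 0 ≤ c ^ 2 * X₁ := by positivity
  unfold regretBound
  linarith

/-- If the confidence level is below the reciprocal of the number of rounds, the logarithmic factors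
are not small. -/
lemma L₁_ge_of_mul_lt (T : ℕ) (hT : (p.s₁ + 1) ^ 2 < (T : ℝ)) (hδT : 6 * (T : ℝ) * p.δ < 1) :
    24 ≤ p.L₁ := by
  have hδ := h.hδ₀
  have hs1 : 31752 ≤ p.s₁ := by
    have := h.s₁_ge
    have : 18144 * (7 / 4) ≤ p.s₀ * p.L₁ :=
      mul_le_mul h.s₀_ge' h.L₁_ge (by norm_num) h.s₀_pos.le
    linarith
  have hT1 : 31752 ^ 2 < (T : ℝ) :=
    lt_of_le_of_lt (pow_le_pow_left₀ (by norm_num) (by linarith) 2) hT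
  unfold L₁
  rw [Real.le_log_iff_exp_le (by have := h.d_ge; positivity), le_div_iff₀ hδ]
  have e : Real.exp 24 = Real.exp 1 ^ 24 := by rw [← Real.exp_nat_mul]; norm_num
  have h24 : Real.exp 24 ≤ 3 * 10 ^ 10 := by
    rw [e]
    calc Real.exp 1 ^ 24 ≤ 2.7182818286 ^ 24 :=
          pow_le_pow_left₀ (Real.exp_pos _).le Real.exp_one_lt_d9.le _
      _ ≤ 3 * 10 ^ 10 := by norm_num
  have := mul_le_mul_of_nonneg_right h24 hδ.le
  have := mul_le_mul_of_nonneg_right hT1.le hδ.le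
  linarith [h.d_ge]

end Params.Admissible

end POSLR

namespace POSLR

/-! ### Deviations along a run -/

section Measurability

variable {d : ℕ}

lemma measurable_firstDraw (A : Finset (Fin d)) (i : Fin d) :
    Measurable fun w => firstDraw A w i := by
  unfold firstDraw
  have h : Measurable fun w : Fin d → ℝ => ∑ j ∈ A, |w j| := by fun_prop
  refine Measurable.ite (h (measurableSet_singleton 0)) measurable_const ?_
  exact (measurable_pi_apply i).abs.div h

lemma measurable_sampleProb (A : Finset (Fin d)) (n : ℕ) (C : Finset (Fin d)) :
    Measurable fun w => sampleProb A n w C :=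
  Finset.measurable_fun_sum _ fun i _ => (measurable_firstDraw A i).mul_const _

lemma measurable_obsProb (S : Finset (Fin d)) (n : ℕ) (i j : Fin d) :
    Measurable fun w => obsProb S n w i j := by
  refine Finset.measurable_fun_sum _ fun C _ => ?_
  split_ifs
  · exact measurable_sampleProb _ _ _
  · exact measurable_const

lemma measurable_xHat (S : Finset (Fin d)) (n : ℕ) (C : Finset (Fin d)) (x : Fin d → ℝ)
    (i : Fin d) : Measurable fun w => xHat S n w C x i := by
  unfold xHat
  split_ifs
  · exact measurable_const.div (measurable_obsProb _ _ _ _)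
  · exact measurable_const

lemma measurable_hHat (S : Finset (Fin d)) (n : ℕ) (C : Finset (Fin d)) (x : Fin d → ℝ)
    (i j : Fin d) : Measurable fun w => hHat S n w C x i j := by
  simp only [hHat, Matrix.of_apply]
  split_ifs
  · exact measurable_const.div (measurable_obsProb _ _ _ _)
  · exact measurable_const

lemma measurable_rowErr (S : Finset (Fin d)) (n : ℕ) (C : Finset (Fin d)) (x : Fin d → ℝ)
    (i j : Fin d) : Measurable fun w => rowErr S n w C x i j :=
  ((measurable_xHat S n C x i).mul_const _).sub (measurable_hHat S n C x i j)

/-- A function of a random finite set is measurable if it is so for each value of the set. -/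
lemma measurable_apply_finset {Ω : Type*} {m : MeasurableSpace Ω} {A : Ω → Finset (Fin d)}
    (hA : ∀ C, MeasurableSet {ω | A ω = C}) {f : Finset (Fin d) → Ω → ℝ}
    (hf : ∀ C, Measurable (f C)) : Measurable fun ω => f (A ω) ω := by
  have : (fun ω => f (A ω) ω) = fun ω => ∑ C, if A ω = C then f C ω else 0 := by
    funext ω; simp
  rw [this]
  exact Finset.measurable_fun_sum _ fun C _ => Measurable.ite (hA C) (hf C) measurable_const

end Measurability

namespace Run

variable {Ω : Type*} [mΩ : MeasurableSpace Ω] {P : Measure Ω} {p : Params} {T : ℕ}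
  {x : ℕ → Fin p.d → ℝ} {wstar : Fin p.d → ℝ} (R : Run P p T x wstar)

lemma card_S (s : ℕ) (hs : s ≤ T) (ω : Ω) : (R.S s ω).card = p.k := by
  rcases Nat.eq_zero_or_pos s with rfl | h
  · exact R.S_zero ω
  · exact (R.S_top s (Finset.mem_Icc.2 ⟨h, hs⟩) ω).1

lemma sampleBounds (h : p.Admissible) (s : ℕ) (hs : s ≤ T) (ω : Ω) :
    SampleBounds (R.S s ω) p.k₀ (R.what s ω) p.K p.g := by
  have hd := h.hd
  have hk := h.hk₀
  have hc : (R.S s ω)ᶜ.card = p.d - p.k := by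
    rw [Finset.card_compl, Fintype.card_fin, R.card_S s hs]
  have hc' : (((R.S s ω)ᶜ.card : ℕ) : ℝ) = p.d' := by
    rw [hc, Nat.cast_sub (by omega)]; rfl
  refine ⟨sum_sampleProb _ _ _ (by omega) (by omega), fun i => ?_, fun i j => ?_, h.one_le_K,
    h.K_le_g⟩
  · have := le_obsProb_diag (R.S s ω) p.k₀ (R.what s ω) (by omega) (by omega) (by omega) i
    rwa [hc', ← one_div_div] at this
  · have := le_obsProb (R.S s ω) p.k₀ (R.what s ω) (by omega) (by omega) (by omega) i j
    rwa [hc', ← one_div_div] at this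

/-- The estimate of attribute `i` in round `τ` if `C` is the sampled set. -/
noncomputable def xEst (τ : ℕ) (i : Fin p.d) (C : Finset (Fin p.d)) (ω : Ω) : ℝ :=
  xHat (R.S (τ - 1) ω) p.k₀ (R.what (τ - 1) ω) C (x τ) i

/-- The estimate of the entry `(i, j)` of the Gram matrix of round `τ` if `C` is the sampled set. -/
noncomputable def hEst (τ : ℕ) (i j : Fin p.d) (C : Finset (Fin p.d)) (ω : Ω) : ℝ :=
  hHat (R.S (τ - 1) ω) p.k₀ (R.what (τ - 1) ω) C (x τ) i j

/-- The part of the error of row `i` in round `τ` that is caused by the sampling, if `C` is the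
sampled set. -/
noncomputable def rowEst (τ : ℕ) (i : Fin p.d) (C : Finset (Fin p.d)) (ω : Ω) : ℝ :=
  ∑ j, rowErr (R.S (τ - 1) ω) p.k₀ (R.what (τ - 1) ω) C (x τ) i j * wstar j

/-- The mass of the target that the prediction of round `τ` misses. -/
noncomputable def missed (τ : ℕ) (ω : Ω) : ℝ := l1 (restr wstar (R.S (τ - 1) ω)ᶜ)

/-- The error of the prediction of round `τ`, up to noise. -/
noncomputable def predErr (τ : ℕ) (ω : Ω) : ℝ :=
  (restr (R.what (τ - 1) ω) (R.S (τ - 1) ω) - wstar) ⬝ᵥ x τ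

/-- The contribution of round `τ` to the error of row `i` of the constraint at the target. -/
noncomputable def rowDev (τ : ℕ) (i : Fin p.d) (ω : Ω) : ℝ :=
  R.xEst τ i (R.B' τ ω) ω * R.η τ ω + R.rowEst τ i (R.B' τ ω) ω

section

variable {R} {τ : ℕ} (hτ : τ ≤ T)
include hτ

lemma measurable_comp {F : Finset (Fin p.d) → (Fin p.d → ℝ) → ℝ} (hF : ∀ C, Measurable (F C)) :
    Measurable[R.ℱ τ] fun ω => F (R.S τ ω) (R.what τ ω) :=
  measurable_apply_finset (m := R.ℱ τ) (R.S_meas τ hτ) fun C => (hF C).comp (R.what_meas τ hτ)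

end

lemma measurable_xEst (τ : ℕ) (hτ : τ ∈ Finset.Icc 1 T) (i : Fin p.d) (C : Finset (Fin p.d)) :
    Measurable[R.ℱ (τ - 1)] (R.xEst τ i C) :=
  measurable_comp (R := R) (by rw [Finset.mem_Icc] at hτ; omega)
    (F := fun A w => xHat A p.k₀ w C (x τ) i) fun A => measurable_xHat _ _ _ _ _

lemma measurable_hEst (τ : ℕ) (hτ : τ ∈ Finset.Icc 1 T) (i j : Fin p.d) (C : Finset (Fin p.d)) :
    Measurable[R.ℱ (τ - 1)] (R.hEst τ i j C) :=
  measurable_comp (R := R) (by rw [Finset.mem_Icc] at hτ; omega)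
    (F := fun A w => hHat A p.k₀ w C (x τ) i j) fun A => measurable_hHat _ _ _ _ _ _

lemma measurable_rowEst (τ : ℕ) (hτ : τ ∈ Finset.Icc 1 T) (i : Fin p.d) (C : Finset (Fin p.d)) :
    Measurable[R.ℱ (τ - 1)] (R.rowEst τ i C) :=
  measurable_comp (R := R) (by rw [Finset.mem_Icc] at hτ; omega)
    (F := fun A w => ∑ j, rowErr A p.k₀ w C (x τ) i j * wstar j)
    fun A => Finset.measurable_fun_sum _ fun j _ => (measurable_rowErr _ _ _ _ _ _).mul_const _

lemma measurable_missed (τ : ℕ) (hτ : τ ∈ Finset.Icc 1 T) :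
    Measurable[R.ℱ (τ - 1)] (R.missed τ) :=
  measurable_comp (R := R) (by rw [Finset.mem_Icc] at hτ; omega)
    (F := fun A _ => l1 (restr wstar Aᶜ)) fun A => measurable_const

lemma measurable_predErr (τ : ℕ) (hτ : τ ∈ Finset.Icc 1 T) :
    Measurable[R.ℱ (τ - 1)] (R.predErr τ) := by
  refine measurable_comp (R := R) (by rw [Finset.mem_Icc] at hτ; omega)
    (F := fun A w => (restr w A - wstar) ⬝ᵥ x τ) fun A => ?_
  unfold dotProduct
  refine Finset.measurable_fun_sum _ fun i _ => Measurable.mul_const ?_ _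
  simp only [Pi.sub_apply, restr]
  split_ifs
  · exact (measurable_pi_apply i).sub_const _
  · exact measurable_const

lemma missed_le (hw : l1 wstar ≤ 1) (τ : ℕ) (ω : Ω) : R.missed τ ω ≤ 1 :=
  (l1_restr_le _ _).trans hw

variable [IsProbabilityMeasure P]

/-- Markov's inequality for the exponential supermartingale with increments
`α (B' τ) * η τ + β (B' τ)`. -/
lemma measure_le_sum (s : ℕ) (hs : s ≤ T) (α β : ℕ → Finset (Fin p.d) → Ω → ℝ)
    (hα : ∀ τ ∈ Finset.Icc 1 s, ∀ C, Measurable[R.ℱ (τ - 1)] (α τ C))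
    (hβ : ∀ τ ∈ Finset.Icc 1 s, ∀ C, Measurable[R.ℱ (τ - 1)] (β τ C))
    (hle : ∀ τ ∈ Finset.Icc 1 s, ∀ ω,
      ∑ C, sampleProb (R.S (τ - 1) ω)ᶜ p.k₀ (R.what (τ - 1) ω) C *
        Real.exp (α τ C ω ^ 2 * (p.σ : ℝ) ^ 2 / 2 + β τ C ω) ≤ 1) (L : ℝ) :
    P {ω | L ≤ ∑ τ ∈ Finset.Icc 1 s, (α τ (R.B' τ ω) ω * R.η τ ω + β τ (R.B' τ ω) ω)}
      ≤ ENNReal.ofReal (Real.exp (-L)) := by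
  have hmem : ∀ τ ∈ Finset.Icc 1 s, τ ∈ Finset.Icc 1 T := fun τ hτ => by
    rw [Finset.mem_Icc] at hτ ⊢; omega
  refine measure_le_sum_le R.ℱ _ s (fun τ hτ => ?_) (fun τ hτ G hG => ?_) L
  · have hB := R.B'_meas τ (hmem τ hτ)
    have hmono : R.ℱ (τ - 1) ≤ R.ℱ τ := R.ℱ.mono (Nat.sub_le _ _)
    have h1 := measurable_apply_finset (m := R.ℱ τ) hB fun C => (hα τ hτ C).mono hmono le_rfl
    have h2 := measurable_apply_finset (m := R.ℱ τ) hB fun C => (hβ τ hτ C).mono hmono le_rfl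
    exact (h1.mul (R.η_meas τ (hmem τ hτ))).add h2
  · have hτ' := hmem τ hτ
    have hm := R.ℱ.le (τ - 1)
    have hτT : τ - 1 ≤ T := by rw [Finset.mem_Icc] at hτ'; omega
    refine lintegral_mul_exp_step_le hm ((R.η_meas τ hτ').mono (R.ℱ.le τ) le_rfl) (R.η_law τ hτ')
      (R.η_indep τ hτ') (fun C => R.ℱ.le τ _ (R.B'_meas τ hτ' C))
      (π := fun C ω => sampleProb (R.S (τ - 1) ω)ᶜ p.k₀ (R.what (τ - 1) ω) C)
      (fun C => measurable_comp (R := R) hτT (F := fun A w => sampleProb Aᶜ p.k₀ w C)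
        fun A => measurable_sampleProb _ _ _)
      (fun C ω => sampleProb_nonneg _ _ _ _) (fun C => R.B'_law τ hτ' C) (hα τ hτ) (hβ τ hτ)
      (fun ω => ?_) hG
    have := hle τ hτ ω
    push_cast
    exact this

/-- The deviation of a row of the constraint at the target, for a variance proxy with constants
`c₁` and `c₂`. -/
lemma measure_row_le (h : p.Admissible) (hw : l1 wstar ≤ 1)
    (hx : ∀ s ∈ Finset.Icc 1 T, ∀ i, |x s i| ≤ 1) (s : ℕ) (hs : s ≤ T) (i : Fin p.d)
    (lam c β η c₁ c₂ : ℝ)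
    (hc : (|lam| * p.σ * p.K) ^ 2 / 2 + |lam| * p.g ≤ c) (hc1 : c ≤ 1)
    (hβ : 1 / 2 + 2 / 9 * c ≤ β) (hβ' : 1 / 2 ≤ β) (hη : 0 < η)
    (hc₁ : 1 + β * (1 + 1 / η) * ((|lam| * p.σ * p.K) ^ 2 / 2) ≤ c₁)
    (hc₂ : 2 * β * (1 + η) ≤ c₂) (L : ℝ) :
    P {ω | L + lam ^ 2 / 2 * (c₁ * (p.σ : ℝ) ^ 2 * p.K * s
        + c₂ * p.g * ∑ τ ∈ Finset.Icc 1 s, R.missed τ ω ^ 2)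
          ≤ lam * ∑ τ ∈ Finset.Icc 1 s, R.rowDev τ i ω}
      ≤ ENNReal.ofReal (Real.exp (-L)) := by
  have hmem : ∀ τ ∈ Finset.Icc 1 s, τ ∈ Finset.Icc 1 T := fun τ hτ => by
    rw [Finset.mem_Icc] at hτ ⊢; omega
  have key := R.measure_le_sum s hs (fun τ C ω => lam * R.xEst τ i C ω)
    (fun τ C ω => lam * R.rowEst τ i C ω
      - lam ^ 2 / 2 * (c₁ * (p.σ : ℝ) ^ 2 * p.K + c₂ * p.g * R.missed τ ω ^ 2))
    (fun τ hτ C => (R.measurable_xEst τ (hmem τ hτ) i C).const_mul _)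
    (fun τ hτ C => ((R.measurable_rowEst τ (hmem τ hτ) i C).const_mul _).sub
      ((((R.measurable_missed τ (hmem τ hτ)).pow_const 2).const_mul _).const_add _ |>.const_mul _))
    (fun τ hτ ω => ?_) L
  · refine le_trans (measure_mono fun ω hω => ?_) key
    simp only [Set.mem_ofPred_eq] at hω ⊢
    have e : ∑ τ ∈ Finset.Icc 1 s, (lam * R.xEst τ i (R.B' τ ω) ω * R.η τ ω
        + (lam * R.rowEst τ i (R.B' τ ω) ω
          - lam ^ 2 / 2 * (c₁ * (p.σ : ℝ) ^ 2 * p.K + c₂ * p.g * R.missed τ ω ^ 2)))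
        = lam * ∑ τ ∈ Finset.Icc 1 s, R.rowDev τ i ω
          - lam ^ 2 / 2 * (c₁ * (p.σ : ℝ) ^ 2 * p.K * s
            + c₂ * p.g * ∑ τ ∈ Finset.Icc 1 s, R.missed τ ω ^ 2) := by
      have hcard : c₁ * (p.σ : ℝ) ^ 2 * p.K * s
          = ∑ τ ∈ Finset.Icc 1 s, c₁ * (p.σ : ℝ) ^ 2 * p.K := by
        rw [Finset.sum_const, Nat.card_Icc]; simp; ring
      rw [hcard, Finset.mul_sum, Finset.mul_sum, ← Finset.sum_add_distrib, Finset.mul_sum,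
        ← Finset.sum_sub_distrib]
      exact Finset.sum_congr rfl fun τ _ => by unfold rowDev; ring
    rw [e]; linarith
  · have hτ' := hmem τ hτ
    have hB := R.sampleBounds h (τ - 1) (by rw [Finset.mem_Icc] at hτ'; omega) ω
    have := hB.sum_exp_row_le (x τ) wstar (hx τ hτ') i lam p.σ c β η c₁ c₂ (R.missed_le hw τ ω)
      hc hc1 hβ hβ' hη hc₁ hc₂
    simp only [add_sub_assoc', Real.exp_sub]
    simp_rw [← mul_div_assoc]
    rw [← Finset.sum_div, div_le_one (Real.exp_pos _)]
    exact this

/-- The deviation of an entry of the estimated Gram matrix. -/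
lemma measure_gram_le (h : p.Admissible)
    (hx : ∀ s ∈ Finset.Icc 1 T, ∀ i, |x s i| ≤ 1) (s : ℕ) (hs : s ≤ T) (i j : Fin p.d)
    (lam : ℝ) (hlam : |lam| * p.g ≤ 3 / 4) (L : ℝ) :
    P {ω | L + 2 / 3 * lam ^ 2 * p.g * s
          ≤ lam * ∑ τ ∈ Finset.Icc 1 s, (R.hEst τ i j (R.B' τ ω) ω - x τ i * x τ j)}
      ≤ ENNReal.ofReal (Real.exp (-L)) := by
  have hmem : ∀ τ ∈ Finset.Icc 1 s, τ ∈ Finset.Icc 1 T := fun τ hτ => by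
    rw [Finset.mem_Icc] at hτ ⊢; omega
  have key := R.measure_le_sum s hs (fun τ C ω => 0)
    (fun τ C ω => lam * (R.hEst τ i j C ω - x τ i * x τ j) - 2 / 3 * lam ^ 2 * p.g)
    (fun τ hτ C => measurable_const)
    (fun τ hτ C => (((R.measurable_hEst τ (hmem τ hτ) i j C).sub_const _).const_mul _).sub_const _)
    (fun τ hτ ω => ?_) L
  · refine le_trans (measure_mono fun ω hω => ?_) key
    simp only [Set.mem_ofPred_eq] at hω ⊢
    have e : ∑ τ ∈ Finset.Icc 1 s, (0 * R.η τ ω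
        + (lam * (R.hEst τ i j (R.B' τ ω) ω - x τ i * x τ j) - 2 / 3 * lam ^ 2 * p.g))
        = lam * ∑ τ ∈ Finset.Icc 1 s, (R.hEst τ i j (R.B' τ ω) ω - x τ i * x τ j)
          - 2 / 3 * lam ^ 2 * p.g * s := by
      simp only [zero_mul, zero_add]
      rw [Finset.sum_sub_distrib, Finset.mul_sum, Finset.sum_const, Nat.card_Icc]; simp; ring
    rw [e]; linarith
  · have hτ' := hmem τ hτ
    have hB := R.sampleBounds h (τ - 1) (by rw [Finset.mem_Icc] at hτ'; omega) ω
    have := hB.sum_exp_hHat_le (x τ) (hx τ hτ') i j lam hlam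
    simp only [add_sub_assoc', Real.exp_sub]
    simp_rw [← mul_div_assoc]
    rw [← Finset.sum_div, div_le_one (Real.exp_pos _)]
    refine le_trans (le_of_eq (Finset.sum_congr rfl fun C _ => ?_)) this
    simp [hEst]

/-- The deviation of the sum of the products of noise and prediction error. -/
lemma measure_noise_le (h : p.Admissible) (lam L : ℝ) :
    P {ω | L + lam ^ 2 / 2 * (p.σ : ℝ) ^ 2 * ∑ τ ∈ Finset.Icc 1 T, R.predErr τ ω ^ 2
          ≤ lam * ∑ τ ∈ Finset.Icc 1 T, R.predErr τ ω * R.η τ ω}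
      ≤ ENNReal.ofReal (Real.exp (-L)) := by
  have key := R.measure_le_sum T le_rfl (fun τ _ ω => lam * R.predErr τ ω)
    (fun τ _ ω => - ((lam * R.predErr τ ω) ^ 2 * (p.σ : ℝ) ^ 2 / 2))
    (fun τ hτ C => (R.measurable_predErr τ hτ).const_mul _)
    (fun τ hτ C => (((((R.measurable_predErr τ hτ).const_mul _).pow_const 2).mul_const _).div_const
      _).neg)
    (fun τ hτ ω => ?_) L
  · refine le_trans (measure_mono fun ω hω => ?_) key
    simp only [Set.mem_ofPred_eq] at hω ⊢
    have e : ∑ τ ∈ Finset.Icc 1 T, (lam * R.predErr τ ω * R.η τ ω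
        + - ((lam * R.predErr τ ω) ^ 2 * (p.σ : ℝ) ^ 2 / 2))
        = lam * ∑ τ ∈ Finset.Icc 1 T, R.predErr τ ω * R.η τ ω
          - lam ^ 2 / 2 * (p.σ : ℝ) ^ 2 * ∑ τ ∈ Finset.Icc 1 T, R.predErr τ ω ^ 2 := by
      rw [Finset.mul_sum, Finset.mul_sum, ← Finset.sum_sub_distrib]
      exact Finset.sum_congr rfl fun τ _ => by ring
    rw [e]; linarith
  · have hB := R.sampleBounds h (τ - 1) (by rw [Finset.mem_Icc] at hτ; omega) ω
    simp [hB.sum_one]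

end Run

end POSLR

namespace POSLR

/-! ### The exceptional events -/

namespace Params

variable (p : Params)

/-- The total variance proxy of a row of the constraint after `s` rounds, if the squared missed
masses add up to `Q`. The second pair of constants is valid because after the first phase the
exponents of the exponential moments are small. -/
noncomputable def varProxy (s : ℕ) (Q : ℝ) : ℝ :=
  if s ≤ p.n₀ then 13 / 9 * (p.σ : ℝ) ^ 2 * p.K * s + 16 / 3 * p.g * Q
  else 1.004 * (p.σ : ℝ) ^ 2 * p.K * s + 1.0404 * p.g * Q

/-- The deviation allowed for the entries of the estimated Gram matrix. -/
noncomputable def gramDev (s : ℕ) : ℝ := 2 * √6 / 3 * √(p.g * s * p.L₂)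

namespace Admissible

variable {p} (h : p.Admissible)
include h

lemma exp_neg_L₁ : Real.exp (-p.L₁) = p.δ / p.d := by
  have := h.d_ge
  have := h.hδ₀
  unfold L₁
  rw [← Real.log_inv, Real.exp_log (by positivity), inv_div]

lemma exp_neg_L₂ : Real.exp (-p.L₂) = p.δ / (p.d : ℝ) ^ 2 := by
  have := h.d_ge
  have := h.hδ₀
  unfold L₂
  rw [← Real.log_inv, Real.exp_log (by positivity), inv_div]

lemma ν_nonneg (s : ℕ) (hs : 1 ≤ s) : 0 ≤ s * p.ν s := by
  have hg := h.one_le_g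
  have hL := h.L₁_pos
  by_cases hs0 : s ≤ p.n₀
  · rw [h.mul_ν_of_le s hs0]; positivity
  · have := h.le_mul_ν s (not_le.1 hs0)
    have := h.Θ_pos
    exact le_trans (by positivity) (h.le_mul_ν s (not_le.1 hs0))

lemma le_mul_γHat (s : ℕ) (hs : 1 ≤ s) : p.α * p.g * p.L₁ ≤ s * p.γHat s := by
  have h1 := h.ν_nonneg s hs
  have h2 := h.Θ_pos
  have h3 := h.a_pos
  rw [h.mul_γHat s hs, h.e_mul_Θ]
  have : 0 ≤ p.Θ * (p.a * √(s / p.s₀)) := by positivity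
  linarith

lemma mul_γHat_pos (s : ℕ) (hs : 1 ≤ s) : 0 < s * p.γHat s := by
  have := h.α_ge
  have := h.one_le_g
  have := h.L₁_pos
  exact lt_of_lt_of_le (by positivity) (h.le_mul_γHat s hs)

/-- The exponent of the exponential moment in units that make it at most `3/4` in all rounds. -/
lemma lam_le_early (s : ℕ) (hs : 1 ≤ s) :
    (2 * p.L₁ / (s * p.γHat s) * p.σ * p.K) ^ 2 / 2 + 2 * p.L₁ / (s * p.γHat s) * p.g ≤ 3 / 4 ∧
      2 * p.L₁ / (s * p.γHat s) * p.σ * p.K ≤ 1 := by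
  have hL := h.L₁_pos
  have hg := h.one_le_g
  have hσ := h.σ_nonneg
  have hα := h.α_ge
  have hK := h.one_le_K
  have hpos := h.mul_γHat_pos s hs
  set lam := 2 * p.L₁ / (s * p.γHat s) with hlam
  have hlam0 : 0 ≤ lam := by positivity
  have h1 : lam * p.g ≤ 2 / p.α := by
    rw [hlam, div_mul_eq_mul_div, div_le_div_iff₀ hpos (by linarith)]
    have := h.le_mul_γHat s hs
    linarith
  have h2 : lam * p.σ * p.K ≤ p.σ * (2 / p.α) := by
    calc lam * p.σ * p.K ≤ lam * p.σ * p.g := by gcongr; exact h.K_le_g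
      _ = p.σ * (lam * p.g) := by ring
      _ ≤ _ := by gcongr
  have h3 : (p.σ : ℝ) * (2 / p.α) = 1 - 4 / 3 * (2 / p.α) := by
    have : (p.σ : ℝ) = p.α / 2 - 4 / 3 := by unfold α; ring
    rw [this]; field_simp
  have ht0 : 0 ≤ 2 / p.α := by positivity
  set t := 2 / p.α with ht
  have hu0 : 0 ≤ (p.σ : ℝ) * t := by positivity
  have h4 : 0 ≤ lam * p.σ * p.K := by positivity
  have h5 : (lam * p.σ * p.K) ^ 2 ≤ (p.σ * t) ^ 2 := pow_le_pow_left₀ h4 h2 2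
  constructor
  · nlinarith
  · linarith

/-- After the first phase the exponents are small. -/
lemma lam_le_late (s : ℕ) (hs : p.n₀ < s) :
    2 * p.L₁ / (s * p.γHat s) * p.g ≤ 0.01 ∧
      2 * p.L₁ / (s * p.γHat s) * p.σ * p.K ≤ 1 / 61 := by
  have hs1 : 1 ≤ s := by omega
  have hL := h.L₁_pos
  have hg := h.one_le_g
  have hσ := h.σ_nonneg
  have hK := h.one_le_K
  have hm := h.m_ge
  have hG := h.G_pos
  have hΘ := h.Θ_pos
  have ha := h.a_pos
  have he := h.e_pos
  have hs' : (0 : ℝ) < s := by exact_mod_cast hs1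
  have hss : p.s₀ ≤ s := h.s₀_le_n₀.trans (by exact_mod_cast hs.le)
  have hpos := h.mul_γHat_pos s hs1
  have hν := h.le_mul_ν s hs
  have h3 : 1.7 ≤ √3 := Real.le_sqrt_of_sq_le (by norm_num)
  have e := h.mul_γHat s hs1
  have x1 : 0 ≤ p.e * p.Θ := by positivity
  have x2 : 0 ≤ p.Θ * (p.a * √(s / p.s₀)) := by positivity
  have x3 : 2 * 1.7 * p.Θ ≤ 2 * √3 * p.Θ := by gcongr
  constructor
  · rw [div_mul_eq_mul_div, div_le_iff₀ hpos]
    have h4 : 24 * 3 * p.g * p.L₁ ≤ p.Θ := by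
      unfold Θ
      exact mul_le_mul (by gcongr) h.L₁_le_G hL.le (by positivity)
    have : 0 < p.g * p.L₁ := by positivity
    linarith
  · rw [div_mul_eq_mul_div, div_mul_eq_mul_div, div_le_iff₀ hpos]
    have h5 : 72 * (p.K * p.L₁) ≤ √(p.K * p.L₁ * s) := by
      refine Real.le_sqrt_of_sq_le ?_
      have h6 : 5184 * (p.K * p.L₁) ≤ s := by
        refine le_trans ?_ ((h.s₀_ge).trans hss)
        have := h.K_le_g
        have := h.L₁_le_L₂
        gcongr
      calc (72 * (p.K * p.L₁)) ^ 2 = p.K * p.L₁ * (5184 * (p.K * p.L₁)) := by ring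
        _ ≤ p.K * p.L₁ * s := by gcongr
    have h7 : 1.7 * (p.σ : ℝ) * (72 * (p.K * p.L₁)) ≤ p.A * √(p.K * p.L₁ * s) :=
      mul_le_mul h.σ_le h5 (by positivity) (by linarith [h.A_ge])
    rw [h.A_mul_sqrt s hs'.le] at h7
    have : 0 ≤ (p.σ : ℝ) * (p.K * p.L₁) := by positivity
    linarith

end Admissible

end Params

namespace Run

variable {Ω : Type*} [mΩ : MeasurableSpace Ω] {P : Measure Ω} {p : Params} {T : ℕ}
  {x : ℕ → Fin p.d → ℝ} {wstar : Fin p.d → ℝ} (R : Run P p T x wstar) [IsProbabilityMeasure P]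

/-- A one-sided deviation of a row, for either sign `ε`. -/
lemma measure_row_signed_le (h : p.Admissible) (hw : l1 wstar ≤ 1)
    (hx : ∀ s ∈ Finset.Icc 1 T, ∀ i, |x s i| ≤ 1) (s : ℕ) (hs : s ∈ Finset.Icc 1 T) (i : Fin p.d)
    (ε : ℝ) (hε : |ε| = 1) :
    P {ω | 2 * p.L₁ * p.varProxy s (∑ τ ∈ Finset.Icc 1 s, R.missed τ ω ^ 2) ≤ (s * p.γHat s) ^ 2 ∧
        s * p.γHat s < ε * ∑ τ ∈ Finset.Icc 1 s, R.rowDev τ i ω}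
      ≤ ENNReal.ofReal (p.δ / p.d) := by
  rw [Finset.mem_Icc] at hs
  have hpos := h.mul_γHat_pos s hs.1
  have hL := h.L₁_pos
  have hσ := h.σ_nonneg
  have hK := h.one_le_K
  set lam := 2 * p.L₁ / (s * p.γHat s) with hlam
  have hlam0 : 0 < lam := by positivity
  have habs : |ε * lam| = lam := by rw [abs_mul, hε, one_mul, abs_of_pos hlam0]
  have hε2 : ε ^ 2 = 1 := by rw [← sq_abs, hε, one_pow]
  have hmul : lam * (s * p.γHat s) = 2 * p.L₁ := div_mul_cancel₀ _ hpos.ne'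
  rw [← h.exp_neg_L₁]
  have hsub : ∀ c₁ c₂ : ℝ, (∀ Q, p.varProxy s Q = c₁ * (p.σ : ℝ) ^ 2 * p.K * s + c₂ * p.g * Q) →
      {ω | 2 * p.L₁ * p.varProxy s (∑ τ ∈ Finset.Icc 1 s, R.missed τ ω ^ 2) ≤ (s * p.γHat s) ^ 2 ∧
        s * p.γHat s < ε * ∑ τ ∈ Finset.Icc 1 s, R.rowDev τ i ω} ⊆
      {ω | p.L₁ + (ε * lam) ^ 2 / 2 * (c₁ * (p.σ : ℝ) ^ 2 * p.K * s
        + c₂ * p.g * ∑ τ ∈ Finset.Icc 1 s, R.missed τ ω ^ 2)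
          ≤ ε * lam * ∑ τ ∈ Finset.Icc 1 s, R.rowDev τ i ω} := by
    intro c₁ c₂ hc ω hω
    simp only [Set.mem_ofPred_eq] at hω ⊢
    obtain ⟨h1, h2⟩ := hω
    rw [← hc]
    set V := p.varProxy s (∑ τ ∈ Finset.Icc 1 s, R.missed τ ω ^ 2)
    have h3 : lam ^ 2 * (2 * p.L₁ * V) ≤ (2 * p.L₁) ^ 2 := by
      rw [← hmul, mul_pow]; rw [← hmul] at h1
      exact mul_le_mul_of_nonneg_left h1 (sq_nonneg _)
    have h4 : lam ^ 2 / 2 * V ≤ p.L₁ := by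
      refine le_of_mul_le_mul_right ?_ (by linarith : 0 < 4 * p.L₁)
      linarith
    have h5 := mul_lt_mul_of_pos_left h2 hlam0
    rw [hmul] at h5
    rw [mul_pow, hε2, one_mul]
    linarith
  by_cases hs0 : s ≤ p.n₀
  · obtain ⟨l1, l2⟩ := h.lam_le_early s hs.1
    rw [← hlam] at l1 l2
    refine (measure_mono (hsub (13 / 9) (16 / 3) fun Q => by
      simp only [Params.varProxy, if_pos hs0])).trans
      (R.measure_row_le h hw hx s hs.2 i (ε * lam) (3 / 4) (2 / 3) 3 _ _ ?_ (by norm_num)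
        (by norm_num) (by norm_num) (by norm_num) ?_ (by norm_num) _)
    · rw [habs]; exact l1
    · rw [habs]
      have : (lam * p.σ * p.K) ^ 2 ≤ 1 := pow_le_one₀ (by positivity) l2
      linarith
  · obtain ⟨l1, l2⟩ := h.lam_le_late s (not_le.1 hs0)
    rw [← hlam] at l1 l2
    have l3 : (lam * p.σ * p.K) ^ 2 ≤ (1 / 61) ^ 2 := pow_le_pow_left₀ (by positivity) l2 2
    refine (measure_mono (hsub 1.004 1.0404 fun Q => by
      simp only [Params.varProxy, if_neg hs0])).trans
      (R.measure_row_le h hw hx s hs.2 i (ε * lam) 0.02 0.51 0.02 _ _ ?_ (by norm_num)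
        (by norm_num) (by norm_num) (by norm_num) ?_ (by norm_num) _)
    · rw [habs]; linarith
    · rw [habs]; linarith

lemma measure_row_abs_le (h : p.Admissible) (hw : l1 wstar ≤ 1)
    (hx : ∀ s ∈ Finset.Icc 1 T, ∀ i, |x s i| ≤ 1) (s : ℕ) (hs : s ∈ Finset.Icc 1 T) (i : Fin p.d) :
    P {ω | 2 * p.L₁ * p.varProxy s (∑ τ ∈ Finset.Icc 1 s, R.missed τ ω ^ 2) ≤ (s * p.γHat s) ^ 2 ∧
        s * p.γHat s < |∑ τ ∈ Finset.Icc 1 s, R.rowDev τ i ω|}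
      ≤ 2 * ENNReal.ofReal (p.δ / p.d) := by
  rw [two_mul (ENNReal.ofReal _)]
  refine le_trans (measure_mono fun ω hω => ?_) ((measure_union_le _ _).trans (add_le_add
    (R.measure_row_signed_le h hw hx s hs i 1 (by simp))
    (R.measure_row_signed_le h hw hx s hs i (-1) (by simp))))
  rcases lt_abs.1 hω.2 with h1 | h1
  · exact Or.inl ⟨hω.1, by rwa [one_mul]⟩
  · exact Or.inr ⟨hω.1, by rwa [neg_one_mul]⟩

lemma measure_gram_abs_le (h : p.Admissible)
    (hx : ∀ s ∈ Finset.Icc 1 T, ∀ i, |x s i| ≤ 1) (s : ℕ) (hs : s ∈ Finset.Icc 1 T)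
    (hs0 : p.s₀ < s) (i j : Fin p.d) :
    P {ω | p.gramDev s
        < |∑ τ ∈ Finset.Icc 1 s, (R.hEst τ i j (R.B' τ ω) ω - x τ i * x τ j)|}
      ≤ 2 * ENNReal.ofReal (p.δ / (p.d : ℝ) ^ 2) := by
  rw [Finset.mem_Icc] at hs
  have hL := h.L₂_pos
  have hg := h.one_le_g
  have hs' : (0 : ℝ) < s := by exact_mod_cast hs.1
  have hX : 0 < p.gramDev s := by unfold Params.gramDev; positivity
  have hX2 : p.gramDev s ^ 2 = 8 / 3 * (p.g * s * p.L₂) := by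
    unfold Params.gramDev
    rw [mul_pow, div_pow, mul_pow, Real.sq_sqrt (by norm_num), Real.sq_sqrt (by positivity)]
    ring
  set X := p.gramDev s
  set lam := 2 * p.L₂ / X with hlam
  have hlam0 : 0 < lam := by positivity
  have hmul : lam * X = 2 * p.L₂ := div_mul_cancel₀ _ hX.ne'
  have hlam2 : 2 / 3 * lam ^ 2 * p.g * s = p.L₂ := by
    rw [hlam, div_pow, hX2]; field_simp; norm_num
  have hlamg : lam * p.g ≤ 3 / 4 := by
    refine le_of_pow_le_pow_left₀ two_ne_zero (by norm_num) ?_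
    refine le_of_mul_le_mul_right ?_ hs'
    have e1 : (lam * p.g) ^ 2 * s = 3 / 2 * (p.g * p.L₂) := by
      have : (lam * p.g) ^ 2 * s = 3 / 2 * p.g * (2 / 3 * lam ^ 2 * p.g * s) := by ring
      rw [this, hlam2]; ring
    rw [e1]
    have := h.s₀_ge
    have : 0 < p.g * p.L₂ := by positivity
    linarith
  have key : ∀ ε : ℝ, |ε| = 1 →
      P {ω | X < ε * ∑ τ ∈ Finset.Icc 1 s, (R.hEst τ i j (R.B' τ ω) ω - x τ i * x τ j)}
        ≤ ENNReal.ofReal (p.δ / (p.d : ℝ) ^ 2) := by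
    intro ε hε
    have habs : |ε * lam| = lam := by rw [abs_mul, hε, one_mul, abs_of_pos hlam0]
    have hε2 : ε ^ 2 = 1 := by rw [← sq_abs, hε, one_pow]
    rw [← h.exp_neg_L₂]
    refine le_trans (measure_mono fun ω hω => ?_)
      (R.measure_gram_le h hx s hs.2 i j (ε * lam) (by rw [habs]; exact hlamg) p.L₂)
    simp only [Set.mem_ofPred_eq] at hω ⊢
    have h5 := mul_lt_mul_of_pos_left hω hlam0
    rw [hmul] at h5
    rw [mul_pow, hε2, one_mul, hlam2]
    linarith
  rw [two_mul]
  refine le_trans (measure_mono fun ω hω => ?_) ((measure_union_le _ _).trans (add_le_add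
    (key 1 (by simp)) (key (-1) (by simp))))
  rcases lt_abs.1 (Set.mem_ofPred_eq.mp hω) with h1 | h1
  · exact Or.inl (by simpa using h1)
  · exact Or.inr (by simpa using h1)

/-- The noise contributes to the regret at most the order of the square root of the accumulated
squared errors. -/
lemma measure_noise_sum_le (h : p.Admissible) (M : ℝ) (hM : 0 < M) :
    P {ω | ∑ τ ∈ Finset.Icc 1 T, R.predErr τ ω ^ 2 ≤ M ∧
        2 * (p.σ : ℝ) * √(2 * M * Real.log (1 / p.δ))
          < - (2 * ∑ τ ∈ Finset.Icc 1 T, R.predErr τ ω * R.η τ ω)}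
      ≤ ENNReal.ofReal p.δ := by
  rcases h.σ_nonneg.eq_or_lt with hσ | hσ
  · -- without noise the sum vanishes almost surely
    have hσ0 : p.σ = 0 := by exact_mod_cast hσ.symm
    have hη : ∀ τ ∈ Finset.Icc 1 T, ∀ᵐ ω ∂P, R.η τ ω = 0 := by
      intro τ hτ
      have h1 := R.η_law τ hτ
      rw [hσ0] at h1
      simp only [ne_eq, OfNat.ofNat_ne_zero, not_false_eq_true, zero_pow, gaussianReal_zero_var]
        at h1
      have hm : Measurable (R.η τ) := (R.η_meas τ hτ).mono (R.ℱ.le τ) le_rfl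
      have h2 : ∀ᵐ y ∂(P.map (R.η τ)), y = 0 := by
        rw [h1]; simp [ae_dirac_eq]
      exact ae_of_ae_map hm.aemeasurable h2
    have hall : ∀ᵐ ω ∂P, ∀ τ ∈ Finset.Icc 1 T, R.η τ ω = 0 :=
      (Finset.eventually_all _).2 hη
    refine le_trans (le_of_eq ?_) zero_le
    refine measure_eq_zero_iff_ae_notMem.2 (hall.mono fun ω hall hω => ?_)
    have h0 : ∑ τ ∈ Finset.Icc 1 T, R.predErr τ ω * R.η τ ω = 0 :=
      Finset.sum_eq_zero fun τ hτ => by rw [hall τ hτ, mul_zero]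
    have := hω.2
    rw [h0, ← hσ] at this
    simp at this
  · set L := Real.log (1 / p.δ) with hL
    have hL0 : 0 < L := by rw [hL, one_div, Real.log_inv]; linarith [h.log_δ_neg]
    have hδ : p.δ = Real.exp (-L) := by
      rw [hL, one_div, Real.log_inv, neg_neg, Real.exp_log h.hδ₀]
    rw [hδ]
    set Z := √(2 * M * L) with hZ
    have hZ0 : 0 < Z := Real.sqrt_pos.2 (by positivity)
    have hZ2 : Z ^ 2 = 2 * M * L := Real.sq_sqrt (by positivity)
    set lam := Z / (p.σ * M) with hlam
    have hlam0 : 0 < lam := by positivity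
    refine le_trans (measure_mono fun ω hω => ?_) (R.measure_noise_le h (-lam) L)
    simp only [Set.mem_ofPred_eq] at hω ⊢
    obtain ⟨h1, h2⟩ := hω
    have e1 : lam * (p.σ * Z) = 2 * L := by
      rw [hlam]; field_simp; linarith
    have e2 : lam ^ 2 / 2 * (p.σ : ℝ) ^ 2 * M = L := by
      rw [hlam, div_pow, hZ2]; field_simp
    have h3 : lam ^ 2 / 2 * (p.σ : ℝ) ^ 2 * ∑ τ ∈ Finset.Icc 1 T, R.predErr τ ω ^ 2 ≤ L := by
      rw [← e2]; gcongr
    have h4 := mul_lt_mul_of_pos_left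
      (show p.σ * Z < - ∑ τ ∈ Finset.Icc 1 T, R.predErr τ ω * R.η τ ω by linarith) hlam0
    rw [e1] at h4
    rw [neg_sq]
    linarith

end Run

end POSLR

namespace POSLR

/-! ### The analysis outside the exceptional events -/

namespace Run

variable {Ω : Type*} [mΩ : MeasurableSpace Ω] {P : Measure Ω} {p : Params} {T : ℕ}
  {x : ℕ → Fin p.d → ℝ} {wstar : Fin p.d → ℝ} (R : Run P p T x wstar)

/-- None of the exceptional events for the rows of the constraint and for the entries of the
estimated Gram matrix occurs. -/
structure Regular (ω : Ω) : Prop where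
  row : ∀ s ∈ Finset.Icc 1 T, ∀ i,
    2 * p.L₁ * p.varProxy s (∑ τ ∈ Finset.Icc 1 s, R.missed τ ω ^ 2) ≤ (s * p.γHat s) ^ 2 →
      |∑ τ ∈ Finset.Icc 1 s, R.rowDev τ i ω| ≤ s * p.γHat s
  gram : ∀ s ∈ Finset.Icc 1 T, p.s₀ < s → ∀ i j,
    |∑ τ ∈ Finset.Icc 1 s, (R.hEst τ i j (R.B' τ ω) ω - x τ i * x τ j)| ≤ p.gramDev s

/-- The linear term of the Dantzig selector in round `s`. -/
noncomputable def linTerm (s : ℕ) (ω : Ω) (i : Fin p.d) : ℝ :=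
  ∑ τ ∈ Finset.Icc 1 s,
    xHat (R.S (τ - 1) ω) p.k₀ (R.what (τ - 1) ω) (R.B' τ ω) (x τ) i * (wstar ⬝ᵥ x τ + R.η τ ω)

/-- The matrix of the Dantzig selector in round `s`. -/
noncomputable def gramMat (s : ℕ) (ω : Ω) : Matrix (Fin p.d) (Fin p.d) ℝ :=
  ∑ τ ∈ Finset.Icc 1 s, hHat (R.S (τ - 1) ω) p.k₀ (R.what (τ - 1) ω) (R.B' τ ω) (x τ)

/-- The target satisfies the constraint of the Dantzig selector in round `s`. -/
def TargetFeasible (s : ℕ) (ω : Ω) : Prop :=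
  DSFeasible (R.linTerm s ω) (R.gramMat s ω) s (p.γHat s) wstar

/-- The `ℓ₁`-error of the estimator of round `s` on the support of the target. -/
noncomputable def estErr (s : ℕ) (ω : Ω) : ℝ := l1 (restr (R.what s ω - wstar) (supp wstar))

lemma gramMat_apply (s : ℕ) (ω : Ω) (i j : Fin p.d) :
    R.gramMat s ω i j = ∑ τ ∈ Finset.Icc 1 s, R.hEst τ i j (R.B' τ ω) ω := by
  unfold gramMat
  rw [Matrix.sum_apply]; rfl

lemma linTerm_sub_mulVec (s : ℕ) (ω : Ω) (i : Fin p.d) :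
    R.linTerm s ω i - (R.gramMat s ω).mulVec wstar i = ∑ τ ∈ Finset.Icc 1 s, R.rowDev τ i ω := by
  unfold linTerm Matrix.mulVec dotProduct
  simp only [gramMat_apply, Finset.sum_mul]
  rw [Finset.sum_comm, ← Finset.sum_sub_distrib]
  refine Finset.sum_congr rfl fun τ _ => ?_
  simp only [rowDev, xEst, rowEst, hEst, rowErr, sub_mul, Finset.sum_sub_distrib, mul_add,
    Finset.mul_sum]
  have : ∑ j, xHat (R.S (τ - 1) ω) p.k₀ (R.what (τ - 1) ω) (R.B' τ ω) (x τ) i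
        * (wstar j * x τ j)
      = ∑ j, xHat (R.S (τ - 1) ω) p.k₀ (R.what (τ - 1) ω) (R.B' τ ω) (x τ) i
        * x τ j * wstar j := Finset.sum_congr rfl fun j _ => by ring
  rw [this]; ring

lemma targetFeasible_of_abs_le {s : ℕ} {ω : Ω} (hs : 1 ≤ s)
    (h : ∀ i, |∑ τ ∈ Finset.Icc 1 s, R.rowDev τ i ω| ≤ s * p.γHat s) : R.TargetFeasible s ω := by
  intro i
  have hs' : (0 : ℝ) < s := by exact_mod_cast hs
  rw [← mul_sub, R.linTerm_sub_mulVec, abs_mul, abs_of_pos (by positivity : 0 < 1 / (s : ℝ)),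
    one_div_mul_eq_div, div_le_iff₀ hs', mul_comm (p.γHat s)]
  exact h i

section

variable {R} {s : ℕ} {ω : Ω} (hs : s ∈ Finset.Icc 1 T) (hf : R.TargetFeasible s ω)
include hs hf

lemma what_solution : DSSolution (R.linTerm s ω) (R.gramMat s ω) s (p.γHat s) (R.what s ω) :=
  R.what_sol s hs ω ⟨wstar, hf⟩

lemma l1_what_le : l1 (R.what s ω) ≤ l1 wstar := (what_solution hs hf).2 wstar hf

lemma missed_succ_le (hsparse : (supp wstar).card ≤ p.k) :
    R.missed (s + 1) ω ≤ 2 * R.estErr s ω :=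
  l1_restr_compl_top_le (R.S_top s hs ω) hsparse (l1_what_le hs hf)

lemma abs_predErr_succ_le (hsparse : (supp wstar).card ≤ p.k)
    (hx : ∀ i, |x (s + 1) i| ≤ 1) : |R.predErr (s + 1) ω| ≤ 3 * R.estErr s ω := by
  refine (abs_dotProduct_le _ _ 1 hx).trans ?_
  rw [mul_one]
  exact l1_restr_top_sub_le (R.S_top s hs ω) hsparse (l1_what_le hs hf)

/-- The error bound for the estimator of a round in which the target is feasible. -/
lemma estErr_le (hreg : R.Regular ω) (hs0 : p.s₀ < s) (hsparse : (supp wstar).card ≤ p.k)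
    (hcompat : Compatible p.δS (supp wstar) 1 x s) :
    p.δS ^ 2 * R.estErr s ω ≤ p.k * (4 * p.γHat s
      + 4 * (2 * √6 / 3 * √(p.g * s * p.L₂) / s) * R.estErr s ω) := by
  refine dantzig_error (Finset.mem_Icc.1 hs).1 hsparse hcompat hf (what_solution hs hf)
    fun i j => ?_
  rw [R.gramMat_apply, ← Finset.sum_sub_distrib]
  exact hreg.gram s hs hs0 i j

end

lemma estErr_nonneg (s : ℕ) (ω : Ω) : 0 ≤ R.estErr s ω := l1_nonneg _

lemma missed_nonneg (s : ℕ) (ω : Ω) : 0 ≤ R.missed s ω := l1_nonneg _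

lemma sum_Icc_eq_add_sum_shift (f : ℕ → ℝ) (n s : ℕ) (h : n < s) :
    ∑ τ ∈ Finset.Icc 1 s, f τ
      = ∑ τ ∈ Finset.Icc 1 (n + 1), f τ + ∑ τ ∈ Finset.Ioc n (s - 1), f (τ + 1) := by
  induction s, h using Nat.le_induction with
  | base => simp
  | succ s hs ih =>
    obtain ⟨t, rfl⟩ : ∃ t, s = t + 1 := ⟨s - 1, by omega⟩
    rw [Finset.sum_Icc_succ_top (by omega), ih, Nat.add_sub_cancel, Nat.add_sub_cancel,
      ← Finset.sum_Ioc_consecutive _ (by omega : n ≤ t) (Nat.le_succ t), Nat.Ioc_succ_singleton,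
      Finset.sum_singleton, add_assoc]

/-- The target is feasible in all rounds: the masses missed by the predictions are controlled by the
error bounds of the previous rounds, and hence the variance proxy of the current round by its
threshold. -/
lemma targetFeasible (h : p.Admissible) (hL : 24 ≤ p.L₁) {ω : Ω} (hreg : R.Regular ω)
    (hw : l1 wstar ≤ 1) (hsparse : (supp wstar).card ≤ p.k)
    (hcompat : ∀ s ∈ Finset.Icc 1 T, p.s₀ < (s : ℝ) → Compatible p.δS (supp wstar) 1 x s)
    (s : ℕ) (hs : s ∈ Finset.Icc 1 T) : R.TargetFeasible s ω := by
  induction s using Nat.strong_induction_on with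
  | _ s ih =>
  have hs1 := (Finset.mem_Icc.1 hs).1
  have hsT := (Finset.mem_Icc.1 hs).2
  have hm1 : ∀ τ, R.missed τ ω ^ 2 ≤ 1 := fun τ =>
    pow_le_one₀ (R.missed_nonneg τ ω) (R.missed_le hw τ ω)
  have hQ : ∀ n : ℕ, ∑ τ ∈ Finset.Icc 1 n, R.missed τ ω ^ 2 ≤ n := fun n => by
    refine (Finset.sum_le_sum fun τ _ => hm1 τ).trans ?_
    simp
  refine R.targetFeasible_of_abs_le hs1 fun i => hreg.row s hs i ?_
  unfold Params.varProxy
  split_ifs with hs0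
  · exact h.variance_le_early s hs1 hs0 _ (hQ s)
  · refine h.variance_le_late hL s (not_le.1 hs0) _ (hQ s) fun hn2 => ?_
    rw [sum_Icc_eq_add_sum_shift _ p.n₂ s hn2, Finset.mul_sum]
    have := hQ (p.n₂ + 1)
    push_cast at this
    refine add_le_add this (Finset.sum_le_sum fun τ hτ => ?_)
    rw [Finset.mem_Ioc] at hτ
    have hτT : τ ∈ Finset.Icc 1 T := Finset.mem_Icc.2 (by omega)
    have hf := ih τ (by omega) hτT
    have hτ0 : p.s₀ < τ := by
      have h1 := h.le_n₂
      have h2 : (p.n₂ : ℝ) < τ := by exact_mod_cast hτ.1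
      linarith [h.s₀_pos]
    have hD := R.estErr_nonneg τ ω
    have herr := h.error_sq_le' hL τ hτ.1 _ hD
      (estErr_le hτT hf hreg hτ0 hsparse (hcompat τ hτT hτ0))
    have hq := pow_le_pow_left₀ (R.missed_nonneg _ ω) (missed_succ_le hτT hf hsparse) 2
    have hY := mul_le_mul_of_nonneg_right h.Y_le
      (sq_nonneg (p.b * √p.s₀ / τ + 1.07 * p.a / √τ))
    linarith

/-- The squared errors of the predictions add up to at most the leading part of the regret
bound. -/
lemma sum_predErr_sq_le (h : p.Admissible) (hL : 24 ≤ p.L₁) {ω : Ω} (hreg : R.Regular ω)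
    (hT : (p.s₁ + 1) ^ 2 < (T : ℝ)) (hx : ∀ s ∈ Finset.Icc 1 T, ∀ i, |x s i| ≤ 1)
    (hw : l1 wstar ≤ 1) (hsparse : (supp wstar).card ≤ p.k)
    (hcompat : ∀ s ∈ Finset.Icc 1 T, p.s₀ < (s : ℝ) → Compatible p.δS (supp wstar) 1 x s) :
    ∑ τ ∈ Finset.Icc 1 T, R.predErr τ ω ^ 2 ≤ p.mainBound T := by
  have hfeas := R.targetFeasible h hL hreg hw hsparse hcompat
  have hn2 := h.n₂_lt_of_lt T hT
  refine le_trans ?_ (h.sum_error_le_mainBound hL T hT)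
  rw [sum_Icc_eq_add_sum_shift _ p.n₂ T (by omega)]
  refine add_le_add ?_ (Finset.sum_le_sum fun τ hτ => ?_)
  · have h4 : ∀ τ ∈ Finset.Icc 1 (p.n₂ + 1), R.predErr τ ω ^ 2 ≤ 4 := by
      intro τ hτ
      rw [Finset.mem_Icc] at hτ
      have hτT : τ ∈ Finset.Icc 1 T := Finset.mem_Icc.2 (by omega)
      have hl1 : l1 (R.what (τ - 1) ω) ≤ 1 := by
        rcases Nat.eq_zero_or_pos (τ - 1) with h0 | h0
        · have hd : (0 : ℝ) < p.d := by linarith [h.d_ge]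
          rw [h0]
          unfold l1
          simp_rw [R.what_zero ω]
          rw [Finset.sum_const, Finset.card_univ, Fintype.card_fin, nsmul_eq_mul,
            abs_of_pos (by positivity)]
          exact le_of_eq (by field_simp)
        · have hm : τ - 1 ∈ Finset.Icc 1 T := Finset.mem_Icc.2 (by omega)
          exact (l1_what_le hm (hfeas _ hm)).trans hw
      have h2 : |R.predErr τ ω| ≤ 2 := by
        refine (abs_dotProduct_le _ _ 1 (hx τ hτT)).trans ?_
        have h5 := l1_sub_le (restr (R.what (τ - 1) ω) (R.S (τ - 1) ω)) wstar
        have h6 := l1_restr_le (R.what (τ - 1) ω) (R.S (τ - 1) ω)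
        linarith
      rw [← sq_abs]
      have := pow_le_pow_left₀ (abs_nonneg _) h2 2
      linarith
    refine (Finset.sum_le_sum h4).trans (le_of_eq ?_)
    simp; ring
  · rw [Finset.mem_Ioc] at hτ
    have hτT : τ ∈ Finset.Icc 1 T := Finset.mem_Icc.2 (by omega)
    have hτT' : τ + 1 ∈ Finset.Icc 1 T := Finset.mem_Icc.2 (by omega)
    have hτ0 : p.s₀ < τ := by
      have h1 := h.le_n₂
      have h2 : (p.n₂ : ℝ) < τ := by exact_mod_cast hτ.1
      linarith [h.s₀_pos]
    have hf := hfeas τ hτT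
    have herr := h.error_sq_le_sum hL τ hτ.1 _ (R.estErr_nonneg τ ω)
      (estErr_le hτT hf hreg hτ0 hsparse (hcompat τ hτT hτ0))
    have h3 := pow_le_pow_left₀ (abs_nonneg _)
      (abs_predErr_succ_le hτT hf hsparse (hx (τ + 1) hτT')) 2
    rw [sq_abs] at h3
    linarith

/-- The prediction only reads the attributes in `S (s - 1)`. -/
lemma regret_eq (ω : Ω) :
    R.regret ω = ∑ τ ∈ Finset.Icc 1 T, R.predErr τ ω ^ 2
      - 2 * ∑ τ ∈ Finset.Icc 1 T, R.predErr τ ω * R.η τ ω := by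
  have hrestr : ∀ (v u : Fin p.d → ℝ) (A : Finset (Fin p.d)),
      restr v A ⬝ᵥ restr u A = restr v A ⬝ᵥ u := by
    intro v u A
    refine Finset.sum_congr rfl fun i _ => ?_
    by_cases hi : i ∈ A <;> simp [restr, hi]
  unfold regret
  rw [Finset.mul_sum, ← Finset.sum_sub_distrib]
  refine Finset.sum_congr rfl fun τ _ => ?_
  unfold yhat y predErr
  rw [hrestr, sub_dotProduct]
  ring

variable [IsProbabilityMeasure P]

/-- The exceptional events of one round have probability at most `4 * δ`. -/
lemma measure_round_le (h : p.Admissible) (hw : l1 wstar ≤ 1)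
    (hx : ∀ s ∈ Finset.Icc 1 T, ∀ i, |x s i| ≤ 1) (s : ℕ) (hs : s ∈ Finset.Icc 1 T) :
    P {ω | ¬ ((∀ i, 2 * p.L₁ * p.varProxy s (∑ τ ∈ Finset.Icc 1 s, R.missed τ ω ^ 2)
          ≤ (s * p.γHat s) ^ 2 → |∑ τ ∈ Finset.Icc 1 s, R.rowDev τ i ω| ≤ s * p.γHat s) ∧
        (p.s₀ < s → ∀ i j,
          |∑ τ ∈ Finset.Icc 1 s, (R.hEst τ i j (R.B' τ ω) ω - x τ i * x τ j)| ≤ p.gramDev s))}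
      ≤ ENNReal.ofReal (4 * p.δ) := by
  have hd := h.d_ge
  have hδ := h.hδ₀
  have hcard : ∀ c : ℝ, 0 ≤ c → ∑ _i : Fin p.d, 2 * ENNReal.ofReal c
      = ENNReal.ofReal (2 * (p.d * c)) := by
    intro c hc
    rw [Finset.sum_const, Finset.card_univ, Fintype.card_fin, nsmul_eq_mul,
      ENNReal.ofReal_mul (by norm_num), ENNReal.ofReal_mul (by positivity), ENNReal.ofReal_natCast,
      ENNReal.ofReal_ofNat]
    ring
  have hrow : P (⋃ i, {ω | 2 * p.L₁ * p.varProxy s (∑ τ ∈ Finset.Icc 1 s, R.missed τ ω ^ 2)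
        ≤ (s * p.γHat s) ^ 2 ∧ s * p.γHat s < |∑ τ ∈ Finset.Icc 1 s, R.rowDev τ i ω|})
      ≤ ENNReal.ofReal (2 * p.δ) := by
    refine (measure_iUnion_fintype_le _ _).trans
      ((Finset.sum_le_sum fun i _ => R.measure_row_abs_le h hw hx s hs i).trans (le_of_eq ?_))
    rw [hcard _ (by positivity)]
    congr 1; field_simp
  have hgram : P (⋃ i, ⋃ j, {ω | p.s₀ < s ∧ p.gramDev s
        < |∑ τ ∈ Finset.Icc 1 s, (R.hEst τ i j (R.B' τ ω) ω - x τ i * x τ j)|})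
      ≤ ENNReal.ofReal (2 * p.δ) := by
    refine (measure_iUnion_fintype_le _ _).trans
      ((Finset.sum_le_sum fun i _ => (measure_iUnion_fintype_le _ _).trans
        (Finset.sum_le_sum fun j _ => (?_ : _ ≤ 2 * ENNReal.ofReal (p.δ / (p.d : ℝ) ^ 2)))).trans
          (le_of_eq ?_))
    · by_cases hs0 : p.s₀ < s
      · simpa only [hs0, true_and] using R.measure_gram_abs_le h hx s hs hs0 i j
      · simp [hs0]
    · rw [hcard _ (by positivity), Finset.sum_const, Finset.card_univ, Fintype.card_fin,
        nsmul_eq_mul, ← ENNReal.ofReal_natCast, ← ENNReal.ofReal_mul (by positivity)]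
      congr 1; field_simp
  have h4 : ENNReal.ofReal (4 * p.δ) = ENNReal.ofReal (2 * p.δ) + ENNReal.ofReal (2 * p.δ) := by
    rw [← ENNReal.ofReal_add (by positivity) (by positivity)]; congr 1; ring
  rw [h4]
  refine (measure_mono fun ω hω => ?_).trans ((measure_union_le _ _).trans (add_le_add hrow hgram))
  simp only [Set.mem_ofPred_eq, not_and_or, not_forall, not_le] at hω
  rcases hω with ⟨i, h1, h2⟩ | ⟨h0, i, j, h2⟩
  · exact Or.inl (Set.mem_iUnion.2 ⟨i, h1, h2⟩)
  · exact Or.inr (Set.mem_iUnion.2 ⟨i, Set.mem_iUnion.2 ⟨j, h0, h2⟩⟩)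

lemma measure_not_regular_le (h : p.Admissible) (hw : l1 wstar ≤ 1)
    (hx : ∀ s ∈ Finset.Icc 1 T, ∀ i, |x s i| ≤ 1) :
    P {ω | ¬ R.Regular ω} ≤ ENNReal.ofReal (4 * T * p.δ) := by
  have hsum : ∑ s ∈ Finset.Icc 1 T, ENNReal.ofReal (4 * p.δ) = ENNReal.ofReal (4 * T * p.δ) := by
    have hδ := h.hδ₀
    rw [Finset.sum_const, Nat.card_Icc, Nat.add_sub_cancel, nsmul_eq_mul, ← ENNReal.ofReal_natCast,
      ← ENNReal.ofReal_mul (by positivity)]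
    congr 1; ring
  rw [← hsum]
  refine (measure_mono fun ω hω => ?_).trans ((measure_biUnion_finset_le (Finset.Icc 1 T) _).trans
    (Finset.sum_le_sum fun s hs => R.measure_round_le h hw hx s hs))
  by_contra hcon
  simp only [Set.mem_iUnion, not_exists, Set.mem_ofPred_eq, not_not] at hcon
  exact hω ⟨fun s hs => (hcon s hs).1, fun s hs => (hcon s hs).2⟩

/-- The regret bound for small confidence parameters. -/
lemma le_measure_regret (h : p.Admissible) (hL : 24 ≤ p.L₁)
    (hT : (p.s₁ + 1) ^ 2 < (T : ℝ)) (hx : ∀ s ∈ Finset.Icc 1 T, ∀ i, |x s i| ≤ 1)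
    (hw : l1 wstar ≤ 1) (hsparse : (supp wstar).card ≤ p.k)
    (hcompat : ∀ s ∈ Finset.Icc 1 T, p.s₀ < (s : ℝ) → Compatible p.δS (supp wstar) 1 x s) :
    1 - (4 * T + 1) * p.δ ≤ P.real {ω | R.regret ω ≤ p.regretBound T} := by
  have hδ := h.hδ₀
  have hM := h.mainBound_pos T hT
  set good := {ω | R.regret ω ≤ p.regretBound T}
  have hbad : P goodᶜ ≤ ENNReal.ofReal ((4 * T + 1) * p.δ) := by
    have e : ENNReal.ofReal ((4 * T + 1) * p.δ)
        = ENNReal.ofReal (4 * T * p.δ) + ENNReal.ofReal p.δ := by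
      rw [← ENNReal.ofReal_add (by positivity) hδ.le]; congr 1; ring
    rw [e]
    refine (measure_mono fun ω hω => ?_).trans ((measure_union_le _ _).trans
      (add_le_add (R.measure_not_regular_le h hw hx) (R.measure_noise_sum_le h _ hM)))
    by_cases hreg : R.Regular ω
    · have h1 := R.sum_predErr_sq_le h hL hreg hT hx hw hsparse hcompat
      refine Or.inr ⟨h1, ?_⟩
      by_contra h2
      refine hω ?_
      show R.regret ω ≤ p.regretBound T
      rw [R.regret_eq]
      unfold Params.regretBound
      linarith
    · exact Or.inl hreg
  have h1 : 1 ≤ P good + P goodᶜ := by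
    rw [← measure_univ (μ := P), ← Set.union_compl_self good]
    exact measure_union_le _ _
  have h2 : (1 : ℝ) ≤ P.real good + (4 * T + 1) * p.δ := by
    have h3 := h1.trans (add_le_add_right hbad _)
    rw [← ofReal_measureReal (measure_ne_top P good), ← ENNReal.ofReal_add measureReal_nonneg
      (by positivity), ENNReal.one_le_ofReal] at h3
    exact h3
  linarith

end Run

end POSLR

theorem theorem2 {Ω : Type*} [MeasurableSpace Ω] (P : Measure Ω) [IsProbabilityMeasure P]
    (p : POSLR.Params) (T : ℕ) (x : ℕ → Fin p.d → ℝ) (wstar : Fin p.d → ℝ)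
    (hk : 3 ≤ p.k) (hk₀ : 3 ≤ p.k₀) (hd : p.k + p.k₀ ≤ p.d)
    (hδ₀ : 0 < p.δ) (hδ₁ : p.δ < 1) (hδS : 0 < p.δS)
    (hκ : 1.2 ≤ p.κ) (hσκ : p.σ ≤ 1 ∨ 1.7 ≤ p.κ)
    (hT : (p.s₁ + 1) ^ 2 < (T : ℝ))
    (hx : ∀ s ∈ Finset.Icc 1 T, ∀ i, |x s i| ≤ 1)
    (hw : POSLR.l1 wstar ≤ 1) (hsparse : (POSLR.supp wstar).card ≤ p.k)
    (hcompat : ∀ s ∈ Finset.Icc 1 T, p.s₀ < (s : ℝ) →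
      POSLR.Compatible p.δS (POSLR.supp wstar) 1 x s)
    (R : POSLR.Run P p T x wstar) :
    1 - ((T : ℝ) * (6 + Real.logb 1.5 (((p.d : ℝ) + p.k) / ((p.k : ℝ) - 2))) + 1) * p.δ
        ≤ P.real {ω | R.regret ω ≤ p.regretBound T} ∧
      p.regretBound T ≤ 10 ^ 7 * (1 + p.κ * (p.σ : ℝ)) ^ 2 *
        ((p.k : ℝ) ^ 2 * p.d' ^ 2 / (p.δS ^ 4 * (p.k₀ : ℝ) ^ 2) * Real.log (p.d / p.δ)
          + (p.k : ℝ) ^ 2 * p.d' / (p.δS ^ 4 * (p.k₀ : ℝ)) * Real.log T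
            * Real.log (p.d * T / p.δ)) := by 
  -- the bound `δS ≤ 1` is not needed for the comparison of `s₀` with `T` from which it follows
  have h₁ : POSLR.Params.Admissible { p with δS := 1 } :=
    ⟨hk, hk₀, hd, hδ₀, hδ₁, one_pos, by norm_num, hκ, hσκ⟩
  have hR : 1 ≤ (p.d' - 2) / ((p.k₀ : ℝ) - 2) := h₁.one_le_R
  have hg : 1 ≤ p.g := h₁.one_le_g
  have hL₁ : 7 / 4 ≤ p.L₁ := h₁.L₁_ge
  have hL₂ : 0 < p.L₂ := h₁.L₂_pos
  have hs₀ : 0 ≤ p.s₀ := by unfold POSLR.Params.s₀; positivity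
  have hs₁ : p.s₀ ≤ p.s₁ := by
    have e : p.s₁ = p.s₀ * ((p.d' - 2) / ((p.k₀ : ℝ) - 2) * p.L₁) := by
      unfold POSLR.Params.s₁ POSLR.Params.s₀; ring
    rw [e]
    exact le_mul_of_one_le_right hs₀ (one_le_mul_of_one_le_of_one_le hR (by linarith))
  have hTs : p.s₀ < (T : ℝ) := by nlinarith
  have hT1 : 1 ≤ T := by
    have : (0 : ℝ) < T := by linarith
    exact_mod_cast this
  have hTmem : T ∈ Finset.Icc 1 T := Finset.mem_Icc.2 ⟨hT1, le_rfl⟩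
  have h : p.Admissible :=
    ⟨hk, hk₀, hd, hδ₀, hδ₁, hδS,
      POSLR.sq_le_one_of_compatible hT1 hx (hcompat T hTmem hTs), hκ, hσκ⟩
  refine ⟨?_, h.regretBound_le T hT⟩
  have hlogb : 0 ≤ Real.logb 1.5 (((p.d : ℝ) + p.k) / ((p.k : ℝ) - 2)) := by
    refine Real.logb_nonneg (by norm_num) ?_
    have := h.k_ge
    have := h.d_ge
    rw [le_div_iff₀ (by linarith)]
    linarith
  set ℓ := Real.logb 1.5 (((p.d : ℝ) + p.k) / ((p.k : ℝ) - 2))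
  have hT0 : (0 : ℝ) ≤ T := Nat.cast_nonneg T
  have hTl : 0 ≤ (T : ℝ) * ℓ * p.δ := by positivity
  -- otherwise the asserted probability is not positive
  by_cases hδT : 6 * (T : ℝ) * p.δ < 1
  · refine le_trans ?_ (R.le_measure_regret h (h.L₁_ge_of_mul_lt T hT hδT) hT hx hw hsparse hcompat)
    have : 0 ≤ (T : ℝ) * p.δ := by positivity
    linarith
  · refine le_trans ?_ measureReal_nonneg
    linarith
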